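/- **Setting.** Manifolds are smooth, finite-dimensional, without boundary, Hausdorff and second countable. Let $\Gamma$ be a strict Lie 2-group, given by a crossed module $(G,H,t,\alpha)$ of Lie groups: $t:H\to G$ is a Lie group homomorphism and $\alpha:G\times H\to H$ a smooth action by group automorphisms with $\alpha(t(h),x)=hxh^{-1}$ and $t(\alpha(g,h))=g\,t(h)\,g^{-1}$. As a groupoid, $\Gamma$ has objects $G$ and morphisms $H\ltimes G$, with $s(h,g)=g$, $t(h,g)=t(h)g$, $(h_2,g_2)\circ(h_1,g_1)=(h_2h_1,g_1)$. Let $\mathfrak g,\mathfrak h$ be the Lie algebras, $t_*:\mathfrak h\to\mathfrak g$ the differential of $t$, $(\alpha_g)_*:\mathfrak h\to\mathfrak h$ the differential of $\alpha_g=\alpha(g,\cdot)$ at $1$, $\alpha_*:\mathfrak g\times\mathfrak h\to\mathfrak h$ the differential of $g\mapsto(\alpha_g)_*$ at $1$, and $(\tilde\alpha_h)_*:\mathfrak g\to\mathfrak h$ the differential at $1$ of $\tilde\alpha_h(g)=h^{-1}\alpha(g,h)$. Write $\gamma=(\mathfrak h,\mathfrak g,t_*,\alpha_*)$. *Forms.*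 Let $\mathcal X$ be a Lie groupoid with objects $\mathcal X_0$, morphisms $\mathcal X_1$, source $s$ and target $t$. An element $\Psi\in\Omega^p(\mathcal X,\gamma)$ is a triple of smooth forms $\Psi^a\in\Omega^p(\mathcal X_0,\mathfrak g)$, $\Psi^b\in\Omega^p(\mathcal X_1,\mathfrak h)$, $\Psi^c\in\Omega^{p+1}(\mathcal X_0,\mathfrak h)$ with $\Delta\Psi^a=t_*(\Psi^b)$ and $\Delta\Psi^b=0$, where $\Delta=t^*-s^*$ for forms on $\mathcal X_0$, and $\Delta=\mathrm{pr}_1^*-c^*+\mathrm{pr}_2^*$ for forms on $\mathcal X_1$, with $c$ the composition map on the manifold of composable pairs. The differential $\mathrm D\Psi$ has components $$(\mathrm D\Psi)^a=\mathrm d\Psi^a-(-1)^pt_*(\Psi^c),\quad(\mathrm D\Psi)^b=\mathrm d\Psi^b-(-1)^p\Delta\Psi^c,\quad(\mathrm D\Psi)^c=\mathrm d\Psi^c,$$ and for $\Psi$ of degree $k$ and $\Phi$ of degree $l$ the product $[\Psi\wedge\Phi]$ has components $$[\Psi^a\wedge\Phi^a],\qquad[\Psi^b\wedge\Phi^b]+\alpha_*(s^*\Psi^a\wedge\Phi^b)-(-1)^{kl}\alpha_*(s^*\Phi^a\wedge\Psi^b),\qquad\alpha_*(\Psi^a\wedge\Phi^c)-(-1)^{kl}\alpha_*(\Phi^a\wedge\Psi^c).$$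 Pullback along smooth functors is componentwise. For a smooth functor $F:\mathcal X\to\Gamma$, given by $F_0:\mathcal X_0\to G$ and $(F_H,F_G):\mathcal X_1\to H\ltimes G$, $\mathrm{Ad}_F(\Psi)$ has components $$\mathrm{Ad}_{F_0}(\Psi^a),\qquad\mathrm{Ad}_{F_H}((\alpha_{F_G})_*(\Psi^b))+(\tilde\alpha_{F_H^{-1}})_*(\mathrm{Ad}_{F_G}(s^*\Psi^a)),\qquad(\alpha_{F_0})_*(\Psi^c),$$ and $\mathrm{Ad}_F^{-1}=\mathrm{Ad}_{F^{-1}}$ with the pointwise inverse $F^{-1}$. The Maurer–Cartan form $\Theta\in\Omega^1(\Gamma,\gamma)$ has components $\Theta^a=\theta^G$, $\Theta^b=(\alpha_{\mathrm{pr}_G^{-1}})_*(\mathrm{pr}_H^*\theta^H)$, $\Theta^c=0$, where $\theta^G,\theta^H$ are the left-invariant Maurer–Cartan forms. *Bundles and connections.* A principal $\Gamma$-2-bundle over a manifold $M$ is a Lie groupoid $\mathcal P$ with a surjective submersion $\pi:\mathcal P_0\to M$ such that $\pi\circ s=\pi\circ t$, and a smooth functor $R:\mathcal P\times\Gamma\to\mathcal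 P$ which is a (strict) right action of $\Gamma$ and preserves $\pi$, such that $(\mathrm{pr}_{\mathcal P},R):\mathcal P\times\Gamma\to\mathcal P\times_M\mathcal P$ is a weak equivalence of Lie groupoids (smoothly essentially surjective and smoothly fully faithful). A connection on $\mathcal P$ is a form $\Omega\in\Omega^1(\mathcal P,\gamma)$ such that over $\mathcal P\times\Gamma$ $$R^*\Omega=\mathrm{Ad}^{-1}_{\mathrm{pr}_\Gamma}(\mathrm{pr}_{\mathcal P}^*\Omega)+\mathrm{pr}_\Gamma^*\Theta .$$ Its curvature is $\mathrm{curv}(\Omega)=\mathrm D\Omega+\tfrac12[\Omega\wedge\Omega]$. **Theorem.** Let $\Omega$ be a connection on a principal $\Gamma$-2-bundle $\mathcal P$ over $M$. Then $\mathrm{curv}(\Omega)\in\Omega^2(\mathcal P,\gamma)$, and (a) (Bianchi identity) $\mathrm D\,\mathrm{curv}(\Omega)=[\mathrm{curv}(\Omega)\wedge\Omega]$; (b) (equivariance) $R^*\mathrm{curv}(\Omega)=\mathrm{Ad}^{-1}_{\mathrm{pr}_\Gamma}(\mathrm{pr}_{\mathcal P}^*\mathrm{curv}(\Omega))$ over $\mathcal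 P\times\Gamma$. -/

import Mathlib

open scoped Manifold ContDiff Topology

noncomputable section

namespace TwoBundle

/-! ### Vector-valued differential forms on manifolds

Mathlib's tangent space `TangentSpace I x` of a manifold modelled on `I : ModelWithCorners ℝ E K`
is, by definition, the model vector space `E` for every point `x` (the identification is made by
the preferred chart at `x`), and `mfderiv I I' f x` is the tangent map with respect to these
identifications. We therefore write `E` for `T_x X`. -/

section Forms

variable {E : Type*} [NormedAddCommGroup E] [NormedSpace ℝ E]
  {K : Type*} [TopologicalSpace K]
  {E' : Type*} [NormedAddCommGroup E'] [NormedSpace ℝ E']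
  {K' : Type*} [TopologicalSpace K']
  {V W U : Type*} [NormedAddCommGroup V] [NormedSpace ℝ V]
  [NormedAddCommGroup W] [NormedSpace ℝ W] [NormedAddCommGroup U] [NormedSpace ℝ U]

/-- The tangent map `T_x X → T_{f x} Y` of `f` at `x`. -/
def tmap (I : ModelWithCorners ℝ E K) (I' : ModelWithCorners ℝ E' K')
    {X : Type*} [TopologicalSpace X] [ChartedSpace K X]
    {Y : Type*} [TopologicalSpace Y] [ChartedSpace K' Y] (f : X → Y) (x : X) : E →L[ℝ] E' :=
  mfderiv I I' f x

/-- Fields of alternating `n`-linear forms on the tangent spaces `T_x X = E` of a manifold `X`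
modelled on `E`, with values in `V`. Smoothness is the separate predicate `DForm.IsSmooth`. -/
abbrev DForm (E : Type*) [NormedAddCommGroup E] [NormedSpace ℝ E] (X : Type*)
    (n : ℕ) (V : Type*) [NormedAddCommGroup V] [NormedSpace ℝ V] : Type _ :=
  X → E [⋀^Fin n]→L[ℝ] V

namespace DForm

variable (I : ModelWithCorners ℝ E K) {X : Type*} [TopologicalSpace X] [ChartedSpace K X]
  (I' : ModelWithCorners ℝ E' K') {Y : Type*} [TopologicalSpace Y] [ChartedSpace K' Y]
  {k l n : ℕ}

/-- The pullback `f^* φ` along `f : X → Y`. -/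
def pullback (f : X → Y) (φ : DForm E' Y n V) : DForm E X n V :=
  fun x => (φ (f x)).compContinuousLinearMap (tmap I I' f x)

/-- The coordinate representation of a form in the preferred chart at `x₀`: its pullback along
the inverse chart, as a form on the model vector space. -/
def chartRep (φ : DForm E X n V) (x₀ : X) : E → E [⋀^Fin n]→L[ℝ] V :=
  pullback 𝓘(ℝ, E) I (extChartAt I x₀).symm φ

/-- A form is smooth if all its coordinate representations are. -/
def IsSmooth (φ : DForm E X n V) : Prop :=
  ∀ x₀ : X, ContDiffOn ℝ ∞ (chartRep I φ x₀) (extChartAt I x₀).target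

/-- The exterior derivative on a manifold without boundary: at `x` it is the exterior derivative
of the coordinate representation in the chart at `x`, transported back to `T_x X`. -/
def extD (φ : DForm E X n V) : DForm E X (n + 1) V :=
  fun x => (extDeriv (chartRep I φ x) (extChartAt I x x)).compContinuousLinearMap
    (tmap I 𝓘(ℝ, E) (extChartAt I x) x)

/-- Apply a point-dependent linear map to the values of a form: `(L(φ))_x = L_x ∘ φ_x`. -/
def mapVal {X : Type*} (L : X → V →L[ℝ] W) (φ : DForm E X n V) : DForm E X n W :=
  fun x => (L x).compContinuousAlternatingMap (φ x)

/-- Regard a form of degree `k` as a form of degree `l = k`. -/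
def castDeg {X : Type*} (h : k = l) (φ : DForm E X k V) : DForm E X l V := h ▸ φ

theorem update_castAdd_left {T : Type*} (inst : DecidableEq (Fin (k + l)))
    (v : Fin (k + l) → T) (i : Fin k) (x : T) :
    (fun a => @Function.update _ _ inst v (Fin.castAdd l i) x (Fin.castAdd l a)) =
      Function.update (fun a => v (Fin.castAdd l a)) i x := by
  funext a
  by_cases h : a = i
  · subst h; simp
  · rw [Function.update_of_ne h, Function.update_of_ne]
    exact fun h' => h (Fin.castAdd_injective k l h')

theorem update_castAdd_right {T : Type*} (inst : DecidableEq (Fin (k + l)))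
    (v : Fin (k + l) → T) (i : Fin k) (x : T) :
    (fun a => @Function.update _ _ inst v (Fin.castAdd l i) x (Fin.natAdd k a)) =
      fun a => v (Fin.natAdd k a) := by
  funext a
  rw [Function.update_of_ne]
  intro h
  have := congrArg Fin.val h
  simp at this
  omega

theorem update_natAdd_left {T : Type*} (inst : DecidableEq (Fin (k + l)))
    (v : Fin (k + l) → T) (j : Fin l) (x : T) :
    (fun a => @Function.update _ _ inst v (Fin.natAdd k j) x (Fin.castAdd l a)) =
      fun a => v (Fin.castAdd l a) := by
  funext a
  rw [Function.update_of_ne]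
  intro h
  have := congrArg Fin.val h
  simp at this
  omega

theorem update_natAdd_right {T : Type*} (inst : DecidableEq (Fin (k + l)))
    (v : Fin (k + l) → T) (j : Fin l) (x : T) :
    (fun a => @Function.update _ _ inst v (Fin.natAdd k j) x (Fin.natAdd k a)) =
      Function.update (fun a => v (Fin.natAdd k a)) j x := by
  funext a
  by_cases h : a = j
  · subst h; simp
  · rw [Function.update_of_ne h, Function.update_of_ne]
    exact fun h' => h (Fin.natAdd_injective l k h')

/-- The multilinear map `(v₁, …, v_{k+l}) ↦ B (φ (v₁, …, v_k)) (ψ (v_{k+1}, …, v_{k+l}))`. -/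
def mulMultilinear {T : Type*} [AddCommGroup T] [Module ℝ T] [TopologicalSpace T]
    (B : V →L[ℝ] W →L[ℝ] U) (φ : T [⋀^Fin k]→L[ℝ] V) (ψ : T [⋀^Fin l]→L[ℝ] W) :
    ContinuousMultilinearMap ℝ (fun _ : Fin (k + l) => T) U where
  toFun v := B (φ fun i => v (Fin.castAdd l i)) (ψ fun j => v (Fin.natAdd k j))
  map_update_add' := by
    intro inst v i x y
    induction i using Fin.addCases with
    | left i => simp [update_castAdd_left, update_castAdd_right]
    | right j => simp [update_natAdd_left, update_natAdd_right]
  map_update_smul' := by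
    intro inst v i c x
    induction i using Fin.addCases with
    | left i => simp [update_castAdd_left, update_castAdd_right]
    | right j => simp [update_natAdd_left, update_natAdd_right]
  cont := by
    have h₁ : Continuous fun v : Fin (k + l) → T => φ fun i => v (Fin.castAdd l i) :=
      φ.cont.comp (by fun_prop)
    have h₂ : Continuous fun v : Fin (k + l) → T => ψ fun j => v (Fin.natAdd k j) :=
      ψ.cont.comp (by fun_prop)
    exact (B.continuous.comp h₁).clm_apply h₂

/-- The wedge product of two vector-valued forms along a bilinear map `B` of their values,
`B(φ ∧ ψ)(v₁, …, v_{k+l}) =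
  1/(k! l!) ∑_σ sign(σ) B(φ(v_{σ(1)}, …, v_{σ(k)}), ψ(v_{σ(k+1)}, …, v_{σ(k+l)}))`. -/
def wedge {X : Type*} (B : V →L[ℝ] W →L[ℝ] U) (φ : DForm E X k V) (ψ : DForm E X l W) :
    DForm E X (k + l) U :=
  fun x => ((k.factorial * l.factorial : ℝ)⁻¹) •
    ContinuousMultilinearMap.alternatization (mulMultilinear B (φ x) (ψ x))

end DForm

end Forms

/-! ### Lie groups and crossed modules

The Lie algebra of a Lie group `G` modelled on `EG` is `T_1 G`, which in Mathlib is by definition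
the model space `EG`. -/

section LieGroups

variable {EG : Type*} [NormedAddCommGroup EG] [NormedSpace ℝ EG]
  {G : Type*} [TopologicalSpace G] [ChartedSpace EG G] [Group G]

theorem lieGroup_minSmoothness [LieGroup 𝓘(ℝ, EG) ∞ G] :
    LieGroup 𝓘(ℝ, EG) (minSmoothness ℝ 3) G := by
  have : minSmoothness ℝ 3 ≤ (∞ : WithTop ℕ∞) := by
    simp only [minSmoothness_of_isRCLikeNormedField]
    exact ENat.LEInfty.out
  exact LieGroup.of_le this

/-- Mathlib's Lie bracket on `T_1 G` (of left invariant vector fields). -/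
abbrev brk (EG : Type*) [NormedAddCommGroup EG] [NormedSpace ℝ EG]
    (G : Type*) [TopologicalSpace G] [ChartedSpace EG G] [Group G] (A B : EG) : EG :=
  Bracket.bracket (L := GroupLieAlgebra 𝓘(ℝ, EG) G) (M := GroupLieAlgebra 𝓘(ℝ, EG) G) A B

/-- The Lie bracket of the Lie algebra of `G`, as a continuous bilinear map. -/
def lieBr (EG : Type*) [NormedAddCommGroup EG] [NormedSpace ℝ EG] [FiniteDimensional ℝ EG]
    (G : Type*) [TopologicalSpace G] [ChartedSpace EG G] [Group G] [LieGroup 𝓘(ℝ, EG) ∞ G] :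
    EG →L[ℝ] EG →L[ℝ] EG :=
  haveI : LieGroup 𝓘(ℝ, EG) (minSmoothness ℝ 3) G := lieGroup_minSmoothness
  haveI : CompleteSpace EG := FiniteDimensional.complete ℝ EG
  LinearMap.toContinuousBilinearMap <|
    LinearMap.mk₂ ℝ (brk EG G)
      (add_lie (L := GroupLieAlgebra 𝓘(ℝ, EG) G) (M := GroupLieAlgebra 𝓘(ℝ, EG) G))
      (smul_lie (L := GroupLieAlgebra 𝓘(ℝ, EG) G) (M := GroupLieAlgebra 𝓘(ℝ, EG) G))
      (lie_add (L := GroupLieAlgebra 𝓘(ℝ, EG) G) (M := GroupLieAlgebra 𝓘(ℝ, EG) G))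
      (lie_smul (L := GroupLieAlgebra 𝓘(ℝ, EG) G) (M := GroupLieAlgebra 𝓘(ℝ, EG) G))

/-- The adjoint action of `G` on its Lie algebra. -/
def Ad (g : G) : EG →L[ℝ] EG :=
  tmap 𝓘(ℝ, EG) 𝓘(ℝ, EG) (fun x : G => g * x * g⁻¹) 1

/-- The (left invariant) Maurer-Cartan form `θ_g(v) = g⁻¹ v`. -/
def maurerCartan : DForm EG G 1 EG :=
  fun g => ContinuousAlternatingMap.ofSubsingleton ℝ EG EG (0 : Fin 1)
    (tmap 𝓘(ℝ, EG) 𝓘(ℝ, EG) (fun x : G => g⁻¹ * x) g)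

end LieGroups

/-- The structure maps of a groupoid with objects `X₀` and morphisms `X₁`. The composition
`comp f g` is `f ∘ g`; its values matter only for `src f = tgt g`. -/
structure GpdStr (X₀ X₁ : Type*) where
  src : X₁ → X₀
  tgt : X₁ → X₀
  comp : X₁ → X₁ → X₁
  one : X₀ → X₁
  inv : X₁ → X₁

/-- The product of two groupoids. -/
def GpdStr.prod {X₀ X₁ Y₀ Y₁ : Type*} (X : GpdStr X₀ X₁) (Y : GpdStr Y₀ Y₁) :
    GpdStr (X₀ × Y₀) (X₁ × Y₁) where
  src f := (X.src f.1, Y.src f.2)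
  tgt f := (X.tgt f.1, Y.tgt f.2)
  comp f g := (X.comp f.1 g.1, Y.comp f.2 g.2)
  one x := (X.one x.1, Y.one x.2)
  inv f := (X.inv f.1, Y.inv f.2)

/-- A crossed module of Lie groups `(G, H, t, α)`, i.e. a strict Lie 2-group. -/
structure CrossedModule (EG : Type*) [NormedAddCommGroup EG] [NormedSpace ℝ EG]
    (G : Type*) [TopologicalSpace G] [ChartedSpace EG G] [Group G]
    (EH : Type*) [NormedAddCommGroup EH] [NormedSpace ℝ EH]
    (H : Type*) [TopologicalSpace H] [ChartedSpace EH H] [Group H] where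
  t : H →* G
  α : G →* MulAut H
  smooth_t : ContMDiff 𝓘(ℝ, EH) 𝓘(ℝ, EG) ∞ t
  smooth_α : ContMDiff (𝓘(ℝ, EG).prod 𝓘(ℝ, EH)) 𝓘(ℝ, EH) ∞ fun p : G × H => α p.1 p.2
  α_t : ∀ h x : H, α (t h) x = h * x * h⁻¹
  t_α : ∀ (g : G) (h : H), t (α g h) = g * t h * g⁻¹

namespace CrossedModule

variable {EG : Type*} [NormedAddCommGroup EG] [NormedSpace ℝ EG]
  {G : Type*} [TopologicalSpace G] [ChartedSpace EG G] [Group G]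
  {EH : Type*} [NormedAddCommGroup EH] [NormedSpace ℝ EH]
  {H : Type*} [TopologicalSpace H] [ChartedSpace EH H] [Group H]
  (Γ : CrossedModule EG G EH H)

/-- The groupoid underlying the Lie 2-group: objects `G`, morphisms `H × G`, where `(h, g)` is a
morphism from `g` to `t(h) g`. -/
def gpd : GpdStr G (H × G) where
  src x := x.2
  tgt x := Γ.t x.1 * x.2
  comp y x := (y.1 * x.1, x.2)
  one g := (1, g)
  inv x := (x.1⁻¹, Γ.t x.1 * x.2)

/-- The multiplication of the semi-direct product `H ⋉ G`. -/
def morMul (x y : H × G) : H × G := (x.1 * Γ.α x.2 y.1, x.2 * y.2)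

/-- The inverse in the semi-direct product `H ⋉ G`. -/
def morInv (x : H × G) : H × G := (Γ.α x.2⁻¹ x.1⁻¹, x.2⁻¹)

/-- `t_* : 𝔥 → 𝔤`, the differential of `t` at `1`. -/
def tStar : EH →L[ℝ] EG := tmap 𝓘(ℝ, EH) 𝓘(ℝ, EG) Γ.t 1

/-- `(α_g)_* : 𝔥 → 𝔥`, the differential at `1` of `h ↦ α(g, h)`. -/
def actStar (g : G) : EH →L[ℝ] EH := tmap 𝓘(ℝ, EH) 𝓘(ℝ, EH) (fun h : H => Γ.α g h) 1

/-- `(α̃_h)_* : 𝔤 → 𝔥`, the differential at `1` of `g ↦ h⁻¹ α(g, h)`. -/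
def tildeStar (h : H) : EG →L[ℝ] EH :=
  tmap 𝓘(ℝ, EG) 𝓘(ℝ, EH) (fun g : G => h⁻¹ * Γ.α g h) 1

/-- `α_* : 𝔤 × 𝔥 → 𝔥`, the differential at `1` of `g ↦ (α_g)_*`. -/
def αStar : EG →L[ℝ] EH →L[ℝ] EH :=
  tmap 𝓘(ℝ, EG) 𝓘(ℝ, EH →L[ℝ] EH) (fun g : G => Γ.actStar g) 1

end CrossedModule

/-! ### Lie groupoids, smooth functors, weak equivalences -/

section Groupoids

variable {E₀ : Type*} [NormedAddCommGroup E₀] [NormedSpace ℝ E₀]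
  {K₀ : Type*} [TopologicalSpace K₀] (I₀ : ModelWithCorners ℝ E₀ K₀)
  {X₀ : Type*} [TopologicalSpace X₀] [ChartedSpace K₀ X₀]
  {E₁ : Type*} [NormedAddCommGroup E₁] [NormedSpace ℝ E₁]
  {K₁ : Type*} [TopologicalSpace K₁] (I₁ : ModelWithCorners ℝ E₁ K₁)
  {X₁ : Type*} [TopologicalSpace X₁] [ChartedSpace K₁ X₁]
  {F₀ : Type*} [NormedAddCommGroup F₀] [NormedSpace ℝ F₀]
  {L₀ : Type*} [TopologicalSpace L₀] (J₀ : ModelWithCorners ℝ F₀ L₀)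
  {Y₀ : Type*} [TopologicalSpace Y₀] [ChartedSpace L₀ Y₀]
  {F₁ : Type*} [NormedAddCommGroup F₁] [NormedSpace ℝ F₁]
  {L₁ : Type*} [TopologicalSpace L₁] (J₁ : ModelWithCorners ℝ F₁ L₁)
  {Y₁ : Type*} [TopologicalSpace Y₁] [ChartedSpace L₁ Y₁]

/-- The axioms of a Lie groupoid. As `src` is a submersion, the set of composable pairs is an
embedded submanifold of `X₁ × X₁`, and `ContMDiffOn` on this set is smoothness on that
submanifold. -/
structure IsLieGroupoid (X : GpdStr X₀ X₁) : Prop where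
  src_comp : ∀ f g, X.src f = X.tgt g → X.src (X.comp f g) = X.src g
  tgt_comp : ∀ f g, X.src f = X.tgt g → X.tgt (X.comp f g) = X.tgt f
  assoc : ∀ f g h, X.src f = X.tgt g → X.src g = X.tgt h →
    X.comp (X.comp f g) h = X.comp f (X.comp g h)
  src_one : ∀ x, X.src (X.one x) = x
  tgt_one : ∀ x, X.tgt (X.one x) = x
  one_comp : ∀ f, X.comp (X.one (X.tgt f)) f = f
  comp_one : ∀ f, X.comp f (X.one (X.src f)) = f
  src_inv : ∀ f, X.src (X.inv f) = X.tgt f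
  tgt_inv : ∀ f, X.tgt (X.inv f) = X.src f
  inv_comp : ∀ f, X.comp (X.inv f) f = X.one (X.src f)
  comp_inv : ∀ f, X.comp f (X.inv f) = X.one (X.tgt f)
  submersion_src : Manifold.IsSubmersion I₁ I₀ ∞ X.src
  submersion_tgt : Manifold.IsSubmersion I₁ I₀ ∞ X.tgt
  smooth_one : ContMDiff I₀ I₁ ∞ X.one
  smooth_inv : ContMDiff I₁ I₁ ∞ X.inv
  smooth_comp : ContMDiffOn (I₁.prod I₁) I₁ ∞ (fun p : X₁ × X₁ => X.comp p.1 p.2)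
    {p | X.src p.1 = X.tgt p.2}

/-- `(φ₀, φ₁)` is a smooth functor from `X` to `Y`. -/
structure IsSmoothFunctor (X : GpdStr X₀ X₁) (Y : GpdStr Y₀ Y₁)
    (φ₀ : X₀ → Y₀) (φ₁ : X₁ → Y₁) : Prop where
  smooth_obj : ContMDiff I₀ J₀ ∞ φ₀
  smooth_mor : ContMDiff I₁ J₁ ∞ φ₁
  src_map : ∀ f, Y.src (φ₁ f) = φ₀ (X.src f)
  tgt_map : ∀ f, Y.tgt (φ₁ f) = φ₀ (X.tgt f)
  map_one : ∀ x, φ₁ (X.one x) = Y.one (φ₀ x)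
  map_comp : ∀ f g, X.src f = X.tgt g → φ₁ (X.comp f g) = Y.comp (φ₁ f) (φ₁ g)

/-- The smooth functor `(φ₀, φ₁) : X → Y`, with values in the full subgroupoid `Y|_S` of `Y` over
an embedded submanifold `S` of `Y₀`, is a weak equivalence from `X` to `Y|_S`: it is smoothly
essentially surjective and smoothly fully faithful. The sets in question are embedded submanifolds
of the ambient products, `ContMDiffOn` is smoothness on them, and a smooth map is a submersion if
and only if there is a local smooth section through every point of its domain. -/
structure IsWeakEquivalenceOnto (X : GpdStr X₀ X₁) (Y : GpdStr Y₀ Y₁) (S : Set Y₀)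
    (φ₀ : X₀ → Y₀) (φ₁ : X₁ → Y₁) : Prop where
  functor : IsSmoothFunctor I₀ I₁ J₀ J₁ X Y φ₀ φ₁
  mapsTo : ∀ x, φ₀ x ∈ S
  /-- `(x, η) ↦ src η` is a surjection from `X₀ ×_{φ, tgt} (Y|_S)₁` to `S`. -/
  essSurj : ∀ y ∈ S, ∃ (x : X₀) (η : Y₁), φ₀ x = Y.tgt η ∧ Y.src η = y
  /-- `(x, η) ↦ src η` is a submersion from `X₀ ×_{φ, tgt} (Y|_S)₁` to `S`. -/
  essSubmersion : ∀ (x : X₀) (η : Y₁), φ₀ x = Y.tgt η → Y.src η ∈ S →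
    ∃ U ∈ 𝓝 (Y.src η), ∃ σ : Y₀ → X₀ × Y₁,
      ContMDiffOn J₀ (I₀.prod J₁) ∞ σ (U ∩ S) ∧ σ (Y.src η) = (x, η) ∧
      ∀ y ∈ U ∩ S, φ₀ (σ y).1 = Y.tgt (σ y).2 ∧ Y.src (σ y).2 = y
  /-- `f ↦ ((src f, tgt f), φ₁ f)` is a diffeomorphism from `X₁` to the fibre product of
  `φ₀ × φ₀` and `(src, tgt)`. -/
  fullyFaithful : ∃ inverse : (X₀ × X₀) × Y₁ → X₁,
    ContMDiffOn ((I₀.prod I₀).prod J₁) I₁ ∞ inverse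
      {z | φ₀ z.1.1 = Y.src z.2 ∧ φ₀ z.1.2 = Y.tgt z.2} ∧
    (∀ f, inverse ((X.src f, X.tgt f), φ₁ f) = f) ∧
    ∀ z : (X₀ × X₀) × Y₁, φ₀ z.1.1 = Y.src z.2 → φ₀ z.1.2 = Y.tgt z.2 →
      ((X.src (inverse z), X.tgt (inverse z)), φ₁ (inverse z)) = z

end Groupoids

/-! ### Lie 2-algebra-valued forms on Lie groupoids -/

/-- Triples `(Ψ^a, Ψ^b, Ψ^c)` of fields of alternating forms of degrees `p`, `p`, `p + 1` on
the manifolds of objects, morphisms and objects, with values in `V`, `W` and `W`. The elements of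
`Ω^p(X, γ)` are those which satisfy `GForm.IsForm`. -/
@[ext]
structure GForm (E₀ : Type*) [NormedAddCommGroup E₀] [NormedSpace ℝ E₀] (X₀ : Type*)
    (E₁ : Type*) [NormedAddCommGroup E₁] [NormedSpace ℝ E₁] (X₁ : Type*)
    (V : Type*) [NormedAddCommGroup V] [NormedSpace ℝ V]
    (W : Type*) [NormedAddCommGroup W] [NormedSpace ℝ W] (p : ℕ) where
  a : DForm E₀ X₀ p V
  b : DForm E₁ X₁ p W
  c : DForm E₀ X₀ (p + 1) W

namespace GForm

section

variable {E₀ : Type*} [NormedAddCommGroup E₀] [NormedSpace ℝ E₀] {X₀ : Type*}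
  {E₁ : Type*} [NormedAddCommGroup E₁] [NormedSpace ℝ E₁] {X₁ : Type*}
  {V : Type*} [NormedAddCommGroup V] [NormedSpace ℝ V]
  {W : Type*} [NormedAddCommGroup W] [NormedSpace ℝ W] {p : ℕ}

instance : Add (GForm E₀ X₀ E₁ X₁ V W p) :=
  ⟨fun Ψ Φ => ⟨Ψ.a + Φ.a, Ψ.b + Φ.b, Ψ.c + Φ.c⟩⟩

instance : SMul ℝ (GForm E₀ X₀ E₁ X₁ V W p) :=
  ⟨fun r Ψ => ⟨r • Ψ.a, r • Ψ.b, r • Ψ.c⟩⟩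

end

section

variable {E₀ : Type*} [NormedAddCommGroup E₀] [NormedSpace ℝ E₀]
  {K₀ : Type*} [TopologicalSpace K₀] (I₀ : ModelWithCorners ℝ E₀ K₀)
  {X₀ : Type*} [TopologicalSpace X₀] [ChartedSpace K₀ X₀]
  {E₁ : Type*} [NormedAddCommGroup E₁] [NormedSpace ℝ E₁]
  {K₁ : Type*} [TopologicalSpace K₁] (I₁ : ModelWithCorners ℝ E₁ K₁)
  {X₁ : Type*} [TopologicalSpace X₁] [ChartedSpace K₁ X₁]
  {F₀ : Type*} [NormedAddCommGroup F₀] [NormedSpace ℝ F₀]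
  {L₀ : Type*} [TopologicalSpace L₀] (J₀ : ModelWithCorners ℝ F₀ L₀)
  {Y₀ : Type*} [TopologicalSpace Y₀] [ChartedSpace L₀ Y₀]
  {F₁ : Type*} [NormedAddCommGroup F₁] [NormedSpace ℝ F₁]
  {L₁ : Type*} [TopologicalSpace L₁] (J₁ : ModelWithCorners ℝ F₁ L₁)
  {Y₁ : Type*} [TopologicalSpace Y₁] [ChartedSpace L₁ Y₁]
  {V : Type*} [NormedAddCommGroup V] [NormedSpace ℝ V]
  {W : Type*} [NormedAddCommGroup W] [NormedSpace ℝ W] {p : ℕ}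

/-- The componentwise pullback along a functor `(φ₀, φ₁) : X → Y`. -/
def pullback (φ₀ : X₀ → Y₀) (φ₁ : X₁ → Y₁) (Ψ : GForm F₀ Y₀ F₁ Y₁ V W p) :
    GForm E₀ X₀ E₁ X₁ V W p where
  a := DForm.pullback I₀ J₀ φ₀ Ψ.a
  b := DForm.pullback I₁ J₁ φ₁ Ψ.b
  c := DForm.pullback I₀ J₀ φ₀ Ψ.c

/-- `Δφ = tgt^* φ - src^* φ` for a form `φ` on the objects. -/
def delta (X : GpdStr X₀ X₁) (φ : DForm E₀ X₀ p V) : DForm E₁ X₁ p V :=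
  DForm.pullback I₁ I₀ X.tgt φ - DForm.pullback I₁ I₀ X.src φ

/-- `Δφ = 0` for a form `φ` on the morphisms, where `Δφ = pr₁^* φ - comp^* φ + pr₂^* φ` lives on
the submanifold of composable pairs: its pullback along every smooth family of composable pairs,
parametrized by some `ℝ^k`, vanishes. -/
def DeltaEqZero (X : GpdStr X₀ X₁) (φ : DForm E₁ X₁ p W) : Prop :=
  ∀ (k : ℕ) (ρ₁ ρ₂ : EuclideanSpace ℝ (Fin k) → X₁),
    ContMDiff 𝓘(ℝ, EuclideanSpace ℝ (Fin k)) I₁ ∞ ρ₁ →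
    ContMDiff 𝓘(ℝ, EuclideanSpace ℝ (Fin k)) I₁ ∞ ρ₂ →
    (∀ u, X.src (ρ₁ u) = X.tgt (ρ₂ u)) →
    DForm.pullback 𝓘(ℝ, EuclideanSpace ℝ (Fin k)) I₁ ρ₁ φ
      - DForm.pullback 𝓘(ℝ, EuclideanSpace ℝ (Fin k)) I₁ (fun u => X.comp (ρ₁ u) (ρ₂ u)) φ
      + DForm.pullback 𝓘(ℝ, EuclideanSpace ℝ (Fin k)) I₁ ρ₂ φ = 0

end

variable {EG : Type*} [NormedAddCommGroup EG] [NormedSpace ℝ EG]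
  {G : Type*} [TopologicalSpace G] [ChartedSpace EG G] [Group G]
  {EH : Type*} [NormedAddCommGroup EH] [NormedSpace ℝ EH]
  {H : Type*} [TopologicalSpace H] [ChartedSpace EH H] [Group H]
  (Γ : CrossedModule EG G EH H)
  {E₀ : Type*} [NormedAddCommGroup E₀] [NormedSpace ℝ E₀]
  {K₀ : Type*} [TopologicalSpace K₀] (I₀ : ModelWithCorners ℝ E₀ K₀)
  {X₀ : Type*} [TopologicalSpace X₀] [ChartedSpace K₀ X₀]
  {E₁ : Type*} [NormedAddCommGroup E₁] [NormedSpace ℝ E₁]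
  {K₁ : Type*} [TopologicalSpace K₁] (I₁ : ModelWithCorners ℝ E₁ K₁)
  {X₁ : Type*} [TopologicalSpace X₁] [ChartedSpace K₁ X₁]
  (X : GpdStr X₀ X₁) {p k l : ℕ}

/-- `Ψ` is a `γ`-valued `p`-form on the Lie groupoid `X`, where `γ` is the Lie 2-algebra of
`Γ`. -/
structure IsForm (Ψ : GForm E₀ X₀ E₁ X₁ EG EH p) : Prop where
  smooth_a : DForm.IsSmooth I₀ Ψ.a
  smooth_b : DForm.IsSmooth I₁ Ψ.b
  smooth_c : DForm.IsSmooth I₀ Ψ.c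
  delta_a : delta I₀ I₁ X Ψ.a = DForm.mapVal (fun _ => Γ.tStar) Ψ.b
  delta_b : DeltaEqZero I₁ X Ψ.b

/-- The differential `D`. -/
def D (Ψ : GForm E₀ X₀ E₁ X₁ EG EH p) : GForm E₀ X₀ E₁ X₁ EG EH (p + 1) where
  a := DForm.extD I₀ Ψ.a - (-1 : ℝ) ^ p • DForm.mapVal (fun _ => Γ.tStar) Ψ.c
  b := DForm.extD I₁ Ψ.b - (-1 : ℝ) ^ p • delta I₀ I₁ X Ψ.c
  c := DForm.extD I₀ Ψ.c

/-- The graded product `[Ψ ∧ Φ]`. -/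
def bracket [FiniteDimensional ℝ EG] [FiniteDimensional ℝ EH]
    [LieGroup 𝓘(ℝ, EG) ∞ G] [LieGroup 𝓘(ℝ, EH) ∞ H]
    (Ψ : GForm E₀ X₀ E₁ X₁ EG EH k) (Φ : GForm E₀ X₀ E₁ X₁ EG EH l) :
    GForm E₀ X₀ E₁ X₁ EG EH (k + l) where
  a := DForm.wedge (lieBr EG G) Ψ.a Φ.a
  b := DForm.wedge (lieBr EH H) Ψ.b Φ.b
    + DForm.wedge Γ.αStar (DForm.pullback I₁ I₀ X.src Ψ.a) Φ.b
    - (-1 : ℝ) ^ (k * l) • DForm.castDeg (Nat.add_comm l k)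
        (DForm.wedge Γ.αStar (DForm.pullback I₁ I₀ X.src Φ.a) Ψ.b)
  c := DForm.wedge Γ.αStar Ψ.a Φ.c
    - (-1 : ℝ) ^ (k * l) • DForm.castDeg (show l + (k + 1) = k + l + 1 by omega)
        (DForm.wedge Γ.αStar Φ.a Ψ.c)

/-- The curvature `D Ψ + ½ [Ψ ∧ Ψ]` of a 1-form. -/
def curv [FiniteDimensional ℝ EG] [FiniteDimensional ℝ EH]
    [LieGroup 𝓘(ℝ, EG) ∞ G] [LieGroup 𝓘(ℝ, EH) ∞ H]
    (Ψ : GForm E₀ X₀ E₁ X₁ EG EH 1) : GForm E₀ X₀ E₁ X₁ EG EH 2 :=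
  D Γ I₀ I₁ X Ψ + (1 / 2 : ℝ) • bracket Γ I₀ I₁ X Ψ Ψ

/-- The adjoint action `Ad_F` of a functor `F = (F₀, F₁) : X → Γ`. -/
def adj (F₀ : X₀ → G) (F₁ : X₁ → H × G) (Ψ : GForm E₀ X₀ E₁ X₁ EG EH p) :
    GForm E₀ X₀ E₁ X₁ EG EH p where
  a := DForm.mapVal (fun x => Ad (F₀ x)) Ψ.a
  b := DForm.mapVal (fun f => (Ad (F₁ f).1).comp (Γ.actStar (F₁ f).2)) Ψ.b
    + DForm.mapVal (fun f => (Γ.tildeStar (F₁ f).1⁻¹).comp (Ad (F₁ f).2))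
        (DForm.pullback I₁ I₀ X.src Ψ.a)
  c := DForm.mapVal (fun x => Γ.actStar (F₀ x)) Ψ.c

/-- `Ad_F⁻¹ = Ad_{F⁻¹}`, where `F⁻¹` is the pointwise inverse of the `Γ`-valued functor `F`. -/
def adjInv (F₀ : X₀ → G) (F₁ : X₁ → H × G) (Ψ : GForm E₀ X₀ E₁ X₁ EG EH p) :
    GForm E₀ X₀ E₁ X₁ EG EH p :=
  adj Γ I₀ I₁ X (fun x => (F₀ x)⁻¹) (fun f => Γ.morInv (F₁ f)) Ψ

/-- The Maurer-Cartan form `Θ` of the Lie 2-group. -/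
def Theta : GForm EG G (EH × EG) (H × G) EG EH 1 where
  a := maurerCartan
  b := DForm.mapVal (fun x : H × G => Γ.actStar x.2⁻¹)
    (DForm.pullback (𝓘(ℝ, EH).prod 𝓘(ℝ, EG)) 𝓘(ℝ, EH) (Prod.fst : H × G → H) maurerCartan)
  c := 0

end GForm

/-! ### Principal 2-bundles and connections -/

section Bundles

variable {EG : Type*} [NormedAddCommGroup EG] [NormedSpace ℝ EG]
  {G : Type*} [TopologicalSpace G] [ChartedSpace EG G] [Group G]
  {EH : Type*} [NormedAddCommGroup EH] [NormedSpace ℝ EH]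
  {H : Type*} [TopologicalSpace H] [ChartedSpace EH H] [Group H]

/-- A principal `Γ`-2-bundle over `M`, with total space a Lie groupoid with objects `P₀` and
morphisms `P₁`. -/
structure PrincipalTwoBundle (Γ : CrossedModule EG G EH H)
    (EM : Type*) [NormedAddCommGroup EM] [NormedSpace ℝ EM]
    (M : Type*) [TopologicalSpace M] [ChartedSpace EM M]
    (E₀ : Type*) [NormedAddCommGroup E₀] [NormedSpace ℝ E₀]
    (P₀ : Type*) [TopologicalSpace P₀] [ChartedSpace E₀ P₀]
    (E₁ : Type*) [NormedAddCommGroup E₁] [NormedSpace ℝ E₁]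
    (P₁ : Type*) [TopologicalSpace P₁] [ChartedSpace E₁ P₁] where
  /-- the total space -/
  P : GpdStr P₀ P₁
  isLieGroupoid : IsLieGroupoid 𝓘(ℝ, E₀) 𝓘(ℝ, E₁) P
  /-- the projection, on objects; on morphisms it is `π ∘ src = π ∘ tgt` -/
  π : P₀ → M
  π_surjective : Function.Surjective π
  π_submersion : Manifold.IsSubmersion 𝓘(ℝ, E₀) 𝓘(ℝ, EM) ∞ π
  π_src_eq_tgt : ∀ ρ, π (P.src ρ) = π (P.tgt ρ)
  /-- the right action of `Γ`, on objects -/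
  R₀ : P₀ × G → P₀
  /-- the right action of `Γ`, on morphisms -/
  R₁ : P₁ × (H × G) → P₁
  R_functor : IsSmoothFunctor (𝓘(ℝ, E₀).prod 𝓘(ℝ, EG))
    (𝓘(ℝ, E₁).prod (𝓘(ℝ, EH).prod 𝓘(ℝ, EG))) 𝓘(ℝ, E₀) 𝓘(ℝ, E₁) (P.prod Γ.gpd) P R₀ R₁
  R₀_one : ∀ p, R₀ (p, 1) = p
  R₁_one : ∀ ρ, R₁ (ρ, (1, 1)) = ρ
  R₀_mul : ∀ p g g', R₀ (R₀ (p, g), g') = R₀ (p, g * g')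
  R₁_mul : ∀ ρ x x', R₁ (R₁ (ρ, x), x') = R₁ (ρ, Γ.morMul x x')
  π_R : ∀ p g, π (R₀ (p, g)) = π p
  /-- `τ = (pr₁, R) : P × Γ → P ×_M P` is a weak equivalence; `P ×_M P` is the full subgroupoid of
  `P × P` over `P₀ ×_M P₀`. -/
  weakEquivalence : IsWeakEquivalenceOnto (𝓘(ℝ, E₀).prod 𝓘(ℝ, EG))
    (𝓘(ℝ, E₁).prod (𝓘(ℝ, EH).prod 𝓘(ℝ, EG))) (𝓘(ℝ, E₀).prod 𝓘(ℝ, E₀))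
    (𝓘(ℝ, E₁).prod 𝓘(ℝ, E₁)) (P.prod Γ.gpd) (P.prod P) {q | π q.1 = π q.2}
    (fun z => (z.1, R₀ z)) (fun z => (z.1, R₁ z))

namespace PrincipalTwoBundle

variable {Γ : CrossedModule EG G EH H}
  {EM : Type*} [NormedAddCommGroup EM] [NormedSpace ℝ EM]
  {M : Type*} [TopologicalSpace M] [ChartedSpace EM M]
  {E₀ : Type*} [NormedAddCommGroup E₀] [NormedSpace ℝ E₀]
  {P₀ : Type*} [TopologicalSpace P₀] [ChartedSpace E₀ P₀]
  {E₁ : Type*} [NormedAddCommGroup E₁] [NormedSpace ℝ E₁]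
  {P₁ : Type*} [TopologicalSpace P₁] [ChartedSpace E₁ P₁]
  (B : PrincipalTwoBundle Γ EM M E₀ P₀ E₁ P₁) {p : ℕ}

/-- `R^* Ψ`, over `P × Γ`. -/
def pullR (Ψ : GForm E₀ P₀ E₁ P₁ EG EH p) :
    GForm (E₀ × EG) (P₀ × G) (E₁ × EH × EG) (P₁ × (H × G)) EG EH p :=
  GForm.pullback (𝓘(ℝ, E₀).prod 𝓘(ℝ, EG)) (𝓘(ℝ, E₁).prod (𝓘(ℝ, EH).prod 𝓘(ℝ, EG)))
    𝓘(ℝ, E₀) 𝓘(ℝ, E₁) B.R₀ B.R₁ Ψ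

/-- `Ad_{pr_Γ}⁻¹ (pr_P^* Ψ)`, over `P × Γ`. -/
def adPull (Ψ : GForm E₀ P₀ E₁ P₁ EG EH p) :
    GForm (E₀ × EG) (P₀ × G) (E₁ × EH × EG) (P₁ × (H × G)) EG EH p :=
  GForm.adjInv Γ (𝓘(ℝ, E₀).prod 𝓘(ℝ, EG)) (𝓘(ℝ, E₁).prod (𝓘(ℝ, EH).prod 𝓘(ℝ, EG)))
    (B.P.prod Γ.gpd) Prod.snd Prod.snd
    (GForm.pullback (𝓘(ℝ, E₀).prod 𝓘(ℝ, EG)) (𝓘(ℝ, E₁).prod (𝓘(ℝ, EH).prod 𝓘(ℝ, EG)))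
      𝓘(ℝ, E₀) 𝓘(ℝ, E₁) Prod.fst Prod.fst Ψ)

/-- `pr_Γ^* Θ`, over `P × Γ`. -/
def pullTheta (_B : PrincipalTwoBundle Γ EM M E₀ P₀ E₁ P₁) :
    GForm (E₀ × EG) (P₀ × G) (E₁ × EH × EG) (P₁ × (H × G)) EG EH 1 :=
  GForm.pullback (𝓘(ℝ, E₀).prod 𝓘(ℝ, EG)) (𝓘(ℝ, E₁).prod (𝓘(ℝ, EH).prod 𝓘(ℝ, EG)))
    𝓘(ℝ, EG) (𝓘(ℝ, EH).prod 𝓘(ℝ, EG)) Prod.snd Prod.snd (GForm.Theta Γ)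

/-- `Ω` is a connection: a `γ`-valued 1-form on the total space with
`R^* Ω = Ad_{pr_Γ}⁻¹ (pr_P^* Ω) + pr_Γ^* Θ`. -/
structure IsConnection (Ω : GForm E₀ P₀ E₁ P₁ EG EH 1) : Prop where
  isForm : GForm.IsForm Γ 𝓘(ℝ, E₀) 𝓘(ℝ, E₁) B.P Ω
  equivariant : B.pullR Ω = B.adPull Ω + B.pullTheta

/-- The curvature of `Ω`. -/
def curv [FiniteDimensional ℝ EG] [FiniteDimensional ℝ EH]
    [LieGroup 𝓘(ℝ, EG) ∞ G] [LieGroup 𝓘(ℝ, EH) ∞ H]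
    (Ω : GForm E₀ P₀ E₁ P₁ EG EH 1) : GForm E₀ P₀ E₁ P₁ EG EH 2 :=
  GForm.curv Γ 𝓘(ℝ, E₀) 𝓘(ℝ, E₁) B.P Ω

end PrincipalTwoBundle

end Bundles

end TwoBundle

end

open scoped Manifold ContDiff Topology

noncomputable section

set_option linter.unusedSectionVars false

namespace TwoBundle

/-! The three assertions reduce to the classical facts about connection one-forms together with the
identities of the differential crossed module `γ`: `t_*` is a homomorphism and intertwines `α_*`
with the adjoint action, `α_*(t_* y)` is the bracket with `y` (Peiffer identity), and `α_*` is a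
representation by derivations. All of these come from differentiating identities between group
elements, once the Lie bracket is known to be the derivative of `Ad` (`lieBr_eq_adStar`).

The curvature is a form because `t^*Ω^a = s^*Ω^a + t_*Ω^b`: expanding the curvature of the
right-hand side, the cross terms are `t_*` of the terms in `curv^b` (`delta_curv_a`). For composable
morphisms `Ω^b` is additive, and the quadratic cross term is compensated by the shift of the source
form, by the Peiffer identity (`deltaEqZero_curv_b`). The Bianchi identity follows from `d² = 0`,
the Leibniz rule and the Jacobi identity (`bianchi_a`, `bianchi_b`, `bianchi_c`).

For equivariance, the object component is the usual computation that `A' = Ad_f⁻¹ A + f^*θ` has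
curvature `Ad_f⁻¹ F`, based on the Maurer–Cartan equation (`extD_mcForm`,
`extD_gauge_add_half_wedge`). The morphism component is the same computation in another group: the
pair `(Ω^b, s^*Ω^a)` is a one-form with values in the Lie algebra of `H ⋉ G`, and the morphism
components of `Ad_F`, `Θ` and the graded product are the `H`-components of the adjoint action,
Maurer–Cartan form and bracket of `H ⋉ G` (`conjStar_semi`, `mcAt_semi`, `adStar_semi`). Hence the
Lie group calculus is developed for an arbitrary boundaryless model, which includes the product
model of `H ⋉ G`. The terms in `Ω^c` that this leaves out are matched by `tildeStar_comp_tStar`. -/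

/-! ### Signed sums over permutations of two, three and four letters. -/

/-- A permutation is given by the image of `0` and a permutation of the remaining letters; this
recursion unfolds the small symmetric groups. -/
theorem sum_perm_fin_succ {A : Type*} [AddCommMonoid A] {n : ℕ} (f : Equiv.Perm (Fin (n + 1)) → A) :
    ∑ σ, f σ = ∑ p : Fin (n + 1), ∑ e : Equiv.Perm (Fin n), f (Equiv.Perm.decomposeFin.symm (p, e)) := by
  rw [← Equiv.sum_comp Equiv.Perm.decomposeFin.symm, Fintype.sum_prod_type]

theorem sum_perm_fin_two {A : Type*} [AddCommGroup A] (g : Fin 2 → Fin 2 → A) :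
    ∑ σ : Equiv.Perm (Fin 2), Equiv.Perm.sign σ • g (σ 0) (σ 1) = g 0 1 - g 1 0 := by
  simp [sum_perm_fin_succ, Fin.sum_univ_succ, Equiv.Perm.decomposeFin_symm_apply_one, sub_eq_add_neg]

theorem sum_perm_fin_three {A : Type*} [AddCommGroup A] (g : Fin 3 → Fin 3 → Fin 3 → A) :
    ∑ σ : Equiv.Perm (Fin 3), Equiv.Perm.sign σ • g (σ 0) (σ 1) (σ 2) =
      g 0 1 2 - g 0 2 1 - g 1 0 2 + g 1 2 0 + g 2 0 1 - g 2 1 0 := by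
  have h2 : ∀ (a b), (Equiv.Perm.decomposeFin.symm (a, b) : Equiv.Perm (Fin 3)) 2 = Equiv.swap 0 a (b 1).succ :=
    fun a b => Equiv.Perm.decomposeFin_symm_apply_succ b a 1
  have h2' : Equiv.swap (0 : Fin 3) 1 2 = 2 := by decide
  have h3' : Equiv.swap (0 : Fin 3) 2 1 = 1 := by decide
  simp [sum_perm_fin_succ, Fin.sum_univ_succ, Equiv.Perm.decomposeFin_symm_apply_one, h2, h2', h3']
  abel

theorem sum_perm_fin_four {A : Type*} [AddCommGroup A] (g : Fin 4 → Fin 4 → Fin 4 → Fin 4 → A) :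
    ∑ σ : Equiv.Perm (Fin 4), Equiv.Perm.sign σ • g (σ 0) (σ 1) (σ 2) (σ 3) =
      g 0 1 2 3 - g 0 1 3 2 - g 0 2 1 3 + g 0 2 3 1 + g 0 3 1 2 - g 0 3 2 1
      - (g 1 0 2 3 - g 1 0 3 2 - g 1 2 0 3 + g 1 2 3 0 + g 1 3 0 2 - g 1 3 2 0)
      + (g 2 0 1 3 - g 2 0 3 1 - g 2 1 0 3 + g 2 1 3 0 + g 2 3 0 1 - g 2 3 1 0)
      - (g 3 0 1 2 - g 3 0 2 1 - g 3 1 0 2 + g 3 1 2 0 + g 3 2 0 1 - g 3 2 1 0)  := by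
  have h2 : ∀ (a b), (Equiv.Perm.decomposeFin.symm (a, b) : Equiv.Perm (Fin 4)) 2 = Equiv.swap 0 a (b 1).succ :=
    fun a b => Equiv.Perm.decomposeFin_symm_apply_succ b a 1
  have h3 : ∀ (a b), (Equiv.Perm.decomposeFin.symm (a, b) : Equiv.Perm (Fin 4)) 3 = Equiv.swap 0 a (b 2).succ :=
    fun a b => Equiv.Perm.decomposeFin_symm_apply_succ b a 2
  have h2' : ∀ (a b), (Equiv.Perm.decomposeFin.symm (a, b) : Equiv.Perm (Fin 3)) 2 = Equiv.swap 0 a (b 1).succ :=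
    fun a b => Equiv.Perm.decomposeFin_symm_apply_succ b a 1
  have e1 : Equiv.swap (0 : Fin 4) 1 2 = 2 := by decide
  have e2 : Equiv.swap (0 : Fin 4) 1 3 = 3 := by decide
  have e3 : Equiv.swap (0 : Fin 4) 2 1 = 1 := by decide
  have e4 : Equiv.swap (0 : Fin 4) 2 3 = 3 := by decide
  have e5 : Equiv.swap (0 : Fin 4) 3 1 = 1 := by decide
  have e6 : Equiv.swap (0 : Fin 4) 3 2 = 2 := by decide
  have e7 : Equiv.swap (0 : Fin 3) 1 2 = 2 := by decide
  have e8 : Equiv.swap (0 : Fin 3) 2 1 = 1 := by decide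
  have e9 : Fin.succ (2 : Fin 3) = 3 := rfl
  simp [sum_perm_fin_succ, Fin.sum_univ_succ, Equiv.Perm.decomposeFin_symm_apply_one, h2, h3, h2', e1, e2, e3, e4, e5, e6, e7, e8, e9]
  abel

theorem vec_one {T : Type*} (f : Fin 1 → T) : f = ![f 0] := by ext i; fin_cases i; rfl

theorem vec_two {T : Type*} (f : Fin 2 → T) : f = ![f 0, f 1] := by ext i; fin_cases i <;> rfl

theorem vec_three {T : Type*} (f : Fin 3 → T) : f = ![f 0, f 1, f 2] := by ext i; fin_cases i <;> rfl

/-! ### Wedge products of low degree as sums over shuffles. -/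

namespace DForm
variable {E : Type*} [NormedAddCommGroup E] [NormedSpace ℝ E]
  {V W U : Type*} [NormedAddCommGroup V] [NormedSpace ℝ V]
  [NormedAddCommGroup W] [NormedSpace ℝ W] [NormedAddCommGroup U] [NormedSpace ℝ U] {X : Type*}

theorem wedge_apply {k l : ℕ} (B : V →L[ℝ] W →L[ℝ] U) (φ : DForm E X k V) (ψ : DForm E X l W) (x : X)
    (v : Fin (k + l) → E) :
    wedge B φ ψ x v = ((k.factorial * l.factorial : ℝ)⁻¹) • ∑ σ : Equiv.Perm (Fin (k + l)),
      Equiv.Perm.sign σ • B (φ x fun i => v (σ (Fin.castAdd l i)))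
        (ψ x fun j => v (σ (Fin.natAdd k j))) := by
  simp only [wedge, ContinuousAlternatingMap.smul_apply,
    ContinuousMultilinearMap.alternatization_apply_apply]
  rfl

theorem wedge_one_one_apply (B : V →L[ℝ] W →L[ℝ] U) (φ : DForm E X 1 V) (ψ : DForm E X 1 W) (x : X)
    (v : Fin 2 → E) :
    wedge B φ ψ x v = B (φ x ![v 0]) (ψ x ![v 1]) - B (φ x ![v 1]) (ψ x ![v 0]) := by
  rw [wedge_apply, ← sum_perm_fin_two fun i j => B (φ x ![v i]) (ψ x ![v j])]
  simp only [vec_one fun i : Fin 1 => v _]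
  norm_num
  rfl

theorem swap_two (φ : E [⋀^Fin 2]→L[ℝ] V) (a b : E) : φ ![b, a] = - φ ![a, b] := by
  have h := φ.toAlternatingMap.map_swap ![a, b] (show (0 : Fin 2) ≠ 1 by decide)
  rw [vec_two (![a, b] ∘ _)] at h
  simpa using h

theorem swap_three_left (φ : E [⋀^Fin 3]→L[ℝ] V) (a b c : E) :
    φ ![b, a, c] = - φ ![a, b, c] := by
  have h := φ.toAlternatingMap.map_swap ![a, b, c] (show (0 : Fin 3) ≠ 1 by decide)
  rw [vec_three (![a, b, c] ∘ _)] at h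
  simpa [show Equiv.swap (0 : Fin 3) 1 2 = 2 by decide] using h

theorem swap_three_right (φ : E [⋀^Fin 3]→L[ℝ] V) (a b c : E) :
    φ ![a, c, b] = - φ ![a, b, c] := by
  have h := φ.toAlternatingMap.map_swap ![a, b, c] (show (1 : Fin 3) ≠ 2 by decide)
  rw [vec_three (![a, b, c] ∘ _)] at h
  simpa [show Equiv.swap (1 : Fin 3) 2 0 = 0 by decide] using h

/-- Antisymmetry of `ψ` makes the six terms agree in pairs, which cancels `1/2!` and leaves one term
per shuffle. Formulas of this kind turn the later identities of forms into identities between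
values. -/
theorem wedge_one_two_apply (B : V →L[ℝ] W →L[ℝ] U) (φ : DForm E X 1 V) (ψ : DForm E X 2 W)
    (x : X) (v : Fin 3 → E) :
    wedge B φ ψ x v = B (φ x ![v 0]) (ψ x ![v 1, v 2]) - B (φ x ![v 1]) (ψ x ![v 0, v 2])
      + B (φ x ![v 2]) (ψ x ![v 0, v 1]) := by
  have h := sum_perm_fin_three fun i j k => B (φ x ![v i]) (ψ x ![v j, v k])
  rw [swap_two (ψ x) (v 0) (v 1), swap_two (ψ x) (v 0) (v 2), swap_two (ψ x) (v 1) (v 2)] at h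
  rw [wedge_apply]
  simp only [vec_one fun i : Fin 1 => v _, vec_two fun i : Fin 2 => v _]
  refine (congrArg _ h).trans ?_
  norm_num
  module

theorem wedge_two_one_apply (B : V →L[ℝ] W →L[ℝ] U) (φ : DForm E X 2 V) (ψ : DForm E X 1 W)
    (x : X) (v : Fin 3 → E) :
    wedge B φ ψ x v = B (φ x ![v 0, v 1]) (ψ x ![v 2]) - B (φ x ![v 0, v 2]) (ψ x ![v 1])
      + B (φ x ![v 1, v 2]) (ψ x ![v 0]) := by
  have h := sum_perm_fin_three fun i j k => B (φ x ![v i, v j]) (ψ x ![v k])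
  rw [swap_two (φ x) (v 0) (v 1), swap_two (φ x) (v 0) (v 2), swap_two (φ x) (v 1) (v 2)] at h
  rw [wedge_apply]
  simp only [vec_one fun i : Fin 1 => v _, vec_two fun i : Fin 2 => v _]
  refine (congrArg _ h).trans ?_
  norm_num
  module

theorem wedge_two_two_apply (B : V →L[ℝ] W →L[ℝ] U) (φ : DForm E X 2 V) (ψ : DForm E X 2 W)
    (x : X) (v : Fin 4 → E) :
    wedge B φ ψ x v = B (φ x ![v 0, v 1]) (ψ x ![v 2, v 3]) - B (φ x ![v 0, v 2]) (ψ x ![v 1, v 3])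
      + B (φ x ![v 0, v 3]) (ψ x ![v 1, v 2]) + B (φ x ![v 1, v 2]) (ψ x ![v 0, v 3])
      - B (φ x ![v 1, v 3]) (ψ x ![v 0, v 2]) + B (φ x ![v 2, v 3]) (ψ x ![v 0, v 1]) := by
  have h := sum_perm_fin_four fun i j k l => B (φ x ![v i, v j]) (ψ x ![v k, v l])
  rw [swap_two (φ x) (v 0) (v 1), swap_two (φ x) (v 0) (v 2), swap_two (φ x) (v 0) (v 3),
    swap_two (φ x) (v 1) (v 2), swap_two (φ x) (v 1) (v 3), swap_two (φ x) (v 2) (v 3),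
    swap_two (ψ x) (v 0) (v 1), swap_two (ψ x) (v 0) (v 2), swap_two (ψ x) (v 0) (v 3),
    swap_two (ψ x) (v 1) (v 2), swap_two (ψ x) (v 1) (v 3), swap_two (ψ x) (v 2) (v 3)] at h
  rw [wedge_apply]
  simp only [vec_two fun i : Fin 2 => v _]
  refine (congrArg _ h).trans ?_
  norm_num
  module

theorem wedge_one_three_apply (B : V →L[ℝ] W →L[ℝ] U) (φ : DForm E X 1 V) (ψ : DForm E X 3 W)
    (x : X) (v : Fin 4 → E) :
    wedge B φ ψ x v = B (φ x ![v 0]) (ψ x ![v 1, v 2, v 3]) - B (φ x ![v 1]) (ψ x ![v 0, v 2, v 3])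
      + B (φ x ![v 2]) (ψ x ![v 0, v 1, v 3]) - B (φ x ![v 3]) (ψ x ![v 0, v 1, v 2]) := by
  have h := sum_perm_fin_four fun i j k l => B (φ x ![v i]) (ψ x ![v j, v k, v l])
  -- Arguments of `ψ` are brought into increasing order, so each of the four shuffles collects six
  -- equal terms and `1/3!` cancels.
  have s : ∀ a b c, ψ x ![a, c, b] = -ψ x ![a, b, c] ∧ ψ x ![b, a, c] = -ψ x ![a, b, c] ∧
      ψ x ![b, c, a] = ψ x ![a, b, c] ∧ ψ x ![c, a, b] = ψ x ![a, b, c] ∧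
      ψ x ![c, b, a] = -ψ x ![a, b, c] := fun a b c =>
    ⟨swap_three_right _ a b c, swap_three_left _ a b c,
      by rw [swap_three_right _ b a c, swap_three_left, neg_neg],
      by rw [swap_three_left _ a c b, swap_three_right, neg_neg],
      by rw [swap_three_left _ b c a, swap_three_right _ b a c, swap_three_left, neg_neg]⟩
  obtain ⟨a1, a2, a3, a4, a5⟩ := s (v 1) (v 2) (v 3)
  obtain ⟨b1, b2, b3, b4, b5⟩ := s (v 0) (v 2) (v 3)
  obtain ⟨c1, c2, c3, c4, c5⟩ := s (v 0) (v 1) (v 3)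
  obtain ⟨d1, d2, d3, d4, d5⟩ := s (v 0) (v 1) (v 2)
  rw [a1, a2, a3, a4, a5, b1, b2, b3, b4, b5, c1, c2, c3, c4, c5, d1, d2, d3, d4, d5] at h
  rw [wedge_apply]
  simp only [vec_one fun i : Fin 1 => v _, vec_three fun i : Fin 3 => v _]
  refine (congrArg _ h).trans ?_
  norm_num [Nat.factorial]
  module

end DForm

/-! ### Smooth families of alternating forms on vector spaces. -/

section AlternatingCalculus

variable {E V Z : Type*} [NormedAddCommGroup E] [NormedSpace ℝ E] [FiniteDimensional ℝ E]
  [NormedAddCommGroup V] [NormedSpace ℝ V] [FiniteDimensional ℝ V]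
  [NormedAddCommGroup Z] [NormedSpace ℝ Z] {n : ℕ}

/-- On finite-dimensional spaces, a family of alternating forms is smooth as soon as all its
evaluations are. -/

theorem contDiffAt_alternating_of_eval {m : WithTop ℕ∞} {f : Z → E [⋀^Fin n]→L[ℝ] V} {z : Z}
    (h : ∀ v, ContDiffAt ℝ m (fun y => f y v) z) : ContDiffAt ℝ m f z := by
  let b := Module.finBasis ℝ E
  -- Evaluation on tuples of basis vectors is injective. A linear left inverse, continuous because
  -- its domain is finite-dimensional, recovers the family from finitely many evaluations.
  let T : (E [⋀^Fin n]→L[ℝ] V) →ₗ[ℝ] ((Fin n → Fin (Module.finrank ℝ E)) → V) :=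
    LinearMap.pi fun s => (ContinuousAlternatingMap.apply ℝ E V fun i => b (s i)).toLinearMap
  have hT : LinearMap.ker T = ⊥ := by
    refine LinearMap.ker_eq_bot.2 fun φ ψ h => ?_
    apply ContinuousAlternatingMap.toAlternatingMap_injective
    apply AlternatingMap.coe_multilinearMap_injective
    refine Module.Basis.ext_multilinear (fun _ => b) fun s => ?_
    exact congrFun h s
  obtain ⟨S, hS⟩ := T.exists_leftInverse_of_injective hT
  have hfS : f = fun y => S.toContinuousLinearMap (fun s => f y fun i => b (s i)) := by
    funext y
    exact (LinearMap.congr_fun hS (f y)).symm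
  rw [hfS]
  exact S.toContinuousLinearMap.contDiff.contDiffAt.comp z (contDiffAt_pi.2 fun s => h _)

theorem contDiffAt_alternating_eval {m : WithTop ℕ∞} {f : Z → E [⋀^Fin n]→L[ℝ] V} {z : Z}
    (h : ContDiffAt ℝ m f z) (v : Fin n → E) : ContDiffAt ℝ m (fun y => f y v) z :=
  (ContinuousAlternatingMap.apply ℝ E V v).contDiff.contDiffAt.comp z h

theorem contDiffAt_alternating_compContinuousLinearMap {m : WithTop ℕ∞}
    {E' : Type*} [NormedAddCommGroup E'] [NormedSpace ℝ E'] [FiniteDimensional ℝ E']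
    {f : Z → E [⋀^Fin n]→L[ℝ] V} {g : Z → E' →L[ℝ] E} {z : Z}
    (hf : ContDiffAt ℝ m f z) (hg : ContDiffAt ℝ m g z) :
    ContDiffAt ℝ m (fun y => (f y).compContinuousLinearMap (g y)) z := by
  refine contDiffAt_alternating_of_eval fun v => ?_
  have h1 : ContDiffAt ℝ m (fun y => (f y).toContinuousMultilinearMap) z :=
    (ContinuousAlternatingMap.toContinuousMultilinearMapCLM (𝕜 := ℝ) (E := E) (F := V) (ι := Fin n) ℝ).contDiff.contDiffAt.comp z hf
  -- Precomposition is continuous multilinear in the `n` copies of `g y`, hence smooth in `g y`.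
  have h2 : ContDiffAt ℝ m (fun y => ContinuousMultilinearMap.compContinuousLinearMapContinuousMultilinear
      ℝ (fun _ : Fin n => E') (fun _ : Fin n => E) V (fun _ => g y)) z :=
    (ContinuousMultilinearMap.contDiff _).contDiffAt.comp z (contDiffAt_pi.2 fun _ => hg)
  exact (ContinuousMultilinearMap.apply ℝ (fun _ : Fin n => E') V v).contDiff.contDiffAt.comp z
    (h2.clm_apply h1)

theorem contDiffAt_extDeriv {f : E → E [⋀^Fin n]→L[ℝ] V} {z : E} (h : ContDiffAt ℝ ∞ f z) :
    ContDiffAt ℝ ∞ (extDeriv f) z := by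
  have e : extDeriv f = fun y =>
      ContinuousAlternatingMap.alternatizeUncurryFinCLM (n := n) ℝ E V (fderiv ℝ f y) := rfl
  rw [e]
  exact (ContinuousAlternatingMap.alternatizeUncurryFinCLM (n := n) ℝ E V).contDiff.contDiffAt.comp z
    (h.fderiv_right (m := ∞) (by simp))

end AlternatingCalculus

/-! ### Tangent maps and preferred charts. -/

section Tmap

variable {E : Type*} [NormedAddCommGroup E] [NormedSpace ℝ E]
  {K : Type*} [TopologicalSpace K] {I : ModelWithCorners ℝ E K}
  {E' : Type*} [NormedAddCommGroup E'] [NormedSpace ℝ E']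
  {K' : Type*} [TopologicalSpace K'] {I' : ModelWithCorners ℝ E' K'}
  {E'' : Type*} [NormedAddCommGroup E''] [NormedSpace ℝ E'']
  {K'' : Type*} [TopologicalSpace K''] {I'' : ModelWithCorners ℝ E'' K''}
  {X : Type*} [TopologicalSpace X] [ChartedSpace K X]
  {Y : Type*} [TopologicalSpace Y] [ChartedSpace K' Y]
  {Z : Type*} [TopologicalSpace Z] [ChartedSpace K'' Z]

theorem tmap_comp {g : Y → Z} {f : X → Y} (x : X) (hg : MDifferentiableAt I' I'' g (f x))
    (hf : MDifferentiableAt I I' f x) :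
    tmap I I'' (fun y => g (f y)) x = (tmap I' I'' g (f x)).comp (tmap I I' f x) :=
  mfderiv_comp x hg hf

theorem tmap_id (x : X) : tmap I I (fun y : X => y) x = ContinuousLinearMap.id ℝ E :=
  mfderiv_id

theorem tmap_const (x : X) (y : Y) : tmap I I' (fun _ : X => y) x = 0 :=
  mfderiv_const

theorem tmap_eq_fderiv (f : E → E') (x : E) : tmap 𝓘(ℝ, E) 𝓘(ℝ, E') f x = fderiv ℝ f x :=
  mfderiv_eq_fderiv

theorem tmap_congr {f g : X → Y} {x : X} (h : f =ᶠ[𝓝 x] g) : tmap I I' f x = tmap I I' g x := by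
  unfold tmap
  exact h.mfderiv_eq

variable [IsManifold I ∞ X]

/-- The identification of the tangent space at `x` with `E` is made by this very chart, so its
tangent map at its own base point is trivial. -/
theorem tmap_extChartAt_self (x : X) :
    tmap I 𝓘(ℝ, E) (extChartAt I x) x = ContinuousLinearMap.id ℝ E :=
  mfderiv_extChartAt_self

variable [I.Boundaryless]

theorem extChartAt_target_mem_nhds_of_mem {x : X} {u : E} (hu : u ∈ (extChartAt I x).target) :
    (extChartAt I x).target ∈ 𝓝 u :=
  (isOpen_extChartAt_target x).mem_nhds hu

theorem contMDiffAt_extChartAt_symm {x : X} {u : E} (hu : u ∈ (extChartAt I x).target) :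
    ContMDiffAt 𝓘(ℝ, E) I ∞ (extChartAt I x).symm u :=
  (contMDiffOn_extChartAt_symm x).contMDiffAt (extChartAt_target_mem_nhds_of_mem hu)

theorem tmap_extChartAt_symm_self (x : X) :
    tmap 𝓘(ℝ, E) I (extChartAt I x).symm (extChartAt I x x) = ContinuousLinearMap.id ℝ E := by
  have h := mfderivWithin_range_extChartAt_symm (I := I) (x := x)
  rw [I.range_eq_univ, mfderivWithin_univ] at h
  exact h

end Tmap

theorem minSmoothness_two_le_infty : minSmoothness ℝ 2 ≤ (∞ : WithTop ℕ∞) := by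
  simp only [minSmoothness_of_isRCLikeNormedField]
  exact ENat.LEInfty.out

/-! ### Pullback, smoothness and exterior derivative of forms on manifolds. -/

namespace DForm

section Algebra

variable {E : Type*} [NormedAddCommGroup E] [NormedSpace ℝ E]
  {K : Type*} [TopologicalSpace K] {I : ModelWithCorners ℝ E K}
  {E' : Type*} [NormedAddCommGroup E'] [NormedSpace ℝ E']
  {K' : Type*} [TopologicalSpace K'] {I' : ModelWithCorners ℝ E' K'}
  {E'' : Type*} [NormedAddCommGroup E''] [NormedSpace ℝ E'']
  {K'' : Type*} [TopologicalSpace K''] {I'' : ModelWithCorners ℝ E'' K''}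
  {X : Type*} [TopologicalSpace X] [ChartedSpace K X]
  {Y : Type*} [TopologicalSpace Y] [ChartedSpace K' Y]
  {Z : Type*} [TopologicalSpace Z] [ChartedSpace K'' Z]
  {V W U : Type*} [NormedAddCommGroup V] [NormedSpace ℝ V]
  [NormedAddCommGroup W] [NormedSpace ℝ W] [NormedAddCommGroup U] [NormedSpace ℝ U] {k l n : ℕ}

theorem pullback_apply (f : X → Y) (φ : DForm E' Y n V) (x : X) (v : Fin n → E) :
    pullback I I' f φ x v = φ (f x) fun i => tmap I I' f x (v i) := rfl

theorem mapVal_apply (L : X → V →L[ℝ] W) (φ : DForm E X n V) (x : X) (v : Fin n → E) :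
    mapVal L φ x v = L x (φ x v) := rfl

theorem add_apply' (φ ψ : DForm E X n V) (x : X) (v : Fin n → E) :
    (φ + ψ) x v = φ x v + ψ x v := rfl

theorem sub_apply' (φ ψ : DForm E X n V) (x : X) (v : Fin n → E) :
    (φ - ψ) x v = φ x v - ψ x v := rfl

theorem smul_apply' (c : ℝ) (φ : DForm E X n V) (x : X) (v : Fin n → E) :
    (c • φ) x v = c • φ x v := rfl

theorem pullback_add (f : X → Y) (φ ψ : DForm E' Y n V) :
    pullback I I' f (φ + ψ) = pullback I I' f φ + pullback I I' f ψ := rfl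

theorem pullback_sub (f : X → Y) (φ ψ : DForm E' Y n V) :
    pullback I I' f (φ - ψ) = pullback I I' f φ - pullback I I' f ψ := rfl

theorem pullback_smul (f : X → Y) (c : ℝ) (φ : DForm E' Y n V) :
    pullback I I' f (c • φ) = c • pullback I I' f φ := rfl

theorem pullback_mapVal (f : X → Y) (L : Y → V →L[ℝ] W) (φ : DForm E' Y n V) :
    pullback I I' f (mapVal L φ) = mapVal (fun x => L (f x)) (pullback I I' f φ) := rfl

theorem pullback_wedge (f : X → Y) (B : V →L[ℝ] W →L[ℝ] U) (φ : DForm E' Y k V)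
    (ψ : DForm E' Y l W) :
    pullback I I' f (wedge B φ ψ) = wedge B (pullback I I' f φ) (pullback I I' f ψ) := by
  funext x
  ext v
  rw [pullback_apply, wedge_apply, wedge_apply]
  rfl

theorem pullback_comp_apply {g : Y → Z} {f : X → Y} (φ : DForm E'' Z n V) {x : X}
    (hg : MDifferentiableAt I' I'' g (f x)) (hf : MDifferentiableAt I I' f x) :
    pullback I I'' (fun x => g (f x)) φ x = pullback I I' f (pullback I' I'' g φ) x := by
  ext v
  simp only [pullback_apply, tmap_comp x hg hf]
  rfl

theorem pullback_comp {g : Y → Z} {f : X → Y} (φ : DForm E'' Z n V)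
    (hg : MDifferentiable I' I'' g) (hf : MDifferentiable I I' f) :
    pullback I I'' (fun x => g (f x)) φ = pullback I I' f (pullback I' I'' g φ) :=
  funext fun x => pullback_comp_apply φ (hg (f x)) (hf x)

end Algebra

section Smooth

variable {E : Type*} [NormedAddCommGroup E] [NormedSpace ℝ E] [FiniteDimensional ℝ E]
  {K : Type*} [TopologicalSpace K] {I : ModelWithCorners ℝ E K} [I.Boundaryless]
  {E' : Type*} [NormedAddCommGroup E'] [NormedSpace ℝ E'] [FiniteDimensional ℝ E']
  {K' : Type*} [TopologicalSpace K'] {I' : ModelWithCorners ℝ E' K'} [I'.Boundaryless]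
  {X : Type*} [TopologicalSpace X] [ChartedSpace K X] [IsManifold I ∞ X]
  {Y : Type*} [TopologicalSpace Y] [ChartedSpace K' Y] [IsManifold I' ∞ Y]
  {F : Type*} [NormedAddCommGroup F] [NormedSpace ℝ F] [FiniteDimensional ℝ F]
  {V W U : Type*} [NormedAddCommGroup V] [NormedSpace ℝ V] [FiniteDimensional ℝ V]
  [NormedAddCommGroup W] [NormedSpace ℝ W] [FiniteDimensional ℝ W]
  [NormedAddCommGroup U] [NormedSpace ℝ U] [FiniteDimensional ℝ U] {k l n : ℕ}

theorem isSmooth_iff_contDiffAt {φ : DForm E X n V} :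
    IsSmooth I φ ↔ ∀ x₀ : X, ∀ u ∈ (extChartAt I x₀).target, ContDiffAt ℝ ∞ (chartRep I φ x₀) u :=
  forall_congr' fun x₀ => (isOpen_extChartAt_target x₀).contDiffOn_iff

theorem chartRep_self (φ : DForm E X n V) (x : X) :
    chartRep I φ x (extChartAt I x x) = φ x := by
  ext v
  simp only [chartRep, pullback_apply, tmap_extChartAt_symm_self, extChartAt_to_inv]
  rfl

theorem extD_apply_eq (φ : DForm E X n V) (x : X) :
    extD I φ x = extDeriv (chartRep I φ x) (extChartAt I x x) := by
  ext v
  simp only [extD, tmap_extChartAt_self]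
  rfl

/-- The pullback of a form to a vector space, computed in a chart of the target. -/

theorem pullback_eventuallyEq_chartRep {f : F → X} {z : F} (hf : ContMDiffAt 𝓘(ℝ, F) I ∞ f z)
    (y : X) (hy : f z ∈ (extChartAt I y).source) (φ : DForm E X n V) :
    pullback 𝓘(ℝ, F) I f φ =ᶠ[𝓝 z] fun w =>
      (chartRep I φ y (extChartAt I y (f w))).compContinuousLinearMap
        (fderiv ℝ (fun w => extChartAt I y (f w)) w) := by
  have h1 : ∀ᶠ w in 𝓝 z, f w ∈ (extChartAt I y).source :=
    hf.continuousAt ((isOpen_extChartAt_source y).mem_nhds hy)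
  have h2 : ∀ᶠ w in 𝓝 z, ContMDiffAt 𝓘(ℝ, F) I 1 f w :=
    (contMDiffAt_iff_contMDiffAt_nhds (by simp)).1 (hf.of_le (by simp))
  filter_upwards [h1.eventually_nhds, h2] with w hw hfw
  have hfd : MDifferentiableAt 𝓘(ℝ, F) I f w := hfw.mdifferentiableAt one_ne_zero
  have hw0 : f w ∈ (extChartAt I y).source := hw.self_of_nhds
  have hc : MDifferentiableAt I 𝓘(ℝ, E) (extChartAt I y) (f w) :=
    mdifferentiableAt_extChartAt (by simpa using hw0)
  have hs : MDifferentiableAt 𝓘(ℝ, E) I (extChartAt I y).symm (extChartAt I y (f w)) :=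
    (contMDiffAt_extChartAt_symm ((extChartAt I y).map_source hw0)).mdifferentiableAt (by simp)
  have hcomp : MDifferentiableAt 𝓘(ℝ, F) 𝓘(ℝ, E) (fun w => extChartAt I y (f w)) w :=
    hc.comp w hfd
  have e : tmap 𝓘(ℝ, F) I f w = (tmap 𝓘(ℝ, E) I (extChartAt I y).symm (extChartAt I y (f w))).comp
      (fderiv ℝ (fun w => extChartAt I y (f w)) w) := by
    rw [← tmap_eq_fderiv, ← tmap_comp (f := fun w => extChartAt I y (f w)) w hs hcomp]
    refine tmap_congr ?_
    filter_upwards [hw] with w' hw'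
    exact ((extChartAt I y).left_inv hw').symm
  ext v
  simp only [pullback_apply, e, chartRep, ContinuousAlternatingMap.compContinuousLinearMap_apply,
    (extChartAt I y).left_inv hw0]
  rfl

theorem contDiffAt_extChartAt_comp {f : F → X} {z : F} (hf : ContMDiffAt 𝓘(ℝ, F) I ∞ f z)
    (y : X) (hy : f z ∈ (extChartAt I y).source) :
    ContDiffAt ℝ ∞ (fun w => extChartAt I y (f w)) z :=
  contMDiffAt_iff_contDiffAt.1
    ((contMDiffAt_extChartAt' (by simpa using hy)).comp z hf)

theorem IsSmooth.contDiffAt_pullback {φ : DForm E X n V} (hφ : IsSmooth I φ) {f : F → X} {z : F}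
    (hf : ContMDiffAt 𝓘(ℝ, F) I ∞ f z) : ContDiffAt ℝ ∞ (pullback 𝓘(ℝ, F) I f φ) z := by
  have hy := mem_extChartAt_source (I := I) (f z)
  refine ContDiffAt.congr_of_eventuallyEq ?_ (pullback_eventuallyEq_chartRep hf (f z) hy φ)
  have hg := contDiffAt_extChartAt_comp hf (f z) hy
  refine contDiffAt_alternating_compContinuousLinearMap ?_ (hg.fderiv_right (by simp))
  exact (isSmooth_iff_contDiffAt.1 hφ (f z) _ (mem_extChartAt_target _)).comp z hg

/-- The chart at `f z` turns `f` into a map of vector spaces, where `extDeriv` is natural; the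
tangent map of that chart at `f z` is the identity, so `extD` appears without correction. The other
naturality statements follow from this one. -/
theorem IsSmooth.extDeriv_pullback {φ : DForm E X n V} (hφ : IsSmooth I φ) {f : F → X} {z : F}
    (hf : ContMDiffAt 𝓘(ℝ, F) I ∞ f z) :
    extDeriv (pullback 𝓘(ℝ, F) I f φ) z =
      (extD I φ (f z)).compContinuousLinearMap (tmap 𝓘(ℝ, F) I f z) := by
  have hy := mem_extChartAt_source (I := I) (f z)
  have hg := contDiffAt_extChartAt_comp hf (f z) hy
  have hd : DifferentiableAt ℝ (chartRep I φ (f z)) ((fun w => extChartAt I (f z) (f w)) z) :=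
    (isSmooth_iff_contDiffAt.1 hφ (f z) _ (mem_extChartAt_target _)).differentiableAt (by simp)
  rw [(pullback_eventuallyEq_chartRep hf (f z) hy φ).extDeriv_eq,
    _root_.extDeriv_pullback (f := fun w => extChartAt I (f z) (f w)) hd hg minSmoothness_two_le_infty, extD_apply_eq, ← tmap_eq_fderiv,
      tmap_comp (I' := I) z (mdifferentiableAt_extChartAt (by simp))
        (hf.mdifferentiableAt (by simp)), tmap_extChartAt_self]
  rfl

theorem chartRep_pullback_eventuallyEq {f : X → Y} {x₀ : X} {u : E}
    (hu : u ∈ (extChartAt I x₀).target)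
    (hf : ContMDiffAt I I' ∞ f ((extChartAt I x₀).symm u)) (φ : DForm E' Y n V) :
    chartRep I (pullback I I' f φ) x₀ =ᶠ[𝓝 u]
      pullback 𝓘(ℝ, E) I' (fun w => f ((extChartAt I x₀).symm w)) φ := by
  have hs := contMDiffAt_extChartAt_symm hu
  have h2 : ∀ᶠ w in 𝓝 u, ContMDiffAt I I' 1 f ((extChartAt I x₀).symm w) :=
    hs.continuousAt.eventually ((contMDiffAt_iff_contMDiffAt_nhds (by simp)).1 (hf.of_le (by simp)))
  filter_upwards [h2, extChartAt_target_mem_nhds_of_mem hu] with w hw hw'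
  exact (pullback_comp_apply φ (hw.mdifferentiableAt one_ne_zero)
    ((contMDiffAt_extChartAt_symm hw').mdifferentiableAt (by simp))).symm

theorem IsSmooth.pullback {φ : DForm E' Y n V} (hφ : IsSmooth I' φ) {f : X → Y}
    (hf : ContMDiff I I' ∞ f) : IsSmooth I (DForm.pullback I I' f φ) := by
  refine isSmooth_iff_contDiffAt.2 fun x₀ u hu => ?_
  refine ContDiffAt.congr_of_eventuallyEq ?_ (chartRep_pullback_eventuallyEq hu (hf _) φ)
  exact hφ.contDiffAt_pullback ((hf _).comp u (contMDiffAt_extChartAt_symm hu))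

/-- The exterior derivative commutes with pullbacks. -/

theorem IsSmooth.extD_pullback {φ : DForm E' Y n V} (hφ : IsSmooth I' φ) {f : X → Y}
    (hf : ContMDiff I I' ∞ f) :
    extD I (DForm.pullback I I' f φ) = DForm.pullback I I' f (extD I' φ) := by
  funext x
  have hu := mem_extChartAt_target (I := I) x
  have hs := contMDiffAt_extChartAt_symm hu
  have hfs : ContMDiffAt 𝓘(ℝ, E) I' ∞ (fun w => f ((extChartAt I x).symm w)) (extChartAt I x x) :=
    (hf _).comp _ hs
  rw [extD_apply_eq, (chartRep_pullback_eventuallyEq hu (hf _) φ).extDeriv_eq,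
    hφ.extDeriv_pullback hfs,
    tmap_comp (I' := I) _ ((hf _).mdifferentiableAt (by simp)) (hs.mdifferentiableAt (by simp)),
    tmap_extChartAt_symm_self, extChartAt_to_inv]
  rfl

/-- `extD` uses a different chart at each point. Naturality under an inverse chart shows that a
single chart computes it on its whole target, which is what smoothness of `dφ` and `d² = 0` require.
-/
theorem IsSmooth.chartRep_extD {φ : DForm E X n V} (hφ : IsSmooth I φ) {x₀ : X} {u : E}
    (hu : u ∈ (extChartAt I x₀).target) :
    chartRep I (extD I φ) x₀ u = extDeriv (chartRep I φ x₀) u :=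
  (hφ.extDeriv_pullback (contMDiffAt_extChartAt_symm hu)).symm

theorem IsSmooth.chartRep_extD_eventuallyEq {φ : DForm E X n V} (hφ : IsSmooth I φ) {x₀ : X}
    {u : E} (hu : u ∈ (extChartAt I x₀).target) :
    chartRep I (extD I φ) x₀ =ᶠ[𝓝 u] extDeriv (chartRep I φ x₀) := by
  filter_upwards [extChartAt_target_mem_nhds_of_mem hu] with w hw
  exact hφ.chartRep_extD hw

theorem IsSmooth.extD {φ : DForm E X n V} (hφ : IsSmooth I φ) : IsSmooth I (extD I φ) :=
  isSmooth_iff_contDiffAt.2 fun x₀ u hu =>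
    (contDiffAt_extDeriv (isSmooth_iff_contDiffAt.1 hφ x₀ u hu)).congr_of_eventuallyEq
      (hφ.chartRep_extD_eventuallyEq hu)

theorem IsSmooth.extD_extD {φ : DForm E X n V} (hφ : IsSmooth I φ) :
    DForm.extD I (DForm.extD I φ) = 0 := by
  funext x
  have hu := mem_extChartAt_target (I := I) x
  rw [extD_apply_eq, (hφ.chartRep_extD_eventuallyEq hu).extDeriv_eq]
  exact extDeriv_extDeriv_apply (isSmooth_iff_contDiffAt.1 hφ x _ hu) minSmoothness_two_le_infty

theorem IsSmooth.contDiffAt_self {φ : DForm E X n V} (hφ : IsSmooth I φ) (x : X) :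
    ContDiffAt ℝ ∞ (chartRep I φ x) (extChartAt I x x) :=
  isSmooth_iff_contDiffAt.1 hφ x _ (mem_extChartAt_target _)

theorem IsSmooth.differentiableAt_self {φ : DForm E X n V} (hφ : IsSmooth I φ) (x : X) :
    DifferentiableAt ℝ (chartRep I φ x) (extChartAt I x x) :=
  (hφ.contDiffAt_self x).differentiableAt (by simp)

theorem IsSmooth.add {φ ψ : DForm E X n V} (hφ : IsSmooth I φ) (hψ : IsSmooth I ψ) :
    IsSmooth I (φ + ψ) :=
  fun x₀ => (hφ x₀).add (hψ x₀)

theorem IsSmooth.sub {φ ψ : DForm E X n V} (hφ : IsSmooth I φ) (hψ : IsSmooth I ψ) :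
    IsSmooth I (φ - ψ) :=
  fun x₀ => (hφ x₀).sub (hψ x₀)

theorem IsSmooth.const_smul {φ : DForm E X n V} (hφ : IsSmooth I φ) (c : ℝ) :
    IsSmooth I (c • φ) :=
  fun x₀ => (hφ x₀).const_smul c

theorem extD_add {φ ψ : DForm E X n V} (hφ : IsSmooth I φ) (hψ : IsSmooth I ψ) :
    extD I (φ + ψ) = extD I φ + extD I ψ := by
  funext x
  simp only [extD_apply_eq, Pi.add_apply]
  exact extDeriv_add (hφ.differentiableAt_self x) (hψ.differentiableAt_self x)

theorem extD_smul (c : ℝ) (φ : DForm E X n V) : extD I (c • φ) = c • extD I φ := by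
  funext x
  simp only [extD_apply_eq, Pi.smul_apply]
  exact extDeriv_smul c (chartRep I φ x)

theorem extD_sub {φ ψ : DForm E X n V} (hφ : IsSmooth I φ) (hψ : IsSmooth I ψ) :
    extD I (φ - ψ) = extD I φ - extD I ψ := by
  have h : φ - ψ = φ + (-1 : ℝ) • ψ := by rw [neg_one_smul, sub_eq_add_neg]
  rw [h, extD_add hφ (hψ.const_smul _), extD_smul, neg_one_smul, sub_eq_add_neg]

theorem IsSmooth.mapVal {φ : DForm E X n V} (hφ : IsSmooth I φ) {L : X → V →L[ℝ] W}
    (hL : ContMDiff I 𝓘(ℝ, V →L[ℝ] W) ∞ L) : IsSmooth I (mapVal L φ) := by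
  refine isSmooth_iff_contDiffAt.2 fun x₀ u hu => contDiffAt_alternating_of_eval fun v => ?_
  have h1 : ContDiffAt ℝ ∞ (fun w => L ((extChartAt I x₀).symm w)) u :=
    contMDiffAt_iff_contDiffAt.1 ((hL _).comp u (contMDiffAt_extChartAt_symm hu))
  exact h1.clm_apply (contDiffAt_alternating_eval (isSmooth_iff_contDiffAt.1 hφ x₀ u hu) v)

theorem IsSmooth.wedge {φ : DForm E X k V} {ψ : DForm E X l W} (hφ : IsSmooth I φ)
    (hψ : IsSmooth I ψ) (B : V →L[ℝ] W →L[ℝ] U) : IsSmooth I (wedge B φ ψ) := by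
  refine isSmooth_iff_contDiffAt.2 fun x₀ u hu => contDiffAt_alternating_of_eval fun v => ?_
  simp only [chartRep, pullback_wedge, wedge_apply]
  refine ContDiffAt.const_smul _ (ContDiffAt.sum fun σ _ => ?_)
  simp only [Units.smul_def]
  refine ContDiffAt.const_smul _ ?_
  exact (B.contDiff.contDiffAt.comp u
      (contDiffAt_alternating_eval (isSmooth_iff_contDiffAt.1 hφ x₀ u hu) _)).clm_apply
    (contDiffAt_alternating_eval (isSmooth_iff_contDiffAt.1 hψ x₀ u hu) _)

/-- The Leibniz rule for a point-dependent linear map applied to a form. -/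

theorem extD_mapVal_apply {φ : DForm E X n V} (hφ : IsSmooth I φ) {L : X → V →L[ℝ] W}
    (hL : ContMDiff I 𝓘(ℝ, V →L[ℝ] W) ∞ L) (x : X) (v : Fin (n + 1) → E) :
    extD I (mapVal L φ) x v = L x (extD I φ x v) +
      ∑ i, (-1 : ℤ) ^ i.val • tmap I 𝓘(ℝ, V →L[ℝ] W) L x (v i) (φ x (i.removeNth v)) := by
  have hu := mem_extChartAt_target (I := I) x
  have hs := contMDiffAt_extChartAt_symm hu
  have hLs := (hL _).comp _ hs
  have h1 : DifferentiableAt ℝ (fun w => L ((extChartAt I x).symm w)) (extChartAt I x x) :=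
    (contMDiffAt_iff_contDiffAt.1 hLs).differentiableAt (by simp)
  have e1 : fderiv ℝ (fun w => L ((extChartAt I x).symm w)) (extChartAt I x x) =
      tmap I 𝓘(ℝ, V →L[ℝ] W) L x := by
    rw [← tmap_eq_fderiv, tmap_comp (I' := I) _ ((hL _).mdifferentiableAt (by simp))
      (hs.mdifferentiableAt (by simp)), tmap_extChartAt_symm_self, extChartAt_to_inv]
    rfl
  rw [extD_apply_eq, extD_apply_eq,
    extDeriv_apply (((hφ.mapVal hL).contDiffAt_self x).differentiableAt (by simp)),
    extDeriv_apply (hφ.differentiableAt_self x), map_sum, ← Finset.sum_add_distrib]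
  refine Finset.sum_congr rfl fun i _ => ?_
  have h2 := contDiffAt_alternating_eval (hφ.contDiffAt_self x) (i.removeNth v)
  have h3 := fderiv_clm_apply h1 (h2.differentiableAt (by simp))
  have h4 : (fun w => chartRep I (DForm.mapVal L φ) x w (i.removeNth v)) = fun w =>
      L ((extChartAt I x).symm w) (chartRep I φ x w (i.removeNth v)) := rfl
  rw [h4, h3, e1, chartRep_self]
  simp

theorem extD_mapVal_const {φ : DForm E X n V} (hφ : IsSmooth I φ) (L : V →L[ℝ] W) :
    extD I (mapVal (fun _ => L) φ) = mapVal (fun _ => L) (extD I φ) := by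
  funext x
  ext v
  rw [extD_mapVal_apply hφ contMDiff_const, tmap_const]
  simp [mapVal_apply]

end Smooth
end DForm

/-! ### The Leibniz rule for wedge products. -/

section Leibniz

variable {E : Type*} [NormedAddCommGroup E] [NormedSpace ℝ E]
  {V W U : Type*} [NormedAddCommGroup V] [NormedSpace ℝ V]
  [NormedAddCommGroup W] [NormedSpace ℝ W] [NormedAddCommGroup U] [NormedSpace ℝ U]

theorem removeNth_two {T : Type*} (v : Fin 2 → T) :
    Fin.removeNth 0 v = ![v 1] ∧ Fin.removeNth 1 v = ![v 0] := by
  refine ⟨?_, ?_⟩ <;> (ext i; fin_cases i; rfl)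

theorem removeNth_three {T : Type*} (v : Fin 3 → T) :
    Fin.removeNth 0 v = ![v 1, v 2] ∧ Fin.removeNth 1 v = ![v 0, v 2] ∧
      Fin.removeNth 2 v = ![v 0, v 1] := by
  refine ⟨?_, ?_, ?_⟩ <;> (ext i; fin_cases i <;> rfl)

theorem removeNth_four {T : Type*} (v : Fin 4 → T) :
    Fin.removeNth 0 v = ![v 1, v 2, v 3] ∧ Fin.removeNth 1 v = ![v 0, v 2, v 3] ∧
      Fin.removeNth 2 v = ![v 0, v 1, v 3] ∧ Fin.removeNth 3 v = ![v 0, v 1, v 2] := by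
  refine ⟨?_, ?_, ?_, ?_⟩ <;> (ext i; fin_cases i <;> rfl)

theorem extDeriv_one_apply {f : E → E [⋀^Fin 1]→L[ℝ] V} {u : E} (h : DifferentiableAt ℝ f u)
    (v : Fin 2 → E) :
    extDeriv f u v = fderiv ℝ (fun w => f w ![v 1]) u (v 0)
      - fderiv ℝ (fun w => f w ![v 0]) u (v 1) := by
  obtain ⟨h0, h1⟩ := removeNth_two v
  rw [extDeriv_apply h, Fin.sum_univ_two, h0, h1]
  simp [sub_eq_add_neg]

theorem extDeriv_two_apply {f : E → E [⋀^Fin 2]→L[ℝ] V} {u : E} (h : DifferentiableAt ℝ f u)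
    (v : Fin 3 → E) :
    extDeriv f u v = fderiv ℝ (fun w => f w ![v 1, v 2]) u (v 0)
      - fderiv ℝ (fun w => f w ![v 0, v 2]) u (v 1)
      + fderiv ℝ (fun w => f w ![v 0, v 1]) u (v 2) := by
  obtain ⟨h0, h1, h2⟩ := removeNth_three v
  rw [extDeriv_apply h, Fin.sum_univ_three, h0, h1, h2]
  simp [sub_eq_add_neg]

theorem extDeriv_three_apply {f : E → E [⋀^Fin 3]→L[ℝ] V} {u : E} (h : DifferentiableAt ℝ f u)
    (v : Fin 4 → E) :
    extDeriv f u v = fderiv ℝ (fun w => f w ![v 1, v 2, v 3]) u (v 0)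
      - fderiv ℝ (fun w => f w ![v 0, v 2, v 3]) u (v 1)
      + fderiv ℝ (fun w => f w ![v 0, v 1, v 3]) u (v 2)
      - fderiv ℝ (fun w => f w ![v 0, v 1, v 2]) u (v 3) := by
  obtain ⟨h0, h1, h2, h3⟩ := removeNth_four v
  rw [extDeriv_apply h, Fin.sum_univ_four, h0, h1, h2, h3]
  simp [sub_eq_add_neg, pow_succ]

theorem hasFDerivAt_alternating_eval {n : ℕ} {f : E → E [⋀^Fin n]→L[ℝ] V} {u : E}
    (h : DifferentiableAt ℝ f u) (v : Fin n → E) :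
    HasFDerivAt (fun w => f w v) (fderiv ℝ (fun w => f w v) u) u :=
  ((ContinuousAlternatingMap.apply ℝ E V v).differentiableAt.comp u h).hasFDerivAt

namespace DForm

/-- After the product rule for `B`, both sides are the same signed sum of terms `B(∂f, g)` and `B(f,
∂g)`. The degrees `1 + 1 + 1` and `1 + (1 + 1)` both compute to `3`, so no `castDeg` is needed. -/
theorem extDeriv_wedge_one_one {B : V →L[ℝ] W →L[ℝ] U} {f : DForm E E 1 V} {g : DForm E E 1 W}
    {u : E} (hf : DifferentiableAt ℝ f u) (hg : DifferentiableAt ℝ g u)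
    (hw : DifferentiableAt ℝ (wedge B f g) u) :
    extDeriv (wedge B f g) u = (wedge B (extDeriv f) g - wedge B f (extDeriv g) : DForm E E 3 U) u := by
  ext v
  have D := fun a b => B.hasFDerivAt_of_bilinear (hasFDerivAt_alternating_eval hf a)
    (hasFDerivAt_alternating_eval hg b)
  rw [extDeriv_two_apply hw, sub_apply', wedge_two_one_apply, wedge_one_two_apply]
  have D' := fun a b c d => ((D a b).sub (D c d)).fderiv
  simp only [Pi.sub_def] at D'
  simp only [wedge_one_one_apply, extDeriv_one_apply hf, extDeriv_one_apply hg, D']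
  simp
  abel

theorem extDeriv_wedge_one_two {B : V →L[ℝ] W →L[ℝ] U} {f : DForm E E 1 V} {g : DForm E E 2 W}
    {u : E} (hf : DifferentiableAt ℝ f u) (hg : DifferentiableAt ℝ g u)
    (hw : DifferentiableAt ℝ (wedge B f g) u) :
    extDeriv (wedge B f g) u = (wedge B (extDeriv f) g - wedge B f (extDeriv g) : DForm E E 4 U) u := by
  ext v
  have D := fun a b => B.hasFDerivAt_of_bilinear (hasFDerivAt_alternating_eval hf a)
    (hasFDerivAt_alternating_eval hg b)
  rw [extDeriv_three_apply hw, sub_apply', wedge_two_two_apply, wedge_one_three_apply]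
  have D' := fun a b c d e f => (((D a b).sub (D c d)).add (D e f)).fderiv
  simp only [Pi.sub_def, Pi.add_def] at D'
  simp only [wedge_one_two_apply, extDeriv_one_apply hf, extDeriv_two_apply hg, D']
  simp
  abel

end DForm
end Leibniz

namespace DForm

variable {E : Type*} [NormedAddCommGroup E] [NormedSpace ℝ E] [FiniteDimensional ℝ E]
  {K : Type*} [TopologicalSpace K] {I : ModelWithCorners ℝ E K} [I.Boundaryless]
  {X : Type*} [TopologicalSpace X] [ChartedSpace K X] [IsManifold I ∞ X]
  {V W U : Type*} [NormedAddCommGroup V] [NormedSpace ℝ V] [FiniteDimensional ℝ V]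
  [NormedAddCommGroup W] [NormedSpace ℝ W] [FiniteDimensional ℝ W]
  [NormedAddCommGroup U] [NormedSpace ℝ U] [FiniteDimensional ℝ U]

/-- The wedge product only involves the values at one point, so it can be compared across different
base spaces; this carries the Leibniz rule from a chart to the manifold. -/
theorem wedge_congr_apply {X' : Type*} {k l : ℕ} {B : V →L[ℝ] W →L[ℝ] U} {φ : DForm E X k V}
    {ψ : DForm E X l W} {φ' : DForm E X' k V} {ψ' : DForm E X' l W} {x : X} {x' : X'}
    (h₁ : φ x = φ' x') (h₂ : ψ x = ψ' x') : wedge B φ ψ x = wedge B φ' ψ' x' := by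
  simp only [wedge, h₁, h₂]

theorem extD_wedge_one_one (B : V →L[ℝ] W →L[ℝ] U) {φ : DForm E X 1 V} {ψ : DForm E X 1 W}
    (hφ : IsSmooth I φ) (hψ : IsSmooth I ψ) :
    extD I (wedge B φ ψ) = (wedge B (extD I φ) ψ - wedge B φ (extD I ψ) : DForm E X 3 U) := by
  funext x
  have h := (hφ.wedge hψ B).differentiableAt_self x
  rw [extD_apply_eq]
  simp only [chartRep, pullback_wedge] at h ⊢
  refine (extDeriv_wedge_one_one (hφ.differentiableAt_self x) (hψ.differentiableAt_self x) h).trans ?_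
  exact congrArg₂ (fun a b : E [⋀^Fin 3]→L[ℝ] U => a - b)
    (wedge_congr_apply (extD_apply_eq φ x).symm (chartRep_self ψ x))
    (wedge_congr_apply (chartRep_self φ x) (extD_apply_eq ψ x).symm)

theorem extD_wedge_one_two (B : V →L[ℝ] W →L[ℝ] U) {φ : DForm E X 1 V} {ψ : DForm E X 2 W}
    (hφ : IsSmooth I φ) (hψ : IsSmooth I ψ) :
    extD I (wedge B φ ψ) = (wedge B (extD I φ) ψ - wedge B φ (extD I ψ) : DForm E X 4 U) := by
  funext x
  have h := (hφ.wedge hψ B).differentiableAt_self x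
  rw [extD_apply_eq]
  simp only [chartRep, pullback_wedge] at h ⊢
  refine (extDeriv_wedge_one_two (hφ.differentiableAt_self x) (hψ.differentiableAt_self x) h).trans ?_
  exact congrArg₂ (fun a b : E [⋀^Fin 4]→L[ℝ] U => a - b)
    (wedge_congr_apply (extD_apply_eq φ x).symm (chartRep_self ψ x))
    (wedge_congr_apply (chartRep_self φ x) (extD_apply_eq ψ x).symm)

end DForm

/-! ### Product rules for tangent maps, and their dependence on parameters. -/

section Calculus

variable {E : Type*} [NormedAddCommGroup E] [NormedSpace ℝ E]
  {K : Type*} [TopologicalSpace K] {I : ModelWithCorners ℝ E K} [I.Boundaryless]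
  {E' : Type*} [NormedAddCommGroup E'] [NormedSpace ℝ E']
  {K' : Type*} [TopologicalSpace K'] {I' : ModelWithCorners ℝ E' K'} [I'.Boundaryless]
  {X : Type*} [TopologicalSpace X] [ChartedSpace K X] [IsManifold I ∞ X]
  {Y : Type*} [TopologicalSpace Y] [ChartedSpace K' Y] [IsManifold I' ∞ Y]
  {V W U : Type*} [NormedAddCommGroup V] [NormedSpace ℝ V]
  [NormedAddCommGroup W] [NormedSpace ℝ W] [NormedAddCommGroup U] [NormedSpace ℝ U]

theorem mdifferentiableAt_extChartAt_symm_self (x : X) :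
    MDifferentiableAt 𝓘(ℝ, E) I (extChartAt I x).symm (extChartAt I x x) :=
  (contMDiffAt_extChartAt_symm (mem_extChartAt_target x)).mdifferentiableAt (by simp)

theorem tmap_comp_of_eq {E'' : Type*} [NormedAddCommGroup E''] [NormedSpace ℝ E'']
    {K'' : Type*} [TopologicalSpace K''] {I'' : ModelWithCorners ℝ E'' K''}
    {Z : Type*} [TopologicalSpace Z] [ChartedSpace K'' Z] {g : Y → Z} {f : X → Y} {x : X} {y : Y}
    (hy : f x = y) (hg : MDifferentiableAt I' I'' g y) (hf : MDifferentiableAt I I' f x) :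
    tmap I I'' (fun y => g (f y)) x = (tmap I' I'' g y).comp (tmap I I' f x) := by
  subst hy
  exact tmap_comp x hg hf

/-- In the preferred chart at `x` no change of coordinates enters, so product rules on the manifold
reduce to those for `fderiv`. -/
theorem tmap_eq_tmap_symm {f : X → Y} {x : X} (hf : MDifferentiableAt I I' f x) :
    tmap I I' f x = tmap 𝓘(ℝ, E) I' (fun w => f ((extChartAt I x).symm w)) (extChartAt I x x) := by
  rw [tmap_comp_of_eq (extChartAt_to_inv x) hf (mdifferentiableAt_extChartAt_symm_self x),
    tmap_extChartAt_symm_self]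
  rfl

theorem tmap_eq_fderiv_symm {f : X → V} {x : X} (hf : MDifferentiableAt I 𝓘(ℝ, V) f x) :
    tmap I 𝓘(ℝ, V) f x = fderiv ℝ (fun w => f ((extChartAt I x).symm w)) (extChartAt I x x) := by
  rw [tmap_eq_tmap_symm hf, tmap_eq_fderiv]

theorem MDifferentiableAt.differentiableAt_symm {f : X → V} {x : X}
    (hf : MDifferentiableAt I 𝓘(ℝ, V) f x) :
    DifferentiableAt ℝ (fun w => f ((extChartAt I x).symm w)) (extChartAt I x x) := by
  rw [← mdifferentiableAt_iff_differentiableAt]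
  refine MDifferentiableAt.comp _ ?_ (mdifferentiableAt_extChartAt_symm_self x)
  rwa [extChartAt_to_inv]

theorem tmap_clm_comp {f : X → W →L[ℝ] U} {g : X → V →L[ℝ] W} {x : X}
    (hf : MDifferentiableAt I 𝓘(ℝ, W →L[ℝ] U) f x) (hg : MDifferentiableAt I 𝓘(ℝ, V →L[ℝ] W) g x)
    (v : E) :
    tmap I 𝓘(ℝ, V →L[ℝ] U) (fun y => (f y).comp (g y)) x v =
      (f x).comp (tmap I 𝓘(ℝ, V →L[ℝ] W) g x v) + (tmap I 𝓘(ℝ, W →L[ℝ] U) f x v).comp (g x) := by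
  have hf' := MDifferentiableAt.differentiableAt_symm hf
  have hg' := MDifferentiableAt.differentiableAt_symm hg
  have hfg : MDifferentiableAt I 𝓘(ℝ, V →L[ℝ] U) (fun y => (f y).comp (g y)) x := hf.clm_comp hg
  rw [tmap_eq_fderiv_symm hf, tmap_eq_fderiv_symm hg, tmap_eq_fderiv_symm hfg,
    fderiv_clm_comp hf' hg']
  simp [-extChartAt, extChartAt_to_inv]

theorem tmap_clm_apply {f : X → V →L[ℝ] W} {x : X}
    (hf : MDifferentiableAt I 𝓘(ℝ, V →L[ℝ] W) f x) (a : V) (v : E) :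
    tmap I 𝓘(ℝ, W) (fun y => f y a) x v = tmap I 𝓘(ℝ, V →L[ℝ] W) f x v a := by
  have h := tmap_comp (g := fun L : V →L[ℝ] W => L a) x
    (ContinuousLinearMap.apply ℝ W a).differentiableAt.mdifferentiableAt hf
  rw [h, tmap_eq_fderiv]
  have h2 : fderiv ℝ (fun L : V →L[ℝ] W => L a) (f x) = ContinuousLinearMap.apply ℝ W a :=
    (ContinuousLinearMap.apply ℝ W a).fderiv
  rw [h2]
  rfl

theorem tmap_clm_left_comp (L : V →L[ℝ] W) {f : X → V} {x : X}
    (hf : MDifferentiableAt I 𝓘(ℝ, V) f x) :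
    tmap I 𝓘(ℝ, W) (fun y => L (f y)) x = L.comp (tmap I 𝓘(ℝ, V) f x) := by
  rw [tmap_comp x L.differentiableAt.mdifferentiableAt hf, tmap_eq_fderiv, L.fderiv]

/-- The tangent maps at `x₀` of a smooth family of maps which send `x₀` to the same point depend
smoothly on the parameter. -/

theorem contMDiffAt_tmap_of_fixed {EN : Type*} [NormedAddCommGroup EN] [NormedSpace ℝ EN]
    {KN : Type*} [TopologicalSpace KN] {J : ModelWithCorners ℝ EN KN}
    {N : Type*} [TopologicalSpace N] [ChartedSpace KN N] [IsManifold J ∞ N]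
    {F : N → X → Y} {n₀ : N} {x₀ : X} {y₀ : Y}
    (hF : ContMDiffAt (J.prod I) I' ∞ (Function.uncurry F) (n₀, x₀)) (h : ∀ n, F n x₀ = y₀) :
    ContMDiffAt J 𝓘(ℝ, E →L[ℝ] E') ∞ (fun n => tmap I I' (F n) x₀) n₀ := by
  have hs := contMDiffAt_extChartAt_symm (mem_extChartAt_target (I := I) x₀)
  -- Since all `F n` send `x₀` to `y₀`, one chart at each of these points serves every parameter,
  -- and the coordinate derivative is `tmap` itself rather than a conjugate of it by coordinate
  -- changes.
  let f : N → E → E' := fun n b => extChartAt I' y₀ (F n ((extChartAt I x₀).symm b))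
  have hf : ContMDiffAt (J.prod 𝓘(ℝ, E)) 𝓘(ℝ, E') ∞ (Function.uncurry f)
      (n₀, extChartAt I x₀ x₀) := by
    have h1 : ContMDiffAt (J.prod 𝓘(ℝ, E)) (J.prod I) ∞
        (fun p : N × E => (p.1, (extChartAt I x₀).symm p.2)) (n₀, extChartAt I x₀ x₀) :=
      contMDiffAt_fst.prodMk (ContMDiffAt.comp (n₀, extChartAt I x₀ x₀) hs contMDiffAt_snd)
    have h2 : ContMDiffAt (J.prod 𝓘(ℝ, E)) I' ∞
        (fun p : N × E => F p.1 ((extChartAt I x₀).symm p.2)) (n₀, extChartAt I x₀ x₀) := by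
      refine ContMDiffAt.comp_of_eq hF h1 ?_
      rw [extChartAt_to_inv]
    refine ContMDiffAt.comp_of_eq (g := extChartAt I' y₀) (contMDiffAt_extChartAt (x := y₀)) h2 ?_
    simp only [extChartAt_to_inv, h]
  have key := ContMDiffAt.mfderiv (m := ∞) f (fun _ => extChartAt I x₀ x₀) hf contMDiffAt_const
    (by simp)
  have key' : ContMDiffAt J 𝓘(ℝ, E →L[ℝ] E') ∞
      (fun n => tmap 𝓘(ℝ, E) 𝓘(ℝ, E') (f n) (extChartAt I x₀ x₀)) n₀ := by
    have e := inTangentCoordinates_model_space (I := 𝓘(ℝ, E)) (I' := 𝓘(ℝ, E')) (fun _ : N => extChartAt I x₀ x₀)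
      (fun n => f n (extChartAt I x₀ x₀))
      (fun n => tmap 𝓘(ℝ, E) 𝓘(ℝ, E') (f n) (extChartAt I x₀ x₀)) n₀
    rw [← e]
    exact key
  refine key'.congr_of_eventuallyEq ?_
  have h3 : ∀ᶠ n in 𝓝 n₀, ContMDiffAt (J.prod I) I' 1 (Function.uncurry F) (n, x₀) :=
    (Continuous.tendsto' (by fun_prop) n₀ (n₀, x₀) rfl : Filter.Tendsto (fun n : N => (n, x₀)) _ _).eventually
      ((contMDiffAt_iff_contMDiffAt_nhds (by simp)).1 (hF.of_le (by simp)))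
  filter_upwards [h3] with n hn
  have hFn : MDifferentiableAt I I' (F n) x₀ :=
    ContMDiffAt.mdifferentiableAt (n := 1)
      (hn.comp x₀ (contMDiffAt_const.prodMk contMDiffAt_id)) (by simp)
  have hFs : MDifferentiableAt 𝓘(ℝ, E) I' (fun w => F n ((extChartAt I x₀).symm w))
      (extChartAt I x₀ x₀) := by
    refine MDifferentiableAt.comp _ ?_ (mdifferentiableAt_extChartAt_symm_self x₀)
    rwa [extChartAt_to_inv]
  have h4 := tmap_comp_of_eq (g := extChartAt I' y₀) (f := fun w => F n ((extChartAt I x₀).symm w))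
    (x := extChartAt I x₀ x₀) (y := y₀) (by simp only [extChartAt_to_inv, h])
    (mdifferentiableAt_extChartAt (by simp)) hFs
  rw [tmap_eq_tmap_symm hFn]
  rw [tmap_extChartAt_self] at h4
  exact h4.symm

end Calculus

/-! ### The adjoint action and the Maurer–Cartan form of a Lie group. -/

section LieGroupCalculus

variable {E : Type*} [NormedAddCommGroup E] [NormedSpace ℝ E]
  {K : Type*} [TopologicalSpace K] (I : ModelWithCorners ℝ E K)
  {S : Type*} [TopologicalSpace S] [ChartedSpace K S] [Group S]

/-- The adjoint action of a Lie group with an arbitrary model. -/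
def conjStar (s : S) : E →L[ℝ] E := tmap I I (fun x : S => s * x * s⁻¹) 1

variable (S) in
/-- The differential at `1` of the adjoint action. -/
def adStar : E →L[ℝ] E →L[ℝ] E := tmap I 𝓘(ℝ, E →L[ℝ] E) (fun s : S => conjStar I s) 1

/-- The value of the left-invariant Maurer-Cartan form at `s`. -/
def mcAt (s : S) : E →L[ℝ] E := tmap I I (fun x : S => s⁻¹ * x) s

variable (S) in
/-- The left-invariant Maurer-Cartan form of a Lie group with an arbitrary model. -/
def mcForm : DForm E S 1 E :=
  fun s => ContinuousAlternatingMap.ofSubsingleton ℝ E E (0 : Fin 1) (mcAt I s)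

variable (S) in
/-- The multiplication in the preferred chart at `1`. -/
def chartMul (p : E × E) : E :=
  extChartAt I (1 : S) ((extChartAt I (1 : S)).symm p.1 * (extChartAt I (1 : S)).symm p.2)

variable (S) in
/-- The coordinates of `1` in the preferred chart at `1`. -/
def chartOne : E := extChartAt I (1 : S) 1

variable (S) in
/-- The left-invariant vector fields in the preferred chart at `1`. -/
def chartLeft (u : E) : E →L[ℝ] E :=
  (fderiv ℝ (chartMul I S) (u, chartOne I S)).comp (ContinuousLinearMap.inr ℝ E E)

variable (S) in
/-- The right-invariant vector fields in the preferred chart at `1`. -/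
def chartRight (u : E) : E →L[ℝ] E :=
  (fderiv ℝ (chartMul I S) (chartOne I S, u)).comp (ContinuousLinearMap.inl ℝ E E)

theorem mcForm_apply (s : S) (v : Fin 1 → E) : mcForm I S s v = mcAt I s (v 0) := rfl

variable [I.Boundaryless] [LieGroup I ∞ S]

instance isManifold_of_lieGroup_infty : IsManifold I ∞ S := LieGroup.toContMDiffMul.toIsManifold

variable {I}

theorem symm_chartOne : (extChartAt I (1 : S)).symm (chartOne I S) = 1 := extChartAt_to_inv _

theorem chartOne_mem_target : chartOne I S ∈ (extChartAt I (1 : S)).target :=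
  mem_extChartAt_target _

theorem contMDiff_mul_left' (s : S) : ContMDiff I I ∞ (fun x : S => s * x) := contMDiff_mul_left

theorem contMDiff_mul_right' (s : S) : ContMDiff I I ∞ (fun x : S => x * s) := contMDiff_mul_right

theorem contMDiff_conj (s : S) : ContMDiff I I ∞ (fun x : S => s * x * s⁻¹) :=
  (contMDiff_mul_right' s⁻¹).comp (contMDiff_mul_left' s)

theorem contDiffAt_chartMul : ContDiffAt ℝ ∞ (chartMul I S) (chartOne I S, chartOne I S) := by
  have hs := contMDiffAt_extChartAt_symm (chartOne_mem_target (I := I) (S := S))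
  rw [← contMDiffAt_iff_contDiffAt]
  have h1 : ContMDiffAt 𝓘(ℝ, E × E) I ∞ (fun p : E × E => (extChartAt I (1 : S)).symm p.1)
      (chartOne I S, chartOne I S) :=
    ContMDiffAt.comp (chartOne I S, chartOne I S) hs contDiff_fst.contMDiff.contMDiffAt
  have h2 : ContMDiffAt 𝓘(ℝ, E × E) I ∞ (fun p : E × E => (extChartAt I (1 : S)).symm p.2)
      (chartOne I S, chartOne I S) :=
    ContMDiffAt.comp (chartOne I S, chartOne I S) hs contDiff_snd.contMDiff.contMDiffAt
  refine ContMDiffAt.comp_of_eq (g := extChartAt I (1 : S)) (contMDiffAt_extChartAt (x := 1))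
    (h1.mul h2) ?_
  simp [-extChartAt, symm_chartOne]

theorem eventually_differentiableAt_chartMul :
    ∀ᶠ p in 𝓝 (chartOne I S, chartOne I S), DifferentiableAt ℝ (chartMul I S) p := by
  filter_upwards [((contDiffAt_chartMul (I := I) (S := S)).of_le
    (m := 1) (by simp)).eventually (by simp)] with p hp
  exact hp.differentiableAt (by simp)

/-- The frame is a partial derivative of the multiplication, so its derivative is a mixed second
derivative. The right-invariant frame gives the other mixed derivative, and symmetry relates the
two. -/
theorem fderiv_chartLeft (v w : E) :
    fderiv ℝ (chartLeft I S) (chartOne I S) v w =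
      fderiv ℝ (fderiv ℝ (chartMul I S)) (chartOne I S, chartOne I S) (v, 0) (0, w) := by
  have h2 : DifferentiableAt ℝ (fderiv ℝ (chartMul I S)) (chartOne I S, chartOne I S) :=
    ((contDiffAt_chartMul (I := I) (S := S)).fderiv_right (m := ∞) (by simp)).differentiableAt
      (by simp)
  have h3 : HasFDerivAt (fun u : E => (u, chartOne I S)) (ContinuousLinearMap.inl ℝ E E)
      (chartOne I S) := hasFDerivAt_prodMk_left _ _
  have h4 : HasFDerivAt (chartLeft I S) _ (chartOne I S) :=
    (HasFDerivAt.comp (f := fun u : E => (u, chartOne I S)) (chartOne I S)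
      h2.hasFDerivAt h3).clm_comp (hasFDerivAt_const _ _)
  rw [h4.fderiv]
  simp

theorem fderiv_chartRight (v w : E) :
    fderiv ℝ (chartRight I S) (chartOne I S) v w =
      fderiv ℝ (fderiv ℝ (chartMul I S)) (chartOne I S, chartOne I S) (0, v) (w, 0) := by
  have h2 : DifferentiableAt ℝ (fderiv ℝ (chartMul I S)) (chartOne I S, chartOne I S) :=
    ((contDiffAt_chartMul (I := I) (S := S)).fderiv_right (m := ∞) (by simp)).differentiableAt
      (by simp)
  have h3 : HasFDerivAt (fun u : E => (chartOne I S, u)) (ContinuousLinearMap.inr ℝ E E)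
      (chartOne I S) := hasFDerivAt_prodMk_right _ _
  have h4 : HasFDerivAt (chartRight I S) _ (chartOne I S) :=
    (h2.hasFDerivAt.comp (chartOne I S) h3).clm_comp (hasFDerivAt_const _ _)
  rw [h4.fderiv]
  simp

theorem contDiffAt_chartLeft : ContDiffAt ℝ ∞ (chartLeft I S) (chartOne I S) := by
  have h2 : ContDiffAt ℝ ∞ (fderiv ℝ (chartMul I S)) (chartOne I S, chartOne I S) :=
    (contDiffAt_chartMul (I := I) (S := S)).fderiv_right (m := ∞) (by simp)
  exact (ContDiffAt.comp (f := fun u : E => (u, chartOne I S)) (chartOne I S) h2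
    (contDiffAt_id.prodMk contDiffAt_const)).clm_comp contDiffAt_const

theorem contDiffAt_chartRight : ContDiffAt ℝ ∞ (chartRight I S) (chartOne I S) := by
  have h2 : ContDiffAt ℝ ∞ (fderiv ℝ (chartMul I S)) (chartOne I S, chartOne I S) :=
    (contDiffAt_chartMul (I := I) (S := S)).fderiv_right (m := ∞) (by simp)
  exact (h2.comp (chartOne I S) (contDiffAt_const.prodMk contDiffAt_id)).clm_comp contDiffAt_const

/-- The derivatives of the left- and right-invariant frames are transposes of each other. -/

theorem fderiv_chartRight_eq (v w : E) :
    fderiv ℝ (chartRight I S) (chartOne I S) v w = fderiv ℝ (chartLeft I S) (chartOne I S) w v := by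
  rw [fderiv_chartRight, fderiv_chartLeft]
  exact ((contDiffAt_chartMul (I := I) (S := S)).isSymmSndFDerivAt minSmoothness_two_le_infty)
    (0, v) (w, 0)

theorem eventually_mem_chart_mul :
    ∀ᶠ u in 𝓝 (chartOne I S), u ∈ (extChartAt I (1 : S)).target ∧
      DifferentiableAt ℝ (chartMul I S) (u, chartOne I S) ∧
      DifferentiableAt ℝ (chartMul I S) (chartOne I S, u) := by
  have h := eventually_differentiableAt_chartMul (I := I) (S := S)
  have h1 : Filter.Tendsto (fun u : E => (u, chartOne I S)) (𝓝 (chartOne I S))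
      (𝓝 (chartOne I S, chartOne I S)) := Continuous.tendsto' (by fun_prop) _ _ rfl
  have h2 : Filter.Tendsto (fun u : E => (chartOne I S, u)) (𝓝 (chartOne I S))
      (𝓝 (chartOne I S, chartOne I S)) := Continuous.tendsto' (by fun_prop) _ _ rfl
  filter_upwards [extChartAt_target_mem_nhds_of_mem (chartOne_mem_target (I := I) (S := S)),
    h1.eventually h, h2.eventually h] with u a b c using ⟨a, b, c⟩

theorem chartLeft_eq_tmap {u : E} (hu : u ∈ (extChartAt I (1 : S)).target)
    (hd : DifferentiableAt ℝ (chartMul I S) (u, chartOne I S)) :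
    chartLeft I S u =
      tmap I 𝓘(ℝ, E) (fun x : S => extChartAt I 1 ((extChartAt I 1).symm u * x)) 1 := by
  have hm : MDifferentiableAt I 𝓘(ℝ, E)
      (fun x : S => extChartAt I 1 ((extChartAt I 1).symm u * x)) 1 := by
    refine MDifferentiableAt.comp (g := extChartAt I (1 : S)) _ ?_
      ((contMDiff_mul_left' _).mdifferentiableAt (by simp))
    rw [mul_one]
    exact mdifferentiableAt_extChartAt (by simpa using (extChartAt I (1 : S)).map_target hu)
  rw [tmap_eq_fderiv_symm hm]
  have h3 : HasFDerivAt (fun w : E => (u, w)) (ContinuousLinearMap.inr ℝ E E)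
      (chartOne I S) := hasFDerivAt_prodMk_right _ _
  exact (hd.hasFDerivAt.comp (chartOne I S) h3).fderiv.symm

theorem chartRight_eq_tmap {u : E} (hu : u ∈ (extChartAt I (1 : S)).target)
    (hd : DifferentiableAt ℝ (chartMul I S) (chartOne I S, u)) :
    chartRight I S u =
      tmap I 𝓘(ℝ, E) (fun x : S => extChartAt I 1 (x * (extChartAt I 1).symm u)) 1 := by
  have hm : MDifferentiableAt I 𝓘(ℝ, E)
      (fun x : S => extChartAt I 1 (x * (extChartAt I 1).symm u)) 1 := by
    refine MDifferentiableAt.comp (g := extChartAt I (1 : S)) _ ?_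
      ((contMDiff_mul_right' _).mdifferentiableAt (by simp))
    rw [one_mul]
    exact mdifferentiableAt_extChartAt (by simpa using (extChartAt I (1 : S)).map_target hu)
  rw [tmap_eq_fderiv_symm hm]
  have h3 : HasFDerivAt (fun w : E => (w, u)) (ContinuousLinearMap.inl ℝ E E)
      (chartOne I S) := hasFDerivAt_prodMk_left _ _
  exact (hd.hasFDerivAt.comp (chartOne I S) h3).fderiv.symm

theorem conjStar_one : conjStar I (1 : S) = ContinuousLinearMap.id ℝ E := by
  simp only [conjStar, one_mul, inv_one, mul_one]
  exact tmap_id 1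

theorem chartLeft_one : chartLeft I S (chartOne I S) = ContinuousLinearMap.id ℝ E := by
  obtain ⟨h1, h2, -⟩ := (eventually_mem_chart_mul (I := I) (S := S)).self_of_nhds
  rw [chartLeft_eq_tmap h1 h2]
  simp only [symm_chartOne, one_mul]
  exact tmap_extChartAt_self 1

theorem chartRight_one : chartRight I S (chartOne I S) = ContinuousLinearMap.id ℝ E := by
  obtain ⟨h1, -, h2⟩ := (eventually_mem_chart_mul (I := I) (S := S)).self_of_nhds
  rw [chartRight_eq_tmap h1 h2]
  simp only [symm_chartOne, mul_one]
  exact tmap_extChartAt_self 1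

theorem contMDiff_conjStar : ContMDiff I 𝓘(ℝ, E →L[ℝ] E) ∞ (fun s : S => conjStar I s) := by
  intro s
  refine contMDiffAt_tmap_of_fixed (F := fun s x : S => s * x * s⁻¹) (y₀ := 1) ?_ (by simp)
  exact ((contMDiff_fst.mul contMDiff_snd).mul contMDiff_fst.inv).contMDiffAt

theorem mdifferentiableAt_conjStar (s : S) :
    MDifferentiableAt I 𝓘(ℝ, E →L[ℝ] E) (fun s : S => conjStar I s) s :=
  (contMDiff_conjStar s).mdifferentiableAt (by simp)

/-- From `s x = (s x s⁻¹) s`: left translation is right translation after conjugation. -/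
theorem chartLeft_eq_chartRight_comp :
    chartLeft I S =ᶠ[𝓝 (chartOne I S)]
      fun u => (chartRight I S u).comp (conjStar I ((extChartAt I (1 : S)).symm u)) := by
  filter_upwards [eventually_mem_chart_mul (I := I) (S := S)] with u hu
  obtain ⟨hu, h1, h2⟩ := hu
  rw [chartLeft_eq_tmap hu h1, chartRight_eq_tmap hu h2]
  have hm : MDifferentiableAt I 𝓘(ℝ, E)
      (fun x : S => extChartAt I 1 (x * (extChartAt I 1).symm u)) 1 := by
    refine MDifferentiableAt.comp (g := extChartAt I (1 : S)) _ ?_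
      ((contMDiff_mul_right' _).mdifferentiableAt (by simp))
    rw [one_mul]
    exact mdifferentiableAt_extChartAt (by simpa using (extChartAt I (1 : S)).map_target hu)
  have h3 := tmap_comp_of_eq (f := fun x : S => (extChartAt I (1 : S)).symm u * x *
    ((extChartAt I (1 : S)).symm u)⁻¹) (x := 1) (by simp) hm
    ((contMDiff_conj ((extChartAt I (1 : S)).symm u)).mdifferentiableAt (by simp))
  simp only [inv_mul_cancel_right] at h3
  exact h3

/-- The differential of the adjoint action, in terms of the left-invariant frame in a chart. -/

theorem adStar_eq (v w : E) :
    adStar I S v w = fderiv ℝ (chartLeft I S) (chartOne I S) v w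
      - fderiv ℝ (chartLeft I S) (chartOne I S) w v := by
  have hc := MDifferentiableAt.differentiableAt_symm (mdifferentiableAt_conjStar (I := I) (1 : S))
  have hR := (contDiffAt_chartRight (I := I) (S := S)).differentiableAt (by simp)
  -- Write `L = R ∘ Ad` for the two frames. At `1` both `R` and `Ad` are the identity, so the
  -- product rule gives `DL = D Ad + DR`, and `DR` is the transpose of `DL`.
  have h := (chartLeft_eq_chartRight_comp (I := I) (S := S)).fderiv_eq (𝕜 := ℝ)
  rw [fderiv_clm_comp hR hc] at h
  rw [← fderiv_chartRight_eq v w, h, adStar, tmap_eq_fderiv_symm (mdifferentiableAt_conjStar 1)]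
  have h1 := symm_chartOne (I := I) (S := S)
  have h2 := chartRight_one (I := I) (S := S)
  simp only [chartOne] at h1 h2 ⊢
  simp [-extChartAt, h1, h2, conjStar_one]

theorem adStar_swap (v w : E) : adStar I S w v = - adStar I S v w := by
  rw [adStar_eq, adStar_eq, neg_sub]

/-- `chartLeft` is left translation read in the chart. This identifies its columns with the
left-invariant vector fields and makes it inverse to the Maurer–Cartan form. -/
theorem tmap_symm_comp_chartLeft :
    ∀ᶠ u in 𝓝 (chartOne I S), (tmap 𝓘(ℝ, E) I (extChartAt I (1 : S)).symm u).comp (chartLeft I S u) =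
      tmap I I (fun x : S => (extChartAt I (1 : S)).symm u * x) 1 := by
  filter_upwards [eventually_mem_chart_mul (I := I) (S := S)] with u hu
  obtain ⟨hu, h1, -⟩ := hu
  have hsrc := (extChartAt I (1 : S)).map_target hu
  rw [chartLeft_eq_tmap hu h1]
  have hm : MDifferentiableAt I 𝓘(ℝ, E)
      (fun x : S => extChartAt I 1 ((extChartAt I 1).symm u * x)) 1 := by
    refine MDifferentiableAt.comp (g := extChartAt I (1 : S)) _ ?_
      ((contMDiff_mul_left' _).mdifferentiableAt (by simp))
    rw [mul_one]
    exact mdifferentiableAt_extChartAt (by simpa using hsrc)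
  rw [← tmap_comp_of_eq (by rw [mul_one, (extChartAt I (1 : S)).right_inv hu])
    ((contMDiffAt_extChartAt_symm hu).mdifferentiableAt (by simp)) hm]
  refine tmap_congr ?_
  have hcont : ContinuousAt (fun x : S => (extChartAt I (1 : S)).symm u * x) 1 :=
    (contMDiff_mul_left' (I := I) _).continuous.continuousAt
  filter_upwards [hcont ((isOpen_extChartAt_source (I := I) (1 : S)).mem_nhds
    (by simpa using hsrc))] with x hx
  exact (extChartAt I (1 : S)).left_inv hx

theorem mcAt_comp_tmap (s : S) :
    (mcAt I s).comp (tmap I I (fun x : S => s * x) 1) = ContinuousLinearMap.id ℝ E := by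
  rw [mcAt, ← tmap_comp_of_eq (mul_one s) ((contMDiff_mul_left' _).mdifferentiableAt (by simp))
    ((contMDiff_mul_left' _).mdifferentiableAt (by simp))]
  simp only [inv_mul_cancel_left]
  exact tmap_id 1

/-- Mathlib's Lie bracket on `T_1 S` is the differential of the adjoint action. -/

theorem mlieBracket_mulInvariantVectorField (v w : E) :
    (VectorField.mlieBracket I (mulInvariantVectorField (I := I) (G := S) v)
      (mulInvariantVectorField (I := I) (G := S) w) 1 : E) = adStar I S v w := by
  have key : ∀ a : E, (fun u => chartLeft I S u a) =ᶠ[𝓝 (chartOne I S)]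
      VectorField.mpullbackWithin 𝓘(ℝ, E) I (extChartAt I (1 : S)).symm
        (mulInvariantVectorField (I := I) (G := S) a) Set.univ := by
    intro a
    filter_upwards [tmap_symm_comp_chartLeft (I := I) (S := S),
      eventually_mem_chart_mul (I := I) (S := S)] with u hu hu'
    have hinv := isInvertible_mfderivWithin_extChartAt_symm hu'.1
    rw [I.range_eq_univ] at hinv
    have h1 := DFunLike.congr_fun hu a
    have h2 : mfderivWithin 𝓘(ℝ, E) I (extChartAt I (1 : S)).symm Set.univ u
        (chartLeft I S u a) = mulInvariantVectorField (I := I) (G := S) a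
          ((extChartAt I (1 : S)).symm u) := by
      rw [mfderivWithin_univ]
      exact h1
    rw [VectorField.mpullbackWithin_apply, ← h2]
    exact (hinv.inverse_apply_eq.2 rfl).symm
  have hL := (contDiffAt_chartLeft (I := I) (S := S)).differentiableAt (by simp)
  have e1 : (VectorField.mlieBracket I (mulInvariantVectorField (I := I) (G := S) v)
      (mulInvariantVectorField (I := I) (G := S) w) 1 : E) =
      (tmap I 𝓘(ℝ, E) (extChartAt I (1 : S)) 1).inverse
        (VectorField.lieBracketWithin ℝ
          (VectorField.mpullbackWithin 𝓘(ℝ, E) I (extChartAt I (1 : S)).symm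
            (mulInvariantVectorField (I := I) (G := S) v) (Set.range I))
          (VectorField.mpullbackWithin 𝓘(ℝ, E) I (extChartAt I (1 : S)).symm
            (mulInvariantVectorField (I := I) (G := S) w) (Set.range I))
          ((extChartAt I (1 : S)).symm ⁻¹' Set.univ ∩ Set.range I) (chartOne I S)) := rfl
  rw [e1, tmap_extChartAt_self, ContinuousLinearMap.inverse_id, I.range_eq_univ,
    Set.preimage_univ, Set.inter_univ]
  refine (congrFun (VectorField.lieBracketWithin_univ (𝕜 := ℝ) (E := E)) (chartOne I S)).trans ?_
  refine ((key v).lieBracket_vectorField_eq (𝕜 := ℝ) (key w)).symm.trans ?_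
  -- The frame `L` is the identity at the coordinates of `1`, so the bracket of `u ↦ L(u) v` and `u
  -- ↦ L(u) w` there is `DL(v) w - DL(w) v`.
  rw [VectorField.lieBracket, adStar_eq, fderiv_clm_apply hL (differentiableAt_const _),
    fderiv_clm_apply hL (differentiableAt_const _), chartLeft_one]
  simp

theorem tmap_symm_one : tmap 𝓘(ℝ, E) I (extChartAt I (1 : S)).symm (chartOne I S) =
    ContinuousLinearMap.id ℝ E := tmap_extChartAt_symm_self 1

/-- The Maurer-Cartan form in a chart depends smoothly on the point. -/

theorem contDiffAt_mcAt_comp {x₀ : S} {u : E} (hu : u ∈ (extChartAt I x₀).target) :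
    ContDiffAt ℝ ∞ (fun w => (mcAt I ((extChartAt I x₀).symm w)).comp
      (tmap 𝓘(ℝ, E) I (extChartAt I x₀).symm w)) u := by
  have hs := contMDiffAt_extChartAt_symm hu
  -- The form at the point with coordinates `w` is the tangent map at `z = 0` of `z ↦ x(w)⁻¹ x(w +
  -- z)`, with `x` the inverse chart. This family sends `0` to `1` for every `w`, so
  -- `contMDiffAt_tmap_of_fixed` applies.
  have hF : ContMDiffAt (𝓘(ℝ, E).prod 𝓘(ℝ, E)) I ∞ (Function.uncurry fun w z : E =>
      ((extChartAt I x₀).symm w)⁻¹ * (extChartAt I x₀).symm (w + z)) (u, 0) := by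
    have h1 : ContMDiffAt (𝓘(ℝ, E).prod 𝓘(ℝ, E)) I ∞
        (fun p : E × E => (extChartAt I x₀).symm p.1) (u, 0) :=
      ContMDiffAt.comp (u, (0 : E)) hs contMDiffAt_fst
    have h2 : ContMDiffAt (𝓘(ℝ, E).prod 𝓘(ℝ, E)) I ∞
        (fun p : E × E => (extChartAt I x₀).symm (p.1 + p.2)) (u, 0) := by
      refine ContMDiffAt.comp_of_eq (f := fun p : E × E => p.1 + p.2) hs ?_ (add_zero u)
      exact contMDiffAt_fst.add contMDiffAt_snd
    exact h1.inv.mul h2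
  have key := contMDiffAt_tmap_of_fixed hF (y₀ := 1) (by simp)
  rw [contMDiffAt_iff_contDiffAt] at key
  refine key.congr_of_eventuallyEq ?_
  filter_upwards [extChartAt_target_mem_nhds_of_mem hu] with w hw
  have hsw : MDifferentiableAt 𝓘(ℝ, E) I (extChartAt I x₀).symm w :=
    (contMDiffAt_extChartAt_symm hw).mdifferentiableAt (by simp)
  have hadd : HasFDerivAt (fun z : E => w + z) (ContinuousLinearMap.id ℝ E) 0 :=
    (hasFDerivAt_id 0).const_add w
  have h1 : tmap 𝓘(ℝ, E) I (fun z : E => (extChartAt I x₀).symm (w + z)) 0 =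
      tmap 𝓘(ℝ, E) I (extChartAt I x₀).symm w := by
    rw [tmap_comp_of_eq (add_zero w) hsw hadd.differentiableAt.mdifferentiableAt, tmap_eq_fderiv,
      hadd.fderiv]
    rfl
  rw [mcAt, ← h1]
  refine (tmap_comp_of_eq (by rw [add_zero]) ((contMDiff_mul_left' _).mdifferentiableAt (by simp))
    ?_).symm
  refine MDifferentiableAt.comp (g := (extChartAt I x₀).symm) (0 : E) ?_
    hadd.differentiableAt.mdifferentiableAt
  rw [add_zero]
  exact hsw

theorem chartRep_mcForm (x₀ : S) :
    DForm.chartRep I (mcForm I S) x₀ = fun w => ContinuousAlternatingMap.ofSubsingleton ℝ E E (0 : Fin 1)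
      ((mcAt I ((extChartAt I x₀).symm w)).comp (tmap 𝓘(ℝ, E) I (extChartAt I x₀).symm w)) := rfl

theorem isSmooth_mcForm [FiniteDimensional ℝ E] : DForm.IsSmooth I (mcForm I S) := by
  refine DForm.isSmooth_iff_contDiffAt.2 fun x₀ u hu => ?_
  rw [chartRep_mcForm]
  refine contDiffAt_alternating_of_eval fun v => ?_
  exact (contDiffAt_mcAt_comp hu).clm_apply contDiffAt_const

theorem pullback_mcForm_mul_left (s : S) :
    DForm.pullback I I (fun x => s * x) (mcForm I S) = mcForm I S := by
  funext x
  ext v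
  simp only [DForm.pullback_apply, mcForm_apply, mcAt]
  have h := tmap_comp (g := fun y : S => (s * x)⁻¹ * y) (f := fun y : S => s * y) x
    ((contMDiff_mul_left' (I := I) _).mdifferentiableAt (by simp))
    ((contMDiff_mul_left' (I := I) _).mdifferentiableAt (by simp))
  have h2 : (fun y : S => (s * x)⁻¹ * (s * y)) = fun y => x⁻¹ * y := by
    funext y
    group
  rw [h2] at h
  rw [h]
  rfl

/-- The Maurer-Cartan equation. -/

theorem extD_mcForm [FiniteDimensional ℝ E] (s : S) (v : Fin 2 → E) :
    DForm.extD I (mcForm I S) s v = - adStar I S (mcAt I s (v 0)) (mcAt I s (v 1)) := by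
  have hone : ∀ v : Fin 2 → E, DForm.extD I (mcForm I S) 1 v = - adStar I S (v 0) (v 1) := by
    intro v
    have hT := (contDiffAt_mcAt_comp (chartOne_mem_target (I := I) (S := S))).differentiableAt
      (by simp)
    have hL := (contDiffAt_chartLeft (I := I) (S := S)).differentiableAt (by simp)
    -- In the chart the Maurer–Cartan form `T` is inverse to the left-invariant frame `L`.
    -- Differentiating `T ∘ L = id` at `1` gives `DT = -DL`, and antisymmetrization yields
    -- `-adStar`.
    have heq : (fun u => ((mcAt I ((extChartAt I (1 : S)).symm u)).comp
        (tmap 𝓘(ℝ, E) I (extChartAt I (1 : S)).symm u)).comp (chartLeft I S u))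
        =ᶠ[𝓝 (chartOne I S)] fun _ => ContinuousLinearMap.id ℝ E := by
      filter_upwards [tmap_symm_comp_chartLeft (I := I) (S := S)] with u hu
      rw [ContinuousLinearMap.comp_assoc, hu, mcAt_comp_tmap]
    have h := heq.fderiv_eq (𝕜 := ℝ)
    have hmc : mcAt I (1 : S) = ContinuousLinearMap.id ℝ E := by
      simp only [mcAt, inv_one, one_mul]
      exact tmap_id 1
    rw [fderiv_clm_comp hT hL, fderiv_fun_const, chartLeft_one, symm_chartOne, tmap_symm_one, hmc]
      at h
    have h' : ∀ a b, fderiv ℝ (fun w => (mcAt I ((extChartAt I (1 : S)).symm w)).comp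
        (tmap 𝓘(ℝ, E) I (extChartAt I (1 : S)).symm w)) (chartOne I S) a b =
        - fderiv ℝ (chartLeft I S) (chartOne I S) a b := by
      intro a b
      have := DFunLike.congr_fun (DFunLike.congr_fun h a) b
      simp at this
      exact eq_neg_of_add_eq_zero_right this
    have h'' : ∀ a b : E, fderiv ℝ (fun w => DForm.chartRep I (mcForm I S) 1 w ![b]) (chartOne I S) a
        = - fderiv ℝ (chartLeft I S) (chartOne I S) a b := by
      intro a b
      rw [← h']
      have := fderiv_clm_apply hT (differentiableAt_const b)
      refine (DFunLike.congr_fun this a).trans ?_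
      simp
    rw [DForm.extD_apply_eq, extDeriv_one_apply (isSmooth_mcForm.differentiableAt_self 1)]
    refine (congrArg₂ (· - ·) (h'' _ _) (h'' _ _)).trans ?_
    rw [adStar_eq]
    abel
  -- Left invariance carries the formula from `1` to `s`.
  have h := isSmooth_mcForm.extD_pullback (contMDiff_mul_left' (I := I) (s⁻¹ : S))
  rw [pullback_mcForm_mul_left] at h
  rw [h, DForm.pullback_apply, inv_mul_cancel, hone]
  rfl

end LieGroupCalculus

/-! ### Smooth representations applied to forms. -/

section Representations

variable {E : Type*} [NormedAddCommGroup E] [NormedSpace ℝ E]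
  {K : Type*} [TopologicalSpace K] {I : ModelWithCorners ℝ E K} [I.Boundaryless]
  {S : Type*} [TopologicalSpace S] [ChartedSpace K S] [Group S] [LieGroup I ∞ S]
  {V : Type*} [NormedAddCommGroup V] [NormedSpace ℝ V]
  {EX : Type*} [NormedAddCommGroup EX] [NormedSpace ℝ EX]
  {KX : Type*} [TopologicalSpace KX] {J : ModelWithCorners ℝ EX KX} [J.Boundaryless]
  {X : Type*} [TopologicalSpace X] [ChartedSpace KX X] [IsManifold J ∞ X]
  {ρ : S → V →L[ℝ] V}

variable (I) in
/-- A smooth representation of a Lie group. -/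
structure IsSmoothRep (ρ : S → V →L[ℝ] V) : Prop where
  smooth : ContMDiff I 𝓘(ℝ, V →L[ℝ] V) ∞ ρ
  map_one : ρ 1 = ContinuousLinearMap.id ℝ V
  map_mul : ∀ a b, ρ (a * b) = (ρ a).comp (ρ b)

theorem IsSmoothRep.mdifferentiableAt (h : IsSmoothRep I ρ) (s : S) :
    MDifferentiableAt I 𝓘(ℝ, V →L[ℝ] V) ρ s := (h.smooth s).mdifferentiableAt (by simp)

theorem IsSmoothRep.inv_comp (h : IsSmoothRep I ρ) (s : S) :
    (ρ s⁻¹).comp (ρ s) = ContinuousLinearMap.id ℝ V := by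
  rw [← h.map_mul, inv_mul_cancel, h.map_one]

theorem IsSmoothRep.comp_inv (h : IsSmoothRep I ρ) (s : S) :
    (ρ s).comp (ρ s⁻¹) = ContinuousLinearMap.id ℝ V := by
  rw [← h.map_mul, mul_inv_cancel, h.map_one]

/-- Differentiate `ρ(x) = ρ(s) ρ(s⁻¹ x)` at `x = s`. -/
theorem IsSmoothRep.tmap_eq (h : IsSmoothRep I ρ) (s : S) (v : E) :
    tmap I 𝓘(ℝ, V →L[ℝ] V) ρ s v =
      (ρ s).comp (tmap I 𝓘(ℝ, V →L[ℝ] V) ρ 1 (mcAt I s v)) := by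
  have e : ρ = fun x => (ρ s).comp (ρ (s⁻¹ * x)) := by
    funext x
    rw [← h.map_mul, mul_inv_cancel_left]
  have hl : MDifferentiableAt I I (fun x : S => s⁻¹ * x) s :=
    (contMDiff_mul_left' _).mdifferentiableAt (by simp)
  have hc : MDifferentiableAt I 𝓘(ℝ, V →L[ℝ] V) (fun x => ρ (s⁻¹ * x)) s :=
    (h.mdifferentiableAt _).comp s hl
  conv_lhs => rw [e]
  rw [tmap_clm_comp mdifferentiableAt_const hc, tmap_const,
    tmap_comp_of_eq (inv_mul_cancel s) (h.mdifferentiableAt 1) hl]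
  simp [mcAt]

/-- Differentiate `ρ(s⁻¹) ρ(s) = id`, substitute `tmap_eq`, and compose with `ρ(s⁻¹)` on the right.
-/
theorem IsSmoothRep.tmap_inv (h : IsSmoothRep I ρ) {f : X → S} {x : X}
    (hf : MDifferentiableAt J I f x) (v : EX) :
    tmap J 𝓘(ℝ, V →L[ℝ] V) (fun x => ρ (f x)⁻¹) x v =
      - (tmap I 𝓘(ℝ, V →L[ℝ] V) ρ 1 (mcAt I (f x) (tmap J I f x v))).comp (ρ (f x)⁻¹) := by
  have hi : MDifferentiableAt I 𝓘(ℝ, V →L[ℝ] V) (fun s => ρ s⁻¹) (f x) :=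
    ((h.smooth.comp (contMDiff_inv I ∞)) (f x)).mdifferentiableAt (by simp)
  have key := tmap_clm_comp hi (h.mdifferentiableAt (f x)) (tmap J I f x v)
  simp only [h.inv_comp] at key
  rw [tmap_const, h.tmap_eq, ← ContinuousLinearMap.comp_assoc, h.inv_comp, ContinuousLinearMap.id_comp] at key
  rw [tmap_comp x hi hf, ContinuousLinearMap.comp_apply]
  have key' := congrArg (fun L => L.comp (ρ (f x)⁻¹)) (eq_neg_of_add_eq_zero_right key.symm)
  simp only [ContinuousLinearMap.neg_comp,
    ContinuousLinearMap.comp_assoc, h.comp_inv, ContinuousLinearMap.comp_id] at key'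
  exact key'

variable [FiniteDimensional ℝ E] [FiniteDimensional ℝ EX] [FiniteDimensional ℝ V]

theorem IsSmoothRep.contMDiff_inv_comp (h : IsSmoothRep I ρ) {f : X → S} (hf : ContMDiff J I ∞ f) :
    ContMDiff J 𝓘(ℝ, V →L[ℝ] V) ∞ (fun x => ρ (f x)⁻¹) := h.smooth.comp hf.inv

/-- The Leibniz rule with `tmap_inv` inserted. It is applied to `Ad` acting on connection forms; the
version for two-forms is applied to `α` acting on `Ω^c`. -/
theorem IsSmoothRep.extD_mapVal_one (h : IsSmoothRep I ρ) {f : X → S} (hf : ContMDiff J I ∞ f)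
    {φ : DForm EX X 1 V} (hφ : DForm.IsSmooth J φ) :
    DForm.extD J (DForm.mapVal (fun x => ρ (f x)⁻¹) φ) =
      (DForm.mapVal (fun x => ρ (f x)⁻¹) (DForm.extD J φ)
        - DForm.wedge (tmap I 𝓘(ℝ, V →L[ℝ] V) ρ 1) (DForm.pullback J I f (mcForm I S))
          (DForm.mapVal (fun x => ρ (f x)⁻¹) φ) : DForm EX X 2 V) := by
  funext x
  ext v
  obtain ⟨h0, h1⟩ := removeNth_two v
  rw [DForm.extD_mapVal_apply hφ (h.contMDiff_inv_comp hf), DForm.sub_apply',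
    DForm.wedge_one_one_apply, Fin.sum_univ_two, h0, h1]
  simp only [h.tmap_inv ((hf x).mdifferentiableAt (by simp)), DForm.mapVal_apply,
    DForm.pullback_apply, mcForm_apply]
  simp
  abel

theorem IsSmoothRep.extD_mapVal_two (h : IsSmoothRep I ρ) {f : X → S} (hf : ContMDiff J I ∞ f)
    {φ : DForm EX X 2 V} (hφ : DForm.IsSmooth J φ) :
    DForm.extD J (DForm.mapVal (fun x => ρ (f x)⁻¹) φ) =
      (DForm.mapVal (fun x => ρ (f x)⁻¹) (DForm.extD J φ)
        - DForm.wedge (tmap I 𝓘(ℝ, V →L[ℝ] V) ρ 1) (DForm.pullback J I f (mcForm I S))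
          (DForm.mapVal (fun x => ρ (f x)⁻¹) φ) : DForm EX X 3 V) := by
  funext x
  ext v
  obtain ⟨h0, h1, h2⟩ := removeNth_three v
  rw [DForm.extD_mapVal_apply hφ (h.contMDiff_inv_comp hf), DForm.sub_apply',
    DForm.wedge_one_two_apply, Fin.sum_univ_three, h0, h1, h2]
  simp only [h.tmap_inv ((hf x).mdifferentiableAt (by simp)), DForm.mapVal_apply,
    DForm.pullback_apply, mcForm_apply]
  simp
  abel

end Representations

/-! ### Homomorphisms and the adjoint action. -/

section Adjoint

variable {E : Type*} [NormedAddCommGroup E] [NormedSpace ℝ E]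
  {K : Type*} [TopologicalSpace K] {I : ModelWithCorners ℝ E K} [I.Boundaryless]
  {S : Type*} [TopologicalSpace S] [ChartedSpace K S] [Group S] [LieGroup I ∞ S]
  {E' : Type*} [NormedAddCommGroup E'] [NormedSpace ℝ E']
  {K' : Type*} [TopologicalSpace K'] {I' : ModelWithCorners ℝ E' K'} [I'.Boundaryless]
  {S' : Type*} [TopologicalSpace S'] [ChartedSpace K' S'] [Group S'] [LieGroup I' ∞ S']

theorem conjStar_mul (a b : S) : conjStar I (a * b) = (conjStar I a).comp (conjStar I b) := by
  rw [conjStar, conjStar, conjStar, ← tmap_comp_of_eq (by simp)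
    ((contMDiff_conj a).mdifferentiableAt (by simp))
    ((contMDiff_conj b).mdifferentiableAt (by simp))]
  congr 1
  funext x
  group

theorem isSmoothRep_conjStar : IsSmoothRep I (fun s : S => conjStar I s) :=
  ⟨contMDiff_conjStar, conjStar_one, conjStar_mul⟩

theorem tmap_hom_comp_conjStar {φ : S →* S'} (hφ : ContMDiff I I' ∞ φ) (s : S) :
    (tmap I I' φ 1).comp (conjStar I s) = (conjStar I' (φ s)).comp (tmap I I' φ 1) := by
  rw [conjStar, conjStar, ← tmap_comp_of_eq (by simp) (hφ.mdifferentiableAt (by simp))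
    ((contMDiff_conj s).mdifferentiableAt (by simp)),
    ← tmap_comp_of_eq (map_one φ) ((contMDiff_conj _).mdifferentiableAt (by simp))
    (hφ.mdifferentiableAt (by simp))]
  simp

/-- The differential of a homomorphism of Lie groups is a homomorphism of Lie algebras. -/

theorem tmap_hom_adStar {φ : S →* S'} (hφ : ContMDiff I I' ∞ φ) (v w : E) :
    tmap I I' φ 1 (adStar I S v w) = adStar I' S' (tmap I I' φ 1 v) (tmap I I' φ 1 w) := by
  have h1 := mdifferentiableAt_conjStar (I := I) (1 : S)
  have h2 : MDifferentiableAt I' 𝓘(ℝ, E' →L[ℝ] E') (fun s : S' => conjStar I' s) (φ 1) :=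
    mdifferentiableAt_conjStar (φ 1)
  have h3 := hφ.mdifferentiableAt (by simp) (x := 1)
  have h4 : MDifferentiableAt I 𝓘(ℝ, E' →L[ℝ] E') (fun s : S => conjStar I' (φ s)) 1 := h2.comp 1 h3
  -- The two sides of `φ_* ∘ Ad_s = Ad_{φ(s)} ∘ φ_*` are differentiated at `s = 1` in the direction
  -- `v`.
  have e := tmap_clm_comp (f := fun _ : S => tmap I I' φ 1) mdifferentiableAt_const h1 v
  have e' := tmap_clm_comp (g := fun _ : S => tmap I I' φ 1) h4 mdifferentiableAt_const v
  simp only [tmap_hom_comp_conjStar hφ] at e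
  rw [e, tmap_const, tmap_comp_of_eq (g := fun s : S' => conjStar I' s) (f := φ)
    (map_one φ) (mdifferentiableAt_conjStar 1) h3] at e'
  have := DFunLike.congr_fun e' w
  simpa [adStar] using this

end Adjoint

/-! ### Gauge transformations of connection one-forms. -/

section Gauge

variable {E : Type*} [NormedAddCommGroup E] [NormedSpace ℝ E] [FiniteDimensional ℝ E]
  {K : Type*} [TopologicalSpace K] {I : ModelWithCorners ℝ E K} [I.Boundaryless]
  {S : Type*} [TopologicalSpace S] [ChartedSpace K S] [Group S] [LieGroup I ∞ S]
  {EX : Type*} [NormedAddCommGroup EX] [NormedSpace ℝ EX] [FiniteDimensional ℝ EX]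
  {KX : Type*} [TopologicalSpace KX] {J : ModelWithCorners ℝ EX KX} [J.Boundaryless]
  {X : Type*} [TopologicalSpace X] [ChartedSpace KX X] [IsManifold J ∞ X]

/-- Conjugation by `s` is a smooth automorphism, so `tmap_hom_adStar` applies to it. -/
theorem conjStar_adStar (s : S) (v w : E) :
    conjStar I s (adStar I S v w) = adStar I S (conjStar I s v) (conjStar I s w) :=
  tmap_hom_adStar (φ := (MulAut.conj s).toMonoidHom) (contMDiff_conj s) v w

/-- The curvature of the gauge transform of a connection 1-form. -/

theorem extD_gauge_add_half_wedge {f : X → S} (hf : ContMDiff J I ∞ f) {A A' : DForm EX X 1 E}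
    (hA : DForm.IsSmooth J A)
    (h : A' = DForm.mapVal (fun x => conjStar I (f x)⁻¹) A + DForm.pullback J I f (mcForm I S)) :
    (DForm.extD J A' + (1 / 2 : ℝ) • DForm.wedge (adStar I S) A' A' : DForm EX X 2 E) =
      DForm.mapVal (fun x => conjStar I (f x)⁻¹)
        (DForm.extD J A + (1 / 2 : ℝ) • DForm.wedge (adStar I S) A A : DForm EX X 2 E) := by
  have hr := isSmoothRep_conjStar (I := I) (S := S)
  have hm := isSmooth_mcForm (I := I) (S := S)
  have e : DForm.extD J A' = (DForm.mapVal (fun x => conjStar I (f x)⁻¹) (DForm.extD J A)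
        - DForm.wedge (adStar I S) (DForm.pullback J I f (mcForm I S))
          (DForm.mapVal (fun x => conjStar I (f x)⁻¹) A)
        + DForm.pullback J I f (DForm.extD I (mcForm I S)) : DForm EX X 2 E) := by
    rw [h, DForm.extD_add (hA.mapVal (hr.contMDiff_inv_comp hf)) (hm.pullback hf),
      hr.extD_mapVal_one hf hA, hm.extD_pullback hf]
    rfl
  -- With `A` now standing for `Ad_f⁻¹ A`, `dA'` contributes `-[f^*θ ∧ A]` and, by Maurer–Cartan,
  -- `-½[f^*θ ∧ f^*θ]`; the square of `A'` contributes the opposite terms.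
  rw [e, h]
  funext x
  ext v
  simp only [DForm.add_apply', DForm.sub_apply', DForm.smul_apply', DForm.wedge_one_one_apply,
    DForm.mapVal_apply, DForm.pullback_apply, mcForm_apply, extD_mcForm, map_add, map_sub, map_smul,
    conjStar_adStar, add_apply, Matrix.cons_val_zero]
  rw [adStar_swap (conjStar I (f x)⁻¹ (A x ![v 0])) (conjStar I (f x)⁻¹ (A x ![v 1])),
    adStar_swap (mcAt I (f x) (tmap J I f x (v 0))) (conjStar I (f x)⁻¹ (A x ![v 1])),
    adStar_swap (mcAt I (f x) (tmap J I f x (v 0))) (mcAt I (f x) (tmap J I f x (v 1))),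
    adStar_swap (mcAt I (f x) (tmap J I f x (v 1))) (conjStar I (f x)⁻¹ (A x ![v 0]))]
  module

end Gauge

/-! ### The Lie bracket as the derivative of the adjoint action. -/

section Bracket

variable {EG : Type*} [NormedAddCommGroup EG] [NormedSpace ℝ EG] [FiniteDimensional ℝ EG]
  {G : Type*} [TopologicalSpace G] [ChartedSpace EG G] [Group G] [LieGroup 𝓘(ℝ, EG) ∞ G]

/-- This lets compatibilities with the bracket be proved by differentiating identities that involve
`Ad`. -/
theorem lieBr_eq_adStar : lieBr EG G = adStar 𝓘(ℝ, EG) G := by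
  ext v w
  exact mlieBracket_mulInvariantVectorField v w

theorem lieBr_swap (v w : EG) : lieBr EG G w v = - lieBr EG G v w := by
  rw [lieBr_eq_adStar, adStar_swap]

theorem lieBr_leibniz (x y z : EG) :
    lieBr EG G x (lieBr EG G y z) = lieBr EG G (lieBr EG G x y) z + lieBr EG G y (lieBr EG G x z) := by
  have : LieGroup 𝓘(ℝ, EG) (minSmoothness ℝ 3) G := lieGroup_minSmoothness
  have : CompleteSpace EG := FiniteDimensional.complete ℝ EG
  exact leibniz_lie (L₁ := GroupLieAlgebra 𝓘(ℝ, EG) G)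
    (L₂ := GroupLieAlgebra 𝓘(ℝ, EG) G) (M := GroupLieAlgebra 𝓘(ℝ, EG) G) x y z

end Bracket

/-! ### Tangent maps of products, and derivatives of representations. -/

section ProductTangent

variable {E : Type*} [NormedAddCommGroup E] [NormedSpace ℝ E]
  {K : Type*} [TopologicalSpace K] {I : ModelWithCorners ℝ E K}
  {E' : Type*} [NormedAddCommGroup E'] [NormedSpace ℝ E']
  {K' : Type*} [TopologicalSpace K'] {I' : ModelWithCorners ℝ E' K'}
  {EX : Type*} [NormedAddCommGroup EX] [NormedSpace ℝ EX]
  {KX : Type*} [TopologicalSpace KX] {J : ModelWithCorners ℝ EX KX}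
  {X : Type*} [TopologicalSpace X] [ChartedSpace KX X]
  {Y : Type*} [TopologicalSpace Y] [ChartedSpace K Y]
  {Z : Type*} [TopologicalSpace Z] [ChartedSpace K' Z]

theorem tmap_prodMk {f : X → Y} {g : X → Z} {x : X} (hf : MDifferentiableAt J I f x)
    (hg : MDifferentiableAt J I' g x) :
    tmap J (I.prod I') (fun x => (f x, g x)) x = (tmap J I f x).prod (tmap J I' g x) :=
  mfderiv_prodMk hf hg

theorem tmap_fst (p : Y × Z) :
    tmap (I.prod I') I (Prod.fst : Y × Z → Y) p = ContinuousLinearMap.fst ℝ E E' := mfderiv_fst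

theorem tmap_snd (p : Y × Z) :
    tmap (I.prod I') I' (Prod.snd : Y × Z → Z) p = ContinuousLinearMap.snd ℝ E E' := mfderiv_snd

theorem tmap_prod_apply {f : Y × Z → X} {p : Y × Z} (hf : MDifferentiableAt (I.prod I') J f p)
    (v : E × E') :
    tmap (I.prod I') J f p v =
      tmap I J (fun y => f (y, p.2)) p.1 v.1 + tmap I' J (fun z => f (p.1, z)) p.2 v.2 :=
  mfderiv_prod_eq_add_apply hf

/-- The partial maps of the multiplication at `(1, 1)` are identities, so its tangent map there is
addition. -/
theorem tmap_mul_of_eq_one {S : Type*} [TopologicalSpace S] [ChartedSpace K S] [Group S]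
    [I.Boundaryless] [LieGroup I ∞ S] [J.Boundaryless] [IsManifold J ∞ X] {f g : X → S} {x : X}
    (hf : MDifferentiableAt J I f x) (hg : MDifferentiableAt J I g x) (hf1 : f x = 1)
    (hg1 : g x = 1) :
    tmap J I (fun y => f y * g y) x = tmap J I f x + tmap J I g x := by
  have hm : MDifferentiableAt (I.prod I) I (fun p : S × S => p.1 * p.2) (1, 1) :=
    (contMDiff_mul I ∞ (1, 1)).mdifferentiableAt (by simp)
  have h := tmap_comp_of_eq (g := fun p : S × S => p.1 * p.2) (f := fun y => (f y, g y)) (x := x)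
    (y := (1, 1)) (by rw [hf1, hg1]) hm (hf.prodMk hg)
  rw [h, tmap_prodMk hf hg]
  ext v
  rw [ContinuousLinearMap.comp_apply, tmap_prod_apply hm]
  simp only [mul_one, one_mul, tmap_id]
  simp

end ProductTangent

/-- Differentiate `ρ(s) ρ(x) = ρ(s x s⁻¹) ρ(s)` at `x = 1`. -/
theorem IsSmoothRep.comp_deriv {E : Type*} [NormedAddCommGroup E] [NormedSpace ℝ E]
    {K : Type*} [TopologicalSpace K] {I : ModelWithCorners ℝ E K} [I.Boundaryless]
    {S : Type*} [TopologicalSpace S] [ChartedSpace K S] [Group S] [LieGroup I ∞ S]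
    {V : Type*} [NormedAddCommGroup V] [NormedSpace ℝ V] {ρ : S → V →L[ℝ] V}
    (h : IsSmoothRep I ρ) (s : S) (w : E) :
    (ρ s).comp (tmap I 𝓘(ℝ, V →L[ℝ] V) ρ 1 w) =
      (tmap I 𝓘(ℝ, V →L[ℝ] V) ρ 1 (conjStar I s w)).comp (ρ s) := by
  have h1 : ∀ x, (ρ s).comp (ρ x) = (ρ (s * x * s⁻¹)).comp (ρ s) := by
    intro x
    rw [← h.map_mul, ← h.map_mul, inv_mul_cancel_right]
  have hc : MDifferentiableAt I I (fun x : S => s * x * s⁻¹) 1 :=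
    (contMDiff_conj s).mdifferentiableAt (by simp)
  have h2 : MDifferentiableAt I 𝓘(ℝ, V →L[ℝ] V) (fun x => ρ (s * x * s⁻¹)) 1 :=
    (h.mdifferentiableAt _).comp 1 hc
  have e := tmap_clm_comp (f := fun _ : S => ρ s) mdifferentiableAt_const
    (h.mdifferentiableAt 1) w
  have conjEq := tmap_clm_comp (g := fun _ : S => ρ s) h2 mdifferentiableAt_const w
  simp only [h1] at e
  rw [e, tmap_const, tmap_comp_of_eq (by simp) (h.mdifferentiableAt 1) hc] at conjEq
  simpa [conjStar] using conjEq

/-- The differential of a representation is a representation of the Lie algebra. -/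

theorem IsSmoothRep.deriv_adStar {E : Type*} [NormedAddCommGroup E] [NormedSpace ℝ E]
    {K : Type*} [TopologicalSpace K] {I : ModelWithCorners ℝ E K} [I.Boundaryless]
    {S : Type*} [TopologicalSpace S] [ChartedSpace K S] [Group S] [LieGroup I ∞ S]
    {V : Type*} [NormedAddCommGroup V] [NormedSpace ℝ V] {ρ : S → V →L[ℝ] V}
    (h : IsSmoothRep I ρ) (v w : E) :
    tmap I 𝓘(ℝ, V →L[ℝ] V) ρ 1 (adStar I S v w) =
      (tmap I 𝓘(ℝ, V →L[ℝ] V) ρ 1 v).comp (tmap I 𝓘(ℝ, V →L[ℝ] V) ρ 1 w)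
      - (tmap I 𝓘(ℝ, V →L[ℝ] V) ρ 1 w).comp (tmap I 𝓘(ℝ, V →L[ℝ] V) ρ 1 v) := by
  have hc := mdifferentiableAt_conjStar (I := I) (1 : S)
  have hcw : MDifferentiableAt I 𝓘(ℝ, E) (fun s : S => conjStar I s w) 1 :=
    hc.clm_apply mdifferentiableAt_const
  have h2 : MDifferentiableAt I 𝓘(ℝ, V →L[ℝ] V)
      (fun s : S => tmap I 𝓘(ℝ, V →L[ℝ] V) ρ 1 (conjStar I s w)) 1 :=
    (tmap I 𝓘(ℝ, V →L[ℝ] V) ρ 1).differentiableAt.mdifferentiableAt.comp 1 hcw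
  -- The identity `comp_deriv` is now differentiated in `s`, at `1` in the direction `v`.
  have e := tmap_clm_comp (g := fun _ : S => tmap I 𝓘(ℝ, V →L[ℝ] V) ρ 1 w)
    (h.mdifferentiableAt 1) mdifferentiableAt_const v
  have e' := tmap_clm_comp h2 (h.mdifferentiableAt 1) v
  simp only [h.comp_deriv] at e
  rw [e, tmap_const, tmap_clm_left_comp _ hcw, h.map_one, conjStar_one] at e'
  rw [ContinuousLinearMap.comp_apply, tmap_clm_apply hc] at e'
  rw [eq_sub_iff_add_eq, adStar]
  simpa [add_comm] using e'.symm

/-! ### The differential crossed module. -/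

namespace CrossedModule

variable {EG : Type*} [NormedAddCommGroup EG] [NormedSpace ℝ EG]
  {G : Type*} [TopologicalSpace G] [ChartedSpace EG G] [Group G] [LieGroup 𝓘(ℝ, EG) ∞ G]
  {EH : Type*} [NormedAddCommGroup EH] [NormedSpace ℝ EH]
  {H : Type*} [TopologicalSpace H] [ChartedSpace EH H] [Group H] [LieGroup 𝓘(ℝ, EH) ∞ H]
  (Γ : CrossedModule EG G EH H)

theorem contMDiff_act (g : G) : ContMDiff 𝓘(ℝ, EH) 𝓘(ℝ, EH) ∞ (fun h : H => Γ.α g h) :=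
  Γ.smooth_α.comp (f := fun h : H => (g, h)) (contMDiff_const.prodMk contMDiff_id)

theorem contMDiff_act_left (h : H) : ContMDiff 𝓘(ℝ, EG) 𝓘(ℝ, EH) ∞ (fun g : G => Γ.α g h) :=
  Γ.smooth_α.comp (f := fun g : G => (g, h)) (contMDiff_id.prodMk contMDiff_const)

theorem contMDiff_actStar : ContMDiff 𝓘(ℝ, EG) 𝓘(ℝ, EH →L[ℝ] EH) ∞ Γ.actStar := by
  intro g
  exact contMDiffAt_tmap_of_fixed (F := fun (g : G) (h : H) => Γ.α g h) (y₀ := 1)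
    (Γ.smooth_α _) (by simp)

theorem isSmoothRep_actStar : IsSmoothRep 𝓘(ℝ, EG) Γ.actStar where
  smooth := Γ.contMDiff_actStar
  map_one := by
    simp only [actStar, map_one, MulAut.one_apply]
    exact tmap_id 1
  map_mul a b := by
    rw [actStar, actStar, actStar, ← tmap_comp_of_eq (map_one (Γ.α b))
      ((Γ.contMDiff_act a).mdifferentiableAt (by simp))
      ((Γ.contMDiff_act b).mdifferentiableAt (by simp))]
    simp

theorem tStar_comp_actStar (g : G) : Γ.tStar.comp (Γ.actStar g) = (Ad g).comp Γ.tStar := by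
  rw [tStar, actStar, Ad, ← tmap_comp_of_eq (map_one (Γ.α g))
    (Γ.smooth_t.mdifferentiableAt (by simp)) ((Γ.contMDiff_act g).mdifferentiableAt (by simp)),
    ← tmap_comp_of_eq (map_one Γ.t) ((contMDiff_conj g).mdifferentiableAt (by simp))
    (Γ.smooth_t.mdifferentiableAt (by simp))]
  simp only [Γ.t_α]

theorem actStar_t (h : H) : Γ.actStar (Γ.t h) = Ad h := by
  simp only [actStar, Ad, Γ.α_t]

theorem contMDiff_tilde (h : H) :
    ContMDiff 𝓘(ℝ, EG) 𝓘(ℝ, EH) ∞ (fun g : G => h⁻¹ * Γ.α g h) :=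
  (contMDiff_mul_left' h⁻¹).comp (Γ.contMDiff_act_left h)

/-- By the Peiffer identity `h α(t(x), h⁻¹) x = h x h⁻¹`, and at `1` the derivative of a product is
the sum of the derivatives. This is what absorbs the `Ω^c` terms in the equivariance of `curv^b`. -/
theorem tildeStar_comp_tStar (h : H) :
    (Γ.tildeStar h⁻¹).comp Γ.tStar = Ad h - ContinuousLinearMap.id ℝ EH := by
  have h1 := Γ.smooth_t.mdifferentiableAt (by simp) (x := 1)
  have h2 : MDifferentiableAt 𝓘(ℝ, EG) 𝓘(ℝ, EH) (fun g : G => h⁻¹⁻¹ * Γ.α g h⁻¹) 1 :=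
    (Γ.contMDiff_tilde h⁻¹).mdifferentiableAt (by simp)
  have h3 : MDifferentiableAt 𝓘(ℝ, EH) 𝓘(ℝ, EH) (fun x : H => h⁻¹⁻¹ * Γ.α (Γ.t x) h⁻¹) 1 :=
    ((Γ.contMDiff_tilde h⁻¹).comp Γ.smooth_t).mdifferentiableAt (by simp)
  rw [eq_sub_iff_add_eq, tildeStar, tStar, ← tmap_comp_of_eq (map_one Γ.t) h2 h1,
    ← tmap_id (I := 𝓘(ℝ, EH)) (1 : H), ← tmap_mul_of_eq_one (g := fun y : H => y) h3 mdifferentiableAt_id (by simp) rfl]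
  simp only [Γ.α_t, Ad]
  congr 1
  funext x
  group

theorem αStar_actStar (g : G) (x : EG) (y : EH) :
    Γ.actStar g (Γ.αStar x y) = Γ.αStar (Ad g x) (Γ.actStar g y) :=
  DFunLike.congr_fun (Γ.isSmoothRep_actStar.comp_deriv g x) y

theorem actStar_adStar (g : G) (y y' : EH) :
    Γ.actStar g (adStar 𝓘(ℝ, EH) H y y') =
      adStar 𝓘(ℝ, EH) H (Γ.actStar g y) (Γ.actStar g y') :=
  tmap_hom_adStar (φ := (Γ.α g).toMonoidHom) (Γ.contMDiff_act g) y y'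

theorem mdifferentiableAt_actStar (g : G) :
    MDifferentiableAt 𝓘(ℝ, EG) 𝓘(ℝ, EH →L[ℝ] EH) Γ.actStar g :=
  Γ.isSmoothRep_actStar.mdifferentiableAt g

theorem actStar_one : Γ.actStar 1 = ContinuousLinearMap.id ℝ EH := Γ.isSmoothRep_actStar.map_one

variable [FiniteDimensional ℝ EG] [FiniteDimensional ℝ EH]

theorem tStar_lieBr (y y' : EH) :
    Γ.tStar (lieBr EH H y y') = lieBr EG G (Γ.tStar y) (Γ.tStar y') := by
  rw [lieBr_eq_adStar, lieBr_eq_adStar]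
  exact tmap_hom_adStar Γ.smooth_t y y'

/-- The derivative at `g = 1` of `tStar_comp_actStar`. -/
theorem tStar_αStar (x : EG) (y : EH) : Γ.tStar (Γ.αStar x y) = lieBr EG G x (Γ.tStar y) := by
  have h1 := Γ.mdifferentiableAt_actStar 1
  have h2 := mdifferentiableAt_conjStar (I := 𝓘(ℝ, EG)) (1 : G)
  have e := tmap_clm_comp (f := fun _ : G => Γ.tStar) mdifferentiableAt_const h1 x
  have e' := tmap_clm_comp (g := fun _ : G => Γ.tStar) h2 mdifferentiableAt_const x
  simp only [Γ.tStar_comp_actStar] at e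
  have e'' := e.symm.trans e'
  rw [tmap_const] at e''
  rw [lieBr_eq_adStar]
  simpa [αStar, adStar] using DFunLike.congr_fun e'' y

/-- The infinitesimal Peiffer identity: the derivative at `1` of `actStar_t`. -/
theorem αStar_tStar (y y' : EH) : Γ.αStar (Γ.tStar y) y' = lieBr EH H y y' := by
  rw [lieBr_eq_adStar, αStar, tStar, ← ContinuousLinearMap.comp_apply,
    ← tmap_comp_of_eq (map_one Γ.t) (Γ.mdifferentiableAt_actStar 1)
      (Γ.smooth_t.mdifferentiableAt (by simp))]
  simp only [Γ.actStar_t]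
  rfl

theorem αStar_lieBr_left (x x' : EG) (y : EH) :
    Γ.αStar (lieBr EG G x x') y = Γ.αStar x (Γ.αStar x' y) - Γ.αStar x' (Γ.αStar x y) := by
  rw [lieBr_eq_adStar]
  exact DFunLike.congr_fun (Γ.isSmoothRep_actStar.deriv_adStar x x') y

/-- Each `(α_g)_*` preserves the bracket (`actStar_adStar`); differentiating in `g` at `1` turns
automorphisms into derivations. -/
theorem αStar_lieBr_right (x : EG) (y y' : EH) :
    Γ.αStar x (lieBr EH H y y') =
      lieBr EH H (Γ.αStar x y) y' + lieBr EH H y (Γ.αStar x y') := by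
  rw [lieBr_eq_adStar]
  have h1 := Γ.mdifferentiableAt_actStar 1
  have hy : ∀ y : EH, MDifferentiableAt 𝓘(ℝ, EG) 𝓘(ℝ, EH) (fun g : G => Γ.actStar g y) 1 :=
    fun y => h1.clm_apply mdifferentiableAt_const
  have h2 : MDifferentiableAt 𝓘(ℝ, EG) 𝓘(ℝ, EH →L[ℝ] EH)
      (fun g : G => adStar 𝓘(ℝ, EH) H (Γ.actStar g y)) 1 :=
    (adStar 𝓘(ℝ, EH) H).differentiableAt.mdifferentiableAt.comp 1 (hy y)
  have e : ∀ g, (Γ.actStar g).comp (adStar 𝓘(ℝ, EH) H y) =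
      (adStar 𝓘(ℝ, EH) H (Γ.actStar g y)).comp (Γ.actStar g) := by
    intro g
    ext z
    exact Γ.actStar_adStar g y z
  have e1 := tmap_clm_comp (g := fun _ : G => adStar 𝓘(ℝ, EH) H y) h1 mdifferentiableAt_const x
  have e2 := tmap_clm_comp h2 h1 x
  simp only [e] at e1
  have e3 := DFunLike.congr_fun (e1.symm.trans e2) y'
  rw [tmap_clm_left_comp _ (hy y), ContinuousLinearMap.comp_apply, tmap_clm_apply h1, tmap_const,
    Γ.actStar_one] at e3
  simpa [αStar, add_comm] using e3

end CrossedModule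

/-! ### The semi-direct product as a Lie group -/

namespace CrossedModule

variable {EG : Type*} [NormedAddCommGroup EG] [NormedSpace ℝ EG]
  {G : Type*} [TopologicalSpace G] [ChartedSpace EG G] [Group G]
  {EH : Type*} [NormedAddCommGroup EH] [NormedSpace ℝ EH]
  {H : Type*} [TopologicalSpace H] [ChartedSpace EH H] [Group H]
  (Γ : CrossedModule EG G EH H)

/-- The semi-direct product `H ⋊ G`, on the product manifold `H × G`. -/
def Semi (_Γ : CrossedModule EG G EH H) : Type _ := H × G

/-- The element `(h, g)` of the semi-direct product. -/
def semiMk (h : H) (g : G) : Γ.Semi := (h, g)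

/-- A pair, as an element of the semi-direct product. -/
def toSemi (x : H × G) : Γ.Semi := x

variable {Γ} in
/-- The component in `H`. -/
def Semi.left (s : Γ.Semi) : H := (show H × G from s).1

variable {Γ} in
/-- The component in `G`. -/
def Semi.right (s : Γ.Semi) : G := (show H × G from s).2

instance : TopologicalSpace Γ.Semi := inferInstanceAs (TopologicalSpace (H × G))

instance : ChartedSpace (ModelProd EH EG) Γ.Semi :=
  inferInstanceAs (ChartedSpace (ModelProd EH EG) (H × G))

instance : Group Γ.Semi where
  mul x y := Γ.morMul x y
  one := ((1, 1) : H × G)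
  inv x := Γ.morInv x
  mul_assoc x y z := by
    change Γ.morMul (Γ.morMul x y) z = Γ.morMul x (Γ.morMul y z)
    simp [morMul, mul_assoc]
  one_mul x := by
    change Γ.morMul (1, 1) x = x
    simp only [morMul, map_one, MulAut.one_apply, one_mul]
    rfl
  mul_one x := by
    change Γ.morMul x (1, 1) = x
    simp only [morMul, map_one, mul_one]
    rfl
  inv_mul_cancel x := by
    change Γ.morMul (Γ.morInv x) x = (1, 1)
    simp [morMul, morInv]

/-- The model of the semi-direct product. -/
abbrev semiModel (_Γ : CrossedModule EG G EH H) :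
    ModelWithCorners ℝ (EH × EG) (ModelProd EH EG) := 𝓘(ℝ, EH).prod 𝓘(ℝ, EG)

variable [LieGroup 𝓘(ℝ, EG) ∞ G] [LieGroup 𝓘(ℝ, EH) ∞ H]

theorem semi_contMDiff_fst : ContMDiff Γ.semiModel 𝓘(ℝ, EH) ∞ (fun x : Γ.Semi => x.left) :=
  contMDiff_fst (M := H) (N := G)

theorem semi_contMDiff_snd : ContMDiff Γ.semiModel 𝓘(ℝ, EG) ∞ (fun x : Γ.Semi => x.right) :=
  contMDiff_snd (M := H) (N := G)

theorem contMDiff_act_comp {EX : Type*} [NormedAddCommGroup EX] [NormedSpace ℝ EX]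
    {KX : Type*} [TopologicalSpace KX] {J : ModelWithCorners ℝ EX KX}
    {X : Type*} [TopologicalSpace X] [ChartedSpace KX X] {f : X → G} {k : X → H}
    (hf : ContMDiff J 𝓘(ℝ, EG) ∞ f) (hk : ContMDiff J 𝓘(ℝ, EH) ∞ k) :
    ContMDiff J 𝓘(ℝ, EH) ∞ (fun x => Γ.α (f x) (k x)) :=
  Γ.smooth_α.comp (hf.prodMk hk)

instance : LieGroup Γ.semiModel ∞ Γ.Semi where
  toIsManifold := inferInstanceAs (IsManifold (𝓘(ℝ, EH).prod 𝓘(ℝ, EG)) ∞ (H × G))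
  contMDiff_mul := by
    have h1 : ContMDiff (Γ.semiModel.prod Γ.semiModel) Γ.semiModel ∞
        (fun p : Γ.Semi × Γ.Semi => p.1) := contMDiff_fst
    have h2 : ContMDiff (Γ.semiModel.prod Γ.semiModel) Γ.semiModel ∞
        (fun p : Γ.Semi × Γ.Semi => p.2) := contMDiff_snd
    have a1 := Γ.semi_contMDiff_fst.comp h1
    have a2 := Γ.semi_contMDiff_snd.comp h1
    have b1 := Γ.semi_contMDiff_fst.comp h2
    have b2 := Γ.semi_contMDiff_snd.comp h2
    exact (a1.mul (Γ.contMDiff_act_comp a2 b1)).prodMk (a2.mul b2)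
  contMDiff_inv :=
    (Γ.contMDiff_act_comp Γ.semi_contMDiff_snd.inv Γ.semi_contMDiff_fst.inv).prodMk
      Γ.semi_contMDiff_snd.inv

/-- The inclusion of `H` into the semi-direct product. -/
def semiInl : H →* Γ.Semi where
  toFun h := ((h, 1) : H × G)
  map_one' := rfl
  map_mul' x y := by
    change ((x * y, 1) : H × G) = Γ.morMul (x, 1) (y, 1)
    simp [morMul]

/-- The inclusion of `G` into the semi-direct product. -/
def semiInr : G →* Γ.Semi where
  toFun g := ((1, g) : H × G)
  map_one' := rfl
  map_mul' x y := by
    change ((1, x * y) : H × G) = Γ.morMul (1, x) (1, y)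
    simp [morMul]

theorem contMDiff_semiInl : ContMDiff 𝓘(ℝ, EH) Γ.semiModel ∞ Γ.semiInl :=
  contMDiff_id.prodMk contMDiff_const

theorem contMDiff_semiInr : ContMDiff 𝓘(ℝ, EG) Γ.semiModel ∞ Γ.semiInr :=
  contMDiff_const.prodMk contMDiff_id

theorem tmap_semiMk {EX : Type*} [NormedAddCommGroup EX] [NormedSpace ℝ EX]
    {KX : Type*} [TopologicalSpace KX] {J : ModelWithCorners ℝ EX KX}
    {X : Type*} [TopologicalSpace X] [ChartedSpace KX X] {f : X → H} {k : X → G} {x : X}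
    (hf : MDifferentiableAt J 𝓘(ℝ, EH) f x) (hk : MDifferentiableAt J 𝓘(ℝ, EG) k x) :
    tmap J Γ.semiModel (fun x => Γ.semiMk (f x) (k x)) x =
      (tmap J 𝓘(ℝ, EH) f x).prod (tmap J 𝓘(ℝ, EG) k x) :=
  tmap_prodMk hf hk

theorem tmap_semiInl (y : EH) : tmap 𝓘(ℝ, EH) Γ.semiModel Γ.semiInl 1 y = (y, 0) := by
  have h := Γ.tmap_semiMk (f := fun h : H => h) (k := fun _ : H => (1 : G)) (x := 1)
    mdifferentiableAt_id (mdifferentiableAt_const (I := 𝓘(ℝ, EH)))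
  rw [tmap_id, tmap_const] at h
  exact DFunLike.congr_fun h y

theorem tmap_semiInr (x : EG) : tmap 𝓘(ℝ, EG) Γ.semiModel Γ.semiInr 1 x = (0, x) := by
  have h := Γ.tmap_semiMk (f := fun _ : G => (1 : H)) (k := fun g : G => g) (x := 1)
    (mdifferentiableAt_const (I := 𝓘(ℝ, EG))) mdifferentiableAt_id
  rw [tmap_id, tmap_const] at h
  exact DFunLike.congr_fun h x

theorem conjStar_semi_inl (h : H) (g : G) (y : EH) :
    conjStar Γ.semiModel (Γ.semiMk h g) (y, 0) = (Ad h (Γ.actStar g y), 0) := by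
  have h1 := Γ.contMDiff_semiInl.mdifferentiableAt (by simp) (x := 1)
  have h2 : MDifferentiableAt 𝓘(ℝ, EH) 𝓘(ℝ, EH) (fun x : H => Γ.α g x) 1 :=
    (Γ.contMDiff_act g).mdifferentiableAt (by simp)
  have h3 : MDifferentiableAt 𝓘(ℝ, EH) 𝓘(ℝ, EH) (fun x : H => h * x * h⁻¹) 1 :=
    (contMDiff_conj h).mdifferentiableAt (by simp)
  have h4 : MDifferentiableAt 𝓘(ℝ, EH) 𝓘(ℝ, EH) (fun x : H => h * Γ.α g x * h⁻¹) 1 :=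
    ((contMDiff_conj h).comp (Γ.contMDiff_act g)).mdifferentiableAt (by simp)
  rw [← Γ.tmap_semiInl, conjStar, ← ContinuousLinearMap.comp_apply, ← tmap_comp_of_eq
    (map_one Γ.semiInl) ((contMDiff_conj (Γ.semiMk h g)).mdifferentiableAt (by simp)) h1]
  have e : (fun x : H => (Γ.semiMk h g) * Γ.semiInl x * (Γ.semiMk h g)⁻¹) =
      fun x => Γ.semiMk (h * Γ.α g x * h⁻¹) 1 := by
    funext x
    change Γ.morMul (Γ.morMul (h, g) (x, 1)) (Γ.morInv (h, g)) = (h * Γ.α g x * h⁻¹, 1)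
    simp [morMul, morInv]
  rw [e, Γ.tmap_semiMk h4 mdifferentiableAt_const, tmap_const,
    tmap_comp_of_eq (map_one (Γ.α g)) h3 h2]
  rfl

theorem conjStar_semi_inr (h : H) (g : G) (x : EG) :
    conjStar Γ.semiModel (Γ.semiMk h g) (0, x) = (Γ.tildeStar h⁻¹ (Ad g x), Ad g x) := by
  have h1 := Γ.contMDiff_semiInr.mdifferentiableAt (by simp) (x := 1)
  have h2 : MDifferentiableAt 𝓘(ℝ, EG) 𝓘(ℝ, EG) (fun x : G => g * x * g⁻¹) 1 :=
    (contMDiff_conj g).mdifferentiableAt (by simp)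
  have h3 : MDifferentiableAt 𝓘(ℝ, EG) 𝓘(ℝ, EH) (fun x : G => h⁻¹⁻¹ * Γ.α x h⁻¹) 1 :=
    (Γ.contMDiff_tilde h⁻¹).mdifferentiableAt (by simp)
  have h4 : MDifferentiableAt 𝓘(ℝ, EG) 𝓘(ℝ, EH)
      (fun x : G => h⁻¹⁻¹ * Γ.α (g * x * g⁻¹) h⁻¹) 1 :=
    ((Γ.contMDiff_tilde h⁻¹).comp (contMDiff_conj g)).mdifferentiableAt (by simp)
  rw [← Γ.tmap_semiInr, conjStar, ← ContinuousLinearMap.comp_apply, ← tmap_comp_of_eq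
    (map_one Γ.semiInr) ((contMDiff_conj (Γ.semiMk h g)).mdifferentiableAt (by simp)) h1]
  have e : (fun x : G => (Γ.semiMk h g) * Γ.semiInr x * (Γ.semiMk h g)⁻¹) =
      fun x => Γ.semiMk (h⁻¹⁻¹ * Γ.α (g * x * g⁻¹) h⁻¹) (g * x * g⁻¹) := by
    funext x
    change Γ.morMul (Γ.morMul (h, g) (1, x)) (Γ.morInv (h, g)) =
      (h⁻¹⁻¹ * Γ.α (g * x * g⁻¹) h⁻¹, g * x * g⁻¹)
    simp [morMul, morInv]
  rw [e, Γ.tmap_semiMk h4 h2, tmap_comp_of_eq (by simp) h3 h2]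
  rfl

/-- The `H`-component is the expression by which `GForm.adj` acts on morphisms, with `y` and `x` in
the places of `Ψ^b` and `s^*Ψ^a`. -/
theorem conjStar_semi (s : Γ.Semi) (y : EH) (x : EG) :
    conjStar Γ.semiModel s (y, x) =
      (Ad s.left (Γ.actStar s.right y) + Γ.tildeStar s.left⁻¹ (Ad s.right x), Ad s.right x) := by
  have h : (y, x) = (y, 0) + (0, x) := by simp
  rw [h, map_add]
  refine (congrArg₂ (· + ·) (Γ.conjStar_semi_inl s.left s.right y)
    (Γ.conjStar_semi_inr s.left s.right x)).trans ?_
  simp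

/-- The `H`-component is `Θ^b` and the `G`-component is `θ^G`: on morphisms, `Θ` is the
Maurer–Cartan form of `H ⋉ G`. -/
theorem mcAt_semi (s : Γ.Semi) (y : EH) (x : EG) :
    mcAt Γ.semiModel s (y, x) =
      (Γ.actStar s.right⁻¹ (mcAt 𝓘(ℝ, EH) s.left y), mcAt 𝓘(ℝ, EG) s.right x) := by
  have e : (fun z : Γ.Semi => s⁻¹ * z) =
      fun z => Γ.semiMk (Γ.α s.right⁻¹ (s.left⁻¹ * z.left)) (s.right⁻¹ * z.right) := by
    funext z
    change Γ.morMul (Γ.morInv (s.left, s.right)) (z.left, z.right) = (Γ.α s.right⁻¹ (s.left⁻¹ * z.left), s.right⁻¹ * z.right)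
    simp [morMul, morInv]
  have f1 := Γ.semi_contMDiff_fst.mdifferentiableAt (by simp) (x := s)
  have f2 := Γ.semi_contMDiff_snd.mdifferentiableAt (by simp) (x := s)
  have h1 : MDifferentiableAt 𝓘(ℝ, EH) 𝓘(ℝ, EH) (fun z : H => s.left⁻¹ * z) s.left :=
    (contMDiff_mul_left' _).mdifferentiableAt (by simp)
  have h2 : MDifferentiableAt 𝓘(ℝ, EG) 𝓘(ℝ, EG) (fun z : G => s.right⁻¹ * z) s.right :=
    (contMDiff_mul_left' _).mdifferentiableAt (by simp)
  have h3 : MDifferentiableAt Γ.semiModel 𝓘(ℝ, EH) (fun z : Γ.Semi => s.left⁻¹ * z.left) s :=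
    h1.comp s f1
  have h4 : MDifferentiableAt Γ.semiModel 𝓘(ℝ, EG) (fun z : Γ.Semi => s.right⁻¹ * z.right) s :=
    h2.comp s f2
  have h5 := (Γ.contMDiff_act s.right⁻¹).mdifferentiableAt (by simp) (x := 1)
  have h6 : MDifferentiableAt Γ.semiModel 𝓘(ℝ, EH)
      (fun z : Γ.Semi => Γ.α s.right⁻¹ (s.left⁻¹ * z.left)) s :=
    ((Γ.contMDiff_act s.right⁻¹).comp ((contMDiff_mul_left' _).comp
      Γ.semi_contMDiff_fst)).mdifferentiableAt (by simp)
  have t1 : tmap Γ.semiModel 𝓘(ℝ, EH) (fun z : Γ.Semi => z.left) s = ContinuousLinearMap.fst ℝ EH EG :=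
    tmap_fst (Y := H) (Z := G) s
  have t2 : tmap Γ.semiModel 𝓘(ℝ, EG) (fun z : Γ.Semi => z.right) s = ContinuousLinearMap.snd ℝ EH EG :=
    tmap_snd (Y := H) (Z := G) s
  rw [mcAt, e, Γ.tmap_semiMk h6 h4, tmap_comp_of_eq (f := fun z : Γ.Semi => s.left⁻¹ * z.left)
    (inv_mul_cancel s.left) h5 h3, tmap_comp s h1 f1, tmap_comp s h2 f2, t1, t2]
  rfl

/-- Conjugation by `(1, g)` acts on `H` through `α_g`; differentiate in `g` at `1`. -/
theorem adStar_semi_inr_inl (x : EG) (y : EH) :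
    adStar Γ.semiModel Γ.Semi (0, x) (y, 0) = (Γ.αStar x y, 0) := by
  have h1 := Γ.contMDiff_semiInr.mdifferentiableAt (by simp) (x := 1)
  have hc := mdifferentiableAt_conjStar (I := Γ.semiModel) (1 : Γ.Semi)
  have ha := Γ.mdifferentiableAt_actStar 1
  have hy : MDifferentiableAt 𝓘(ℝ, EG) 𝓘(ℝ, EH) (fun g : G => Γ.actStar g y) 1 :=
    ha.clm_apply mdifferentiableAt_const
  have hcy : MDifferentiableAt Γ.semiModel 𝓘(ℝ, EH × EG)
      (fun s : Γ.Semi => conjStar Γ.semiModel s (y, 0)) 1 :=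
    hc.clm_apply mdifferentiableAt_const
  have e : (fun g : G => conjStar Γ.semiModel (Γ.semiInr g) (y, 0)) =
      fun g => ContinuousLinearMap.inl ℝ EH EG (Γ.actStar g y) := by
    funext g
    refine (Γ.conjStar_semi_inl 1 g y).trans ?_
    have : Ad (1 : H) = ContinuousLinearMap.id ℝ EH := conjStar_one
    simp [this]
  have key := tmap_comp_of_eq (g := fun s : Γ.Semi => conjStar Γ.semiModel s (y, 0))
    (map_one Γ.semiInr) hcy h1
  rw [e, tmap_clm_left_comp _ hy] at key
  have key' := DFunLike.congr_fun key x
  rw [ContinuousLinearMap.comp_apply, ContinuousLinearMap.comp_apply, Γ.tmap_semiInr,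
    tmap_clm_apply hc, tmap_clm_apply ha] at key'
  exact key'.symm

/-- The two inclusions are homomorphisms, which settles the pure brackets; `adStar_semi_inr_inl` and
antisymmetry give the mixed ones. The `H`-component has the shape of the product `[Ψ ∧ Φ]` on
morphisms. -/
theorem adStar_semi (y y' : EH) (x x' : EG) :
    adStar Γ.semiModel Γ.Semi (y, x) (y', x') =
      (adStar 𝓘(ℝ, EH) H y y' + Γ.αStar x y' - Γ.αStar x' y, adStar 𝓘(ℝ, EG) G x x') := by
  have h : ∀ (y : EH) (x : EG), (y, x) = (y, 0) + (0, x) := by simp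
  have e1 := tmap_hom_adStar Γ.contMDiff_semiInl y y'
  have e2 := tmap_hom_adStar Γ.contMDiff_semiInr x x'
  simp only [Γ.tmap_semiInl] at e1
  simp only [Γ.tmap_semiInr] at e2
  rw [h y x, h y' x', map_add, map_add, add_apply, add_apply, ← e1, ← e2,
    Γ.adStar_semi_inr_inl, adStar_swap (I := Γ.semiModel) (S := Γ.Semi) (0, x') (y, 0),
    Γ.adStar_semi_inr_inl]
  ext <;> simp
  abel

end CrossedModule

/-! ### The curvature is a form with values in the Lie 2-algebra. -/

namespace DForm

theorem half_wedge_lieBr_self_apply {E : Type*} [NormedAddCommGroup E] [NormedSpace ℝ E] {X : Type*}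
    {EG : Type*} [NormedAddCommGroup EG] [NormedSpace ℝ EG] [FiniteDimensional ℝ EG]
    {G : Type*} [TopologicalSpace G] [ChartedSpace EG G] [Group G] [LieGroup 𝓘(ℝ, EG) ∞ G]
    (φ : DForm E X 1 EG) (x : X) (v : Fin 2 → E) :
    ((1 / 2 : ℝ) • wedge (lieBr EG G) φ φ) x v = lieBr EG G (φ x ![v 0]) (φ x ![v 1]) := by
  change (1 / 2 : ℝ) • (wedge (lieBr EG G) φ φ x v) = _
  rw [wedge_one_one_apply, lieBr_swap (φ x ![v 0]) (φ x ![v 1])]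
  module

end DForm

namespace GForm

variable {EG : Type*} [NormedAddCommGroup EG] [NormedSpace ℝ EG] [FiniteDimensional ℝ EG]
  {G : Type*} [TopologicalSpace G] [ChartedSpace EG G] [Group G] [LieGroup 𝓘(ℝ, EG) ∞ G]
  {EH : Type*} [NormedAddCommGroup EH] [NormedSpace ℝ EH] [FiniteDimensional ℝ EH]
  {H : Type*} [TopologicalSpace H] [ChartedSpace EH H] [Group H] [LieGroup 𝓘(ℝ, EH) ∞ H]
  {Γ : CrossedModule EG G EH H}
  {E₀ : Type*} [NormedAddCommGroup E₀] [NormedSpace ℝ E₀] [FiniteDimensional ℝ E₀]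
  {K₀ : Type*} [TopologicalSpace K₀] {I₀ : ModelWithCorners ℝ E₀ K₀} [I₀.Boundaryless]
  {X₀ : Type*} [TopologicalSpace X₀] [ChartedSpace K₀ X₀] [IsManifold I₀ ∞ X₀]
  {E₁ : Type*} [NormedAddCommGroup E₁] [NormedSpace ℝ E₁] [FiniteDimensional ℝ E₁]
  {K₁ : Type*} [TopologicalSpace K₁] {I₁ : ModelWithCorners ℝ E₁ K₁} [I₁.Boundaryless]
  {X₁ : Type*} [TopologicalSpace X₁] [ChartedSpace K₁ X₁] [IsManifold I₁ ∞ X₁]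
  {X : GpdStr X₀ X₁} {Ω : GForm E₀ X₀ E₁ X₁ EG EH 1}

theorem curv_a (Ω : GForm E₀ X₀ E₁ X₁ EG EH 1) : (curv Γ I₀ I₁ X Ω).a =
    (DForm.extD I₀ Ω.a + DForm.mapVal (fun _ => Γ.tStar) Ω.c
      + (1 / 2 : ℝ) • DForm.wedge (lieBr EG G) Ω.a Ω.a : DForm E₀ X₀ 2 EG) := by
  change (DForm.extD I₀ Ω.a - (-1 : ℝ) ^ 1 • DForm.mapVal (fun _ => Γ.tStar) Ω.c
    + (1 / 2 : ℝ) • DForm.wedge (lieBr EG G) Ω.a Ω.a : DForm E₀ X₀ 2 EG) = _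
  rw [pow_one, neg_one_smul, sub_neg_eq_add]

/-- In degree one the two `α_*` terms of the product coincide, signs included, so the factor `½`
disappears from them; likewise in `curv_c`. -/
theorem curv_b (Ω : GForm E₀ X₀ E₁ X₁ EG EH 1) : (curv Γ I₀ I₁ X Ω).b =
    (DForm.extD I₁ Ω.b + delta I₀ I₁ X Ω.c + (1 / 2 : ℝ) • DForm.wedge (lieBr EH H) Ω.b Ω.b
      + DForm.wedge Γ.αStar (DForm.pullback I₁ I₀ X.src Ω.a) Ω.b : DForm E₁ X₁ 2 EH) := by
  change (DForm.extD I₁ Ω.b - (-1 : ℝ) ^ 1 • delta I₀ I₁ X Ω.c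
    + (1 / 2 : ℝ) • (DForm.wedge (lieBr EH H) Ω.b Ω.b
      + DForm.wedge Γ.αStar (DForm.pullback I₁ I₀ X.src Ω.a) Ω.b
      - (-1 : ℝ) ^ 1 • DForm.wedge Γ.αStar (DForm.pullback I₁ I₀ X.src Ω.a) Ω.b) :
        DForm E₁ X₁ 2 EH) = _
  module

theorem curv_c (Ω : GForm E₀ X₀ E₁ X₁ EG EH 1) : (curv Γ I₀ I₁ X Ω).c =
    (DForm.extD I₀ Ω.c + DForm.wedge Γ.αStar Ω.a Ω.c : DForm E₀ X₀ 3 EH) := by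
  change (DForm.extD I₀ Ω.c + (1 / 2 : ℝ) • (DForm.wedge Γ.αStar Ω.a Ω.c
      - (-1 : ℝ) ^ 1 • DForm.wedge Γ.αStar Ω.a Ω.c) : DForm E₀ X₀ 3 EH) = _
  module

theorem contMDiff_comp_of_composable (hX : IsLieGroupoid I₀ I₁ X)
    {E : Type*} [NormedAddCommGroup E] [NormedSpace ℝ E] {K : Type*} [TopologicalSpace K]
    {J : ModelWithCorners ℝ E K} {Y : Type*} [TopologicalSpace Y] [ChartedSpace K Y]
    {ρ₁ ρ₂ : Y → X₁} (h₁ : ContMDiff J I₁ ∞ ρ₁) (h₂ : ContMDiff J I₁ ∞ ρ₂)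
    (h : ∀ u, X.src (ρ₁ u) = X.tgt (ρ₂ u)) :
    ContMDiff J I₁ ∞ (fun u => X.comp (ρ₁ u) (ρ₂ u)) :=
  hX.smooth_comp.comp_contMDiff (h₁.prodMk h₂) h

theorem isSmooth_curv_a (h : IsForm Γ I₀ I₁ X Ω) : DForm.IsSmooth I₀ (curv Γ I₀ I₁ X Ω).a := by
  rw [curv_a]
  exact (h.smooth_a.extD.add (h.smooth_c.mapVal contMDiff_const)).add
    ((h.smooth_a.wedge h.smooth_a _).const_smul _)

theorem isSmooth_delta (hX : IsLieGroupoid I₀ I₁ X) {p : ℕ} {φ : DForm E₀ X₀ p EH}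
    (h : DForm.IsSmooth I₀ φ) : DForm.IsSmooth I₁ (delta I₀ I₁ X φ) :=
  (h.pullback hX.submersion_tgt.contMDiff).sub (h.pullback hX.submersion_src.contMDiff)

theorem isSmooth_curv_b (hX : IsLieGroupoid I₀ I₁ X) (h : IsForm Γ I₀ I₁ X Ω) :
    DForm.IsSmooth I₁ (curv Γ I₀ I₁ X Ω).b := by
  rw [curv_b]
  exact ((h.smooth_b.extD.add (isSmooth_delta hX h.smooth_c)).add
    ((h.smooth_b.wedge h.smooth_b _).const_smul _)).add
      ((h.smooth_a.pullback hX.submersion_src.contMDiff).wedge h.smooth_b _)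

theorem isSmooth_curv_c (h : IsForm Γ I₀ I₁ X Ω) : DForm.IsSmooth I₀ (curv Γ I₀ I₁ X Ω).c := by
  rw [curv_c]
  exact h.smooth_c.extD.add (h.smooth_a.wedge h.smooth_c _)

theorem IsForm.pullback_tgt_a (h : IsForm Γ I₀ I₁ X Ω) :
    DForm.pullback I₁ I₀ X.tgt Ω.a =
      DForm.pullback I₁ I₀ X.src Ω.a + DForm.mapVal (fun _ => Γ.tStar) Ω.b := by
  rw [← h.delta_a, delta, add_sub_cancel]

/-- Substituting `t^*Ω^a = s^*Ω^a + t_*Ω^b`, the cross term `[s^*Ω^a ∧ t_*Ω^b]` is `t_*` of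
`α_*(s^*Ω^a ∧ Ω^b)`, and the square of `t_*Ω^b` is `t_*` of that of `Ω^b`. -/
theorem delta_curv_a (hX : IsLieGroupoid I₀ I₁ X) (h : IsForm Γ I₀ I₁ X Ω) :
    delta I₀ I₁ X (curv Γ I₀ I₁ X Ω).a =
      DForm.mapVal (fun _ => Γ.tStar) (curv Γ I₀ I₁ X Ω).b := by
  have hs := hX.submersion_src.contMDiff
  have ht := hX.submersion_tgt.contMDiff
  have hd := congrArg (DForm.extD I₁) h.pullback_tgt_a
  rw [h.smooth_a.extD_pullback ht, DForm.extD_add (h.smooth_a.pullback hs)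
    (h.smooth_b.mapVal contMDiff_const), h.smooth_a.extD_pullback hs,
    DForm.extD_mapVal_const h.smooth_b] at hd
  rw [curv_a, curv_b, delta]
  simp only [DForm.pullback_add, DForm.pullback_smul, DForm.pullback_wedge,
    DForm.pullback_mapVal, hd, h.pullback_tgt_a]
  funext f
  ext v
  simp only [DForm.add_apply', DForm.sub_apply', DForm.mapVal_apply, delta,
    DForm.half_wedge_lieBr_self_apply, map_add, map_sub, add_apply, Γ.tStar_lieBr,
    DForm.wedge_one_one_apply, Γ.tStar_αStar]
  rw [lieBr_swap (DForm.pullback I₁ I₀ X.src Ω.a f ![v 1]) (Γ.tStar (Ω.b f ![v 0]))]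
  abel

/-- All ingredients are natural, so `curv^b` along `ρ` depends only on the pulled-back data. It is
used along composable families and along functors. -/
theorem pullback_curv_b (hX : IsLieGroupoid I₀ I₁ X) (h : IsForm Γ I₀ I₁ X Ω)
    {E : Type*} [NormedAddCommGroup E] [NormedSpace ℝ E] [FiniteDimensional ℝ E]
    {K : Type*} [TopologicalSpace K]
    {J : ModelWithCorners ℝ E K} [J.Boundaryless] {Y : Type*} [TopologicalSpace Y]
    [ChartedSpace K Y] [IsManifold J ∞ Y] {ρ : Y → X₁} (hρ : ContMDiff J I₁ ∞ ρ) :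
    DForm.pullback J I₁ ρ (curv Γ I₀ I₁ X Ω).b =
      (DForm.extD J (DForm.pullback J I₁ ρ Ω.b)
      + (DForm.pullback J I₀ (fun u => X.tgt (ρ u)) Ω.c
        - DForm.pullback J I₀ (fun u => X.src (ρ u)) Ω.c)
      + (1 / 2 : ℝ) • DForm.wedge (lieBr EH H) (DForm.pullback J I₁ ρ Ω.b)
        (DForm.pullback J I₁ ρ Ω.b)
      + DForm.wedge Γ.αStar (DForm.pullback J I₀ (fun u => X.src (ρ u)) Ω.a)
        (DForm.pullback J I₁ ρ Ω.b) : DForm E Y 2 EH) := by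
  have hs := hX.submersion_src.contMDiff.mdifferentiable (by simp)
  have ht := hX.submersion_tgt.contMDiff.mdifferentiable (by simp)
  have hρ' := hρ.mdifferentiable (by simp)
  rw [curv_b, DForm.pullback_comp _ ht hρ', DForm.pullback_comp _ hs hρ',
    DForm.pullback_comp _ hs hρ', h.smooth_b.extD_pullback hρ]
  simp only [DForm.pullback_add, DForm.pullback_smul, DForm.pullback_wedge, delta,
    DForm.pullback_sub]

/-- Write `b₁`, `b₂` for `Ω^b` along the two families. The composite has `½[(b₁+b₂) ∧ (b₁+b₂)]` with
cross term `[b₁ ∧ b₂]`; the source form of `ρ₁` exceeds that of the composite by `t_* b₂`, which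
contributes `α_*(t_* b₂ ∧ b₁) = [b₂ ∧ b₁]`. For one-forms these agree, and the terms in `Ω^c`
telescope. -/
theorem deltaEqZero_curv_b (hX : IsLieGroupoid I₀ I₁ X) (h : IsForm Γ I₀ I₁ X Ω) :
    DeltaEqZero I₁ X (curv Γ I₀ I₁ X Ω).b := by
  intro k ρ₁ ρ₂ h₁ h₂ h₁₂
  have hc := contMDiff_comp_of_composable hX h₁ h₂ h₁₂
  have hb := h.delta_b k ρ₁ ρ₂ h₁ h₂ h₁₂
  have hs := hX.submersion_src.contMDiff.mdifferentiable (by simp)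
  have ht := hX.submersion_tgt.contMDiff.mdifferentiable (by simp)
  have hρ₂ := h₂.mdifferentiable (by simp)
  have hb' : DForm.pullback 𝓘(ℝ, EuclideanSpace ℝ (Fin k)) I₁ (fun u => X.comp (ρ₁ u) (ρ₂ u)) Ω.b
      = DForm.pullback 𝓘(ℝ, EuclideanSpace ℝ (Fin k)) I₁ ρ₁ Ω.b
        + DForm.pullback 𝓘(ℝ, EuclideanSpace ℝ (Fin k)) I₁ ρ₂ Ω.b := by
    rw [← sub_eq_zero, ← neg_eq_zero, ← hb]
    abel
  have ha : DForm.pullback 𝓘(ℝ, EuclideanSpace ℝ (Fin k)) I₀ (fun u => X.tgt (ρ₂ u)) Ω.a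
      = DForm.pullback 𝓘(ℝ, EuclideanSpace ℝ (Fin k)) I₀ (fun u => X.src (ρ₂ u)) Ω.a
        + DForm.mapVal (fun _ => Γ.tStar)
          (DForm.pullback 𝓘(ℝ, EuclideanSpace ℝ (Fin k)) I₁ ρ₂ Ω.b) := by
    rw [DForm.pullback_comp _ ht hρ₂, DForm.pullback_comp _ hs hρ₂, h.pullback_tgt_a]
    rfl
  rw [pullback_curv_b hX h h₁, pullback_curv_b hX h h₂, pullback_curv_b hX h hc, hb',
    DForm.extD_add (h.smooth_b.pullback h₁) (h.smooth_b.pullback h₂)]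
  have e1 : (fun u => X.src (X.comp (ρ₁ u) (ρ₂ u))) = fun u => X.src (ρ₂ u) :=
    funext fun u => hX.src_comp _ _ (h₁₂ u)
  have e2 : (fun u => X.tgt (X.comp (ρ₁ u) (ρ₂ u))) = fun u => X.tgt (ρ₁ u) :=
    funext fun u => hX.tgt_comp _ _ (h₁₂ u)
  simp only [e1, e2, h₁₂, ha]
  funext u
  ext v
  simp only [DForm.add_apply', DForm.sub_apply', DForm.mapVal_apply,
    DForm.half_wedge_lieBr_self_apply, map_add, add_apply,
    DForm.wedge_one_one_apply, Γ.αStar_tStar]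
  rw [lieBr_swap (DForm.pullback 𝓘(ℝ, EuclideanSpace ℝ (Fin k)) I₁ ρ₁ Ω.b u ![v 0])
    (DForm.pullback 𝓘(ℝ, EuclideanSpace ℝ (Fin k)) I₁ ρ₂ Ω.b u ![v 1])]
  change _ = (0 : EH)
  abel

theorem isForm_curv (hX : IsLieGroupoid I₀ I₁ X) (h : IsForm Γ I₀ I₁ X Ω) :
    IsForm Γ I₀ I₁ X (curv Γ I₀ I₁ X Ω) where
  smooth_a := isSmooth_curv_a h
  smooth_b := isSmooth_curv_b hX h
  smooth_c := isSmooth_curv_c h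
  delta_a := delta_curv_a hX h
  delta_b := deltaEqZero_curv_b hX h

end GForm

/-! ### The Bianchi identity. -/

namespace GForm

variable {EG : Type*} [NormedAddCommGroup EG] [NormedSpace ℝ EG] [FiniteDimensional ℝ EG]
  {G : Type*} [TopologicalSpace G] [ChartedSpace EG G] [Group G] [LieGroup 𝓘(ℝ, EG) ∞ G]
  {EH : Type*} [NormedAddCommGroup EH] [NormedSpace ℝ EH] [FiniteDimensional ℝ EH]
  {H : Type*} [TopologicalSpace H] [ChartedSpace EH H] [Group H] [LieGroup 𝓘(ℝ, EH) ∞ H]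
  {Γ : CrossedModule EG G EH H}
  {E₀ : Type*} [NormedAddCommGroup E₀] [NormedSpace ℝ E₀] [FiniteDimensional ℝ E₀]
  {K₀ : Type*} [TopologicalSpace K₀] {I₀ : ModelWithCorners ℝ E₀ K₀} [I₀.Boundaryless]
  {X₀ : Type*} [TopologicalSpace X₀] [ChartedSpace K₀ X₀] [IsManifold I₀ ∞ X₀]
  {E₁ : Type*} [NormedAddCommGroup E₁] [NormedSpace ℝ E₁] [FiniteDimensional ℝ E₁]
  {K₁ : Type*} [TopologicalSpace K₁] {I₁ : ModelWithCorners ℝ E₁ K₁} [I₁.Boundaryless]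
  {X₁ : Type*} [TopologicalSpace X₁] [ChartedSpace K₁ X₁] [IsManifold I₁ ∞ X₁]
  {X : GpdStr X₀ X₁} {Ω : GForm E₀ X₀ E₁ X₁ EG EH 1}

/-- The terms `t_* dΩ^c` cancel, `t_* α_*(Ω^a ∧ Ω^c)` is the bracket of `Ω^a` with `t_*Ω^c`, and
`[[Ω^a ∧ Ω^a] ∧ Ω^a] = 0` by Jacobi. -/
theorem bianchi_a (h : IsForm Γ I₀ I₁ X Ω) :
    (D Γ I₀ I₁ X (curv Γ I₀ I₁ X Ω)).a = (bracket Γ I₀ I₁ X (curv Γ I₀ I₁ X Ω) Ω).a := by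
  have ha := h.smooth_a
  have e : DForm.extD I₀ (curv Γ I₀ I₁ X Ω).a = (DForm.mapVal (fun _ => Γ.tStar) (DForm.extD I₀ Ω.c)
      + (1 / 2 : ℝ) • (DForm.wedge (lieBr EG G) (DForm.extD I₀ Ω.a) Ω.a
        - DForm.wedge (lieBr EG G) Ω.a (DForm.extD I₀ Ω.a)) : DForm E₀ X₀ 3 EG) := by
    rw [curv_a, DForm.extD_add (ha.extD.add (h.smooth_c.mapVal contMDiff_const))
      ((ha.wedge ha _).const_smul _), DForm.extD_add ha.extD (h.smooth_c.mapVal contMDiff_const),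
      ha.extD_extD, DForm.extD_smul, DForm.extD_mapVal_const h.smooth_c,
      DForm.extD_wedge_one_one _ ha ha, zero_add]
  change (DForm.extD I₀ (curv Γ I₀ I₁ X Ω).a - (-1 : ℝ) ^ 2 • DForm.mapVal (fun _ => Γ.tStar)
    (curv Γ I₀ I₁ X Ω).c : DForm E₀ X₀ 3 EG) =
    (DForm.wedge (lieBr EG G) (curv Γ I₀ I₁ X Ω).a Ω.a : DForm E₀ X₀ 3 EG)
  rw [e, curv_a, curv_c]
  funext x
  ext v
  simp only [DForm.add_apply', DForm.sub_apply', DForm.smul_apply', DForm.mapVal_apply,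
    map_add, map_sub, add_apply, DForm.wedge_two_one_apply,
    DForm.wedge_one_two_apply, Γ.tStar_αStar]
  simp only [← DForm.smul_apply', DForm.half_wedge_lieBr_self_apply]
  simp only [Matrix.cons_val_zero, Matrix.cons_val_one]
  set a0 := Ω.a x ![v 0]
  set a1 := Ω.a x ![v 1]
  set a2 := Ω.a x ![v 2]
  rw [lieBr_swap (DForm.extD I₀ Ω.a x ![v 0, v 1]) a2,
    lieBr_swap (DForm.extD I₀ Ω.a x ![v 0, v 2]) a1,
    lieBr_swap (DForm.extD I₀ Ω.a x ![v 1, v 2]) a0,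
    lieBr_swap (Γ.tStar (Ω.c x ![v 0, v 1])) a2,
    lieBr_swap (Γ.tStar (Ω.c x ![v 0, v 2])) a1,
    lieBr_swap (Γ.tStar (Ω.c x ![v 1, v 2])) a0]
  have j := lieBr_leibniz (G := G) a0 a1 a2
  rw [lieBr_swap (lieBr EG G a1 a2) a0, lieBr_swap (lieBr EG G a0 a2) a1] at j
  linear_combination (norm := module) j

/-- `α_*(t_*Ω^c ∧ Ω^c) = [Ω^c ∧ Ω^c]` vanishes because `Ω^c` has even degree, and the terms
quadratic in `Ω^a` cancel because `α_*` is a representation. -/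
theorem bianchi_c (h : IsForm Γ I₀ I₁ X Ω) :
    (D Γ I₀ I₁ X (curv Γ I₀ I₁ X Ω)).c = (bracket Γ I₀ I₁ X (curv Γ I₀ I₁ X Ω) Ω).c := by
  have ha := h.smooth_a
  have hc := h.smooth_c
  have e : DForm.extD I₀ (curv Γ I₀ I₁ X Ω).c =
      (DForm.wedge Γ.αStar (DForm.extD I₀ Ω.a) Ω.c
        - DForm.wedge Γ.αStar Ω.a (DForm.extD I₀ Ω.c) : DForm E₀ X₀ 4 EH) := by
    rw [curv_c, DForm.extD_add hc.extD (ha.wedge hc _), hc.extD_extD,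
      DForm.extD_wedge_one_two _ ha hc, zero_add]
  change (DForm.extD I₀ (curv Γ I₀ I₁ X Ω).c : DForm E₀ X₀ 4 EH) =
    (DForm.wedge Γ.αStar (curv Γ I₀ I₁ X Ω).a Ω.c
      - (-1 : ℝ) ^ 2 • DForm.wedge Γ.αStar Ω.a (curv Γ I₀ I₁ X Ω).c : DForm E₀ X₀ 4 EH)
  rw [e, curv_a, curv_c]
  funext x
  ext v
  simp only [DForm.add_apply', DForm.sub_apply', DForm.smul_apply', DForm.mapVal_apply,
    map_add, map_sub, add_apply, DForm.wedge_two_two_apply, DForm.wedge_one_three_apply,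
    DForm.wedge_one_two_apply, Γ.αStar_tStar]
  simp only [← DForm.smul_apply', DForm.half_wedge_lieBr_self_apply]
  simp only [Matrix.cons_val, Γ.αStar_lieBr_left]
  rw [lieBr_swap (Ω.c x ![v 0, v 1]) (Ω.c x ![v 2, v 3]),
    lieBr_swap (Ω.c x ![v 0, v 2]) (Ω.c x ![v 1, v 3]),
    lieBr_swap (Ω.c x ![v 0, v 3]) (Ω.c x ![v 1, v 2])]
  module

/-- Here `ΔΩ^c` interacts with `Ω^b`: expanding `t^*Ω^a` in `Δ curv^c` produces `[Ω^b ∧ t^*Ω^c]`,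
matched by `[ΔΩ^c ∧ Ω^b]` and `α_*(t_* s^*Ω^c ∧ Ω^b)`. The rest uses that `α_*` is a representation
by derivations, and Jacobi in `𝔥`. -/
theorem bianchi_b (hX : IsLieGroupoid I₀ I₁ X) (h : IsForm Γ I₀ I₁ X Ω) :
    (D Γ I₀ I₁ X (curv Γ I₀ I₁ X Ω)).b = (bracket Γ I₀ I₁ X (curv Γ I₀ I₁ X Ω) Ω).b := by
  have hs := hX.submersion_src.contMDiff
  have ht := hX.submersion_tgt.contMDiff
  have hb := h.smooth_b
  have hc := h.smooth_c
  have has := h.smooth_a.pullback hs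
  have e : DForm.extD I₁ (curv Γ I₀ I₁ X Ω).b = (delta I₀ I₁ X (DForm.extD I₀ Ω.c)
      + (1 / 2 : ℝ) • (DForm.wedge (lieBr EH H) (DForm.extD I₁ Ω.b) Ω.b
        - DForm.wedge (lieBr EH H) Ω.b (DForm.extD I₁ Ω.b))
      + (DForm.wedge Γ.αStar (DForm.pullback I₁ I₀ X.src (DForm.extD I₀ Ω.a)) Ω.b
        - DForm.wedge Γ.αStar (DForm.pullback I₁ I₀ X.src Ω.a) (DForm.extD I₁ Ω.b)) :
      DForm E₁ X₁ 3 EH) := by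
    rw [curv_b, DForm.extD_add ((hb.extD.add (isSmooth_delta hX hc)).add
      ((hb.wedge hb _).const_smul _)) (has.wedge hb _), DForm.extD_add
      (hb.extD.add (isSmooth_delta hX hc)) ((hb.wedge hb _).const_smul _), DForm.extD_add hb.extD
      (isSmooth_delta hX hc), hb.extD_extD, DForm.extD_smul, DForm.extD_wedge_one_one _ hb hb,
      DForm.extD_wedge_one_one _ has hb, zero_add, delta, DForm.extD_sub (hc.pullback ht)
      (hc.pullback hs), hc.extD_pullback ht, hc.extD_pullback hs, h.smooth_a.extD_pullback hs]
    rfl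
  change (DForm.extD I₁ (curv Γ I₀ I₁ X Ω).b - (-1 : ℝ) ^ 2 • delta I₀ I₁ X
    (curv Γ I₀ I₁ X Ω).c : DForm E₁ X₁ 3 EH) =
    (DForm.wedge (lieBr EH H) (curv Γ I₀ I₁ X Ω).b Ω.b
      + DForm.wedge Γ.αStar (DForm.pullback I₁ I₀ X.src (curv Γ I₀ I₁ X Ω).a) Ω.b
      - (-1 : ℝ) ^ 2 • DForm.wedge Γ.αStar (DForm.pullback I₁ I₀ X.src Ω.a)
        (curv Γ I₀ I₁ X Ω).b : DForm E₁ X₁ 3 EH)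
  rw [e, curv_a, curv_b, curv_c]
  simp only [delta, DForm.pullback_add, DForm.pullback_smul, DForm.pullback_wedge,
    DForm.pullback_mapVal, h.pullback_tgt_a]
  funext f
  ext v
  simp only [DForm.add_apply', DForm.sub_apply', DForm.smul_apply', DForm.mapVal_apply,
    map_add, map_sub, add_apply, sub_apply, DForm.wedge_two_one_apply,
    DForm.wedge_one_two_apply, Γ.αStar_tStar]
  simp only [← DForm.smul_apply', DForm.half_wedge_lieBr_self_apply]
  simp only [DForm.wedge_one_one_apply, Matrix.cons_val, Γ.αStar_lieBr_left, Γ.αStar_lieBr_right,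
    map_sub, sub_apply]
  set s0 := DForm.pullback I₁ I₀ X.src Ω.a f ![v 0]
  set s1 := DForm.pullback I₁ I₀ X.src Ω.a f ![v 1]
  set s2 := DForm.pullback I₁ I₀ X.src Ω.a f ![v 2]
  set b0 := Ω.b f ![v 0]
  set b1 := Ω.b f ![v 1]
  set b2 := Ω.b f ![v 2]
  rw [lieBr_swap (DForm.extD I₁ Ω.b f ![v 0, v 1]) b2,
    lieBr_swap (DForm.extD I₁ Ω.b f ![v 0, v 2]) b1,
    lieBr_swap (DForm.extD I₁ Ω.b f ![v 1, v 2]) b0,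
    lieBr_swap (DForm.pullback I₁ I₀ X.tgt Ω.c f ![v 0, v 1]) b2,
    lieBr_swap (DForm.pullback I₁ I₀ X.tgt Ω.c f ![v 0, v 2]) b1,
    lieBr_swap (DForm.pullback I₁ I₀ X.tgt Ω.c f ![v 1, v 2]) b0,
    lieBr_swap (Γ.αStar s0 b2) b1, lieBr_swap (Γ.αStar s1 b2) b0, lieBr_swap (Γ.αStar s2 b1) b0]
  have j := lieBr_leibniz (G := H) b0 b1 b2
  rw [lieBr_swap (lieBr EH H b1 b2) b0, lieBr_swap (lieBr EH H b0 b2) b1] at j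
  linear_combination (norm := module) j

/-- The Bianchi identity. -/

theorem bianchi (hX : IsLieGroupoid I₀ I₁ X) (h : IsForm Γ I₀ I₁ X Ω) :
    D Γ I₀ I₁ X (curv Γ I₀ I₁ X Ω) = bracket Γ I₀ I₁ X (curv Γ I₀ I₁ X Ω) Ω :=
  GForm.ext (bianchi_a h) (bianchi_b hX h) (bianchi_c h)

end GForm

/-! ### Equivariance of the curvature. -/

namespace DForm

section Pair

variable {E : Type*} [NormedAddCommGroup E] [NormedSpace ℝ E] {X : Type*}
  {V W : Type*} [NormedAddCommGroup V] [NormedSpace ℝ V]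
  [NormedAddCommGroup W] [NormedSpace ℝ W] {n : ℕ}

/-- The form with values in `V × W` with the given components. -/
def pair (φ : DForm E X n V) (ψ : DForm E X n W) : DForm E X n (V × W) :=
  mapVal (fun _ => ContinuousLinearMap.inl ℝ V W) φ + mapVal (fun _ => ContinuousLinearMap.inr ℝ V W) ψ

theorem pair_apply (φ : DForm E X n V) (ψ : DForm E X n W) (x : X) (v : Fin n → E) :
    pair φ ψ x v = (φ x v, ψ x v) := by
  change (φ x v, (0 : W)) + ((0 : V), ψ x v) = _
  simp

variable [FiniteDimensional ℝ E] [FiniteDimensional ℝ V] [FiniteDimensional ℝ W]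
  {K : Type*} [TopologicalSpace K] {I : ModelWithCorners ℝ E K} [I.Boundaryless]
  [TopologicalSpace X] [ChartedSpace K X] [IsManifold I ∞ X]

theorem IsSmooth.pair {φ : DForm E X n V} {ψ : DForm E X n W} (hφ : IsSmooth I φ)
    (hψ : IsSmooth I ψ) : IsSmooth I (pair φ ψ) :=
  (hφ.mapVal contMDiff_const).add (hψ.mapVal contMDiff_const)

theorem extD_pair {φ : DForm E X n V} {ψ : DForm E X n W} (hφ : IsSmooth I φ)
    (hψ : IsSmooth I ψ) : extD I (DForm.pair φ ψ) = DForm.pair (extD I φ) (extD I ψ) := by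
  rw [DForm.pair, extD_add (hφ.mapVal contMDiff_const) (hψ.mapVal contMDiff_const),
    extD_mapVal_const hφ, extD_mapVal_const hψ, DForm.pair]

end Pair

end DForm

namespace GForm

variable {EG : Type*} [NormedAddCommGroup EG] [NormedSpace ℝ EG] [FiniteDimensional ℝ EG]
  {G : Type*} [TopologicalSpace G] [ChartedSpace EG G] [Group G] [LieGroup 𝓘(ℝ, EG) ∞ G]
  {EH : Type*} [NormedAddCommGroup EH] [NormedSpace ℝ EH] [FiniteDimensional ℝ EH]
  {H : Type*} [TopologicalSpace H] [ChartedSpace EH H] [Group H] [LieGroup 𝓘(ℝ, EH) ∞ H]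
  {Γ : CrossedModule EG G EH H}
  {E₀ : Type*} [NormedAddCommGroup E₀] [NormedSpace ℝ E₀] [FiniteDimensional ℝ E₀]
  {K₀ : Type*} [TopologicalSpace K₀] {I₀ : ModelWithCorners ℝ E₀ K₀} [I₀.Boundaryless]
  {X₀ : Type*} [TopologicalSpace X₀] [ChartedSpace K₀ X₀] [IsManifold I₀ ∞ X₀]
  {E₁ : Type*} [NormedAddCommGroup E₁] [NormedSpace ℝ E₁] [FiniteDimensional ℝ E₁]
  {K₁ : Type*} [TopologicalSpace K₁] {I₁ : ModelWithCorners ℝ E₁ K₁} [I₁.Boundaryless]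
  {X₁ : Type*} [TopologicalSpace X₁] [ChartedSpace K₁ X₁] [IsManifold I₁ ∞ X₁]
  {X : GpdStr X₀ X₁} {Ω : GForm E₀ X₀ E₁ X₁ EG EH 1}
  {F₀ : Type*} [NormedAddCommGroup F₀] [NormedSpace ℝ F₀] [FiniteDimensional ℝ F₀]
  {L₀ : Type*} [TopologicalSpace L₀] {J₀ : ModelWithCorners ℝ F₀ L₀} [J₀.Boundaryless]
  {Y₀ : Type*} [TopologicalSpace Y₀] [ChartedSpace L₀ Y₀] [IsManifold J₀ ∞ Y₀]
  {F₁ : Type*} [NormedAddCommGroup F₁] [NormedSpace ℝ F₁] [FiniteDimensional ℝ F₁]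
  {L₁ : Type*} [TopologicalSpace L₁] {J₁ : ModelWithCorners ℝ F₁ L₁} [J₁.Boundaryless]
  {Y₁ : Type*} [TopologicalSpace Y₁] [ChartedSpace L₁ Y₁] [IsManifold J₁ ∞ Y₁]
  {Y : GpdStr Y₀ Y₁} {p₀ r₀ : Y₀ → X₀} {p₁ r₁ : Y₁ → X₁} {g₀ : Y₀ → G} {g₁ : Y₁ → H × G}

theorem maurerCartan_eq_mcForm : (maurerCartan : DForm EG G 1 EG) = mcForm 𝓘(ℝ, EG) G := rfl

/-- The ordinary gauge law covers `dΩ^a + ½[Ω^a ∧ Ω^a]`; the remaining `t_*Ω^c` transforms correctly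
because `t_*` intertwines `α_g` with `Ad_g`. -/
theorem pullback_curv_a_of_gauge (h : IsForm Γ I₀ I₁ X Ω)
    (hp : ContMDiff J₀ I₀ ∞ p₀) (hr : ContMDiff J₀ I₀ ∞ r₀) (hg : ContMDiff J₀ 𝓘(ℝ, EG) ∞ g₀)
    (ea : DForm.pullback J₀ I₀ r₀ Ω.a = DForm.mapVal (fun x => Ad (g₀ x)⁻¹)
      (DForm.pullback J₀ I₀ p₀ Ω.a) + DForm.pullback J₀ 𝓘(ℝ, EG) g₀ maurerCartan)
    (ec : DForm.pullback J₀ I₀ r₀ Ω.c = DForm.mapVal (fun x => Γ.actStar (g₀ x)⁻¹)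
      (DForm.pullback J₀ I₀ p₀ Ω.c)) :
    DForm.pullback J₀ I₀ r₀ (curv Γ I₀ I₁ X Ω).a = DForm.mapVal (fun x => Ad (g₀ x)⁻¹)
      (DForm.pullback J₀ I₀ p₀ (curv Γ I₀ I₁ X Ω).a) := by
  have key := extD_gauge_add_half_wedge hg (h.smooth_a.pullback hp) ea
  rw [h.smooth_a.extD_pullback hr, h.smooth_a.extD_pullback hp] at key
  rw [curv_a]
  simp only [DForm.pullback_add, DForm.pullback_smul, DForm.pullback_wedge,
    DForm.pullback_mapVal, lieBr_eq_adStar]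
  rw [add_right_comm, key, ec]
  funext x
  ext v
  have := DFunLike.congr_fun (Γ.tStar_comp_actStar (g₀ x)⁻¹) (DForm.pullback J₀ I₀ p₀ Ω.c x v)
  simp only [ContinuousLinearMap.comp_apply] at this
  simp only [DForm.add_apply', DForm.mapVal_apply, map_add, this]
  exact add_right_comm _ _ _

/-- Differentiating `α_{g⁻¹}` produces `-α_*(g^*θ ∧ ·)`, which cancels the Maurer–Cartan part of
`r^*Ω^a` in `α_*(r^*Ω^a ∧ r^*Ω^c)`. -/
theorem pullback_curv_c_of_gauge (h : IsForm Γ I₀ I₁ X Ω)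
    (hp : ContMDiff J₀ I₀ ∞ p₀) (hr : ContMDiff J₀ I₀ ∞ r₀) (hg : ContMDiff J₀ 𝓘(ℝ, EG) ∞ g₀)
    (ea : DForm.pullback J₀ I₀ r₀ Ω.a = DForm.mapVal (fun x => Ad (g₀ x)⁻¹)
      (DForm.pullback J₀ I₀ p₀ Ω.a) + DForm.pullback J₀ 𝓘(ℝ, EG) g₀ maurerCartan)
    (ec : DForm.pullback J₀ I₀ r₀ Ω.c = DForm.mapVal (fun x => Γ.actStar (g₀ x)⁻¹)
      (DForm.pullback J₀ I₀ p₀ Ω.c)) :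
    DForm.pullback J₀ I₀ r₀ (curv Γ I₀ I₁ X Ω).c = DForm.mapVal (fun x => Γ.actStar (g₀ x)⁻¹)
      (DForm.pullback J₀ I₀ p₀ (curv Γ I₀ I₁ X Ω).c) := by
  have key := Γ.isSmoothRep_actStar.extD_mapVal_two hg (h.smooth_c.pullback hp)
  rw [← ec, h.smooth_c.extD_pullback hr, h.smooth_c.extD_pullback hp, ec] at key
  rw [curv_c]
  simp only [DForm.pullback_add, DForm.pullback_wedge]
  rw [key, ea, ec, maurerCartan_eq_mcForm]
  funext x
  ext v
  simp only [DForm.add_apply', DForm.sub_apply', DForm.mapVal_apply, DForm.wedge_one_two_apply,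
    map_add, map_sub, add_apply, Γ.αStar_actStar]
  change _ - (Γ.αStar _ _ - Γ.αStar _ _ + Γ.αStar _ _) + _ = _
  abel

/-- The morphism component of a gauge transformation, as a gauge transformation for the
semi-direct product. -/

theorem pair_eq_of_gauge (hY : ContMDiff J₁ J₀ ∞ Y.src)
    (hp : IsSmoothFunctor J₀ J₁ I₀ I₁ Y X p₀ p₁) (hr : IsSmoothFunctor J₀ J₁ I₀ I₁ Y X r₀ r₁)
    (hg : IsSmoothFunctor J₀ J₁ 𝓘(ℝ, EG) (𝓘(ℝ, EH).prod 𝓘(ℝ, EG)) Y Γ.gpd g₀ g₁)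
    (e : pullback J₀ J₁ I₀ I₁ r₀ r₁ Ω = adjInv Γ J₀ J₁ Y g₀ g₁ (pullback J₀ J₁ I₀ I₁ p₀ p₁ Ω)
      + pullback J₀ J₁ 𝓘(ℝ, EG) (𝓘(ℝ, EH).prod 𝓘(ℝ, EG)) g₀ g₁ (Theta Γ)) :
    DForm.pair (DForm.pullback J₁ I₁ r₁ Ω.b) (DForm.pullback J₁ I₀ (fun y => X.src (r₁ y)) Ω.a) =
      DForm.mapVal (fun y => conjStar Γ.semiModel (Γ.toSemi (g₁ y))⁻¹)
        (DForm.pair (DForm.pullback J₁ I₁ p₁ Ω.b)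
          (DForm.pullback J₁ I₀ (fun y => X.src (p₁ y)) Ω.a))
      + DForm.pullback J₁ Γ.semiModel (fun y => Γ.toSemi (g₁ y)) (mcForm Γ.semiModel Γ.Semi) := by
  have hp₁ := hp.smooth_mor.mdifferentiable (by simp)
  have hY' := hY.mdifferentiable (by simp)
  have ea : DForm.pullback J₀ I₀ r₀ Ω.a = DForm.mapVal (fun x => Ad (g₀ x)⁻¹)
      (DForm.pullback J₀ I₀ p₀ Ω.a) + DForm.pullback J₀ 𝓘(ℝ, EG) g₀ maurerCartan :=
    congrArg GForm.a e
  have eb := congrArg GForm.b e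
  have ep : DForm.pullback J₁ J₀ Y.src (DForm.pullback J₀ I₀ p₀ Ω.a) =
      DForm.pullback J₁ I₀ (fun y => X.src (p₁ y)) Ω.a := by
    rw [← DForm.pullback_comp _ (hp.smooth_obj.mdifferentiable (by simp)) hY']
    simp only [hp.src_map]
  have er : DForm.pullback J₁ I₀ (fun y => X.src (r₁ y)) Ω.a =
      DForm.pullback J₁ J₀ Y.src (DForm.pullback J₀ I₀ r₀ Ω.a) := by
    rw [← DForm.pullback_comp _ (hr.smooth_obj.mdifferentiable (by simp)) hY']
    simp only [hr.src_map]
  have hsrc : ∀ y, g₀ (Y.src y) = (g₁ y).2 := fun y => (hg.src_map y).symm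
  have eg : DForm.pullback J₁ J₀ Y.src (DForm.pullback J₀ 𝓘(ℝ, EG) g₀ maurerCartan) =
      DForm.pullback J₁ 𝓘(ℝ, EG) (fun y => (g₁ y).2) maurerCartan := by
    rw [← DForm.pullback_comp _ (hg.smooth_obj.mdifferentiable (by simp)) hY']
    simp only [hsrc]
  have hg₁ := hg.smooth_mor.mdifferentiable (by simp)
  funext y
  ext1 v
  have et : tmap J₁ 𝓘(ℝ, EG) (fun y => (g₁ y).2) y (v 0) =
      (tmap J₁ (𝓘(ℝ, EH).prod 𝓘(ℝ, EG)) g₁ y (v 0)).2 := by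
    rw [tmap_comp y mdifferentiableAt_snd (hg₁ y), tmap_snd]
    rfl
  rw [DForm.add_apply', DForm.mapVal_apply, DForm.pair_apply, DForm.pair_apply, er, ea,
    DForm.pullback_add, DForm.pullback_mapVal, ep, eg]
  have c1 := Γ.conjStar_semi (Γ.toSemi (g₁ y))⁻¹ (DForm.pullback J₁ I₁ p₁ Ω.b y v)
    (DForm.pullback J₁ I₀ (fun y => X.src (p₁ y)) Ω.a y v)
  have c2 := Γ.mcAt_semi (Γ.toSemi (g₁ y)) (tmap J₁ (𝓘(ℝ, EH).prod 𝓘(ℝ, EG)) g₁ y (v 0)).1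
    (tmap J₁ (𝓘(ℝ, EH).prod 𝓘(ℝ, EG)) g₁ y (v 0)).2
  have eb' := DFunLike.congr_fun (congrFun eb y) v
  have ep' := DFunLike.congr_fun (congrFun ep y) v
  -- The `H`-component is the morphism part of the hypothesis `e`; the `G`-component is its object
  -- part pulled back along the source map, with `g₀ (Y.src y) = (g₁ y).2`.
  refine Prod.ext ?_ ?_
  · refine Eq.trans ?_ (congrArg Prod.fst (congrArg₂ (· + ·) c1 c2)).symm
    refine eb'.trans ?_
    refine congrArg₂ (· + ·) (congrArg₂ (· + ·) rfl
      (congrArg (fun z => Γ.tildeStar (Γ.morInv (g₁ y)).1⁻¹ (Ad (Γ.morInv (g₁ y)).2 z)) ep')) ?_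
    exact congrArg (fun L : EH × EG →L[ℝ] EH => Γ.actStar (g₁ y).2⁻¹ (mcAt 𝓘(ℝ, EH) (g₁ y).1
      (L (tmap J₁ (𝓘(ℝ, EH).prod 𝓘(ℝ, EG)) g₁ y (v 0))))) (tmap_fst (g₁ y))
  · refine Eq.trans ?_ (congrArg Prod.snd (congrArg₂ (· + ·) c1 c2)).symm
    exact congrArg₂ (· + ·) (congrArg (fun z => Ad z⁻¹
      (DForm.pullback J₁ I₀ (fun y => X.src (p₁ y)) Ω.a y v)) (hsrc y))
      (congrArg (mcAt 𝓘(ℝ, EG) (g₁ y).2) et)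

/-- For `φ = Ω^b` and `ψ = s^*Ω^a` the components are `curv^b` without `ΔΩ^c` and `s^*curv^a`
without `t_*s^*Ω^c`. -/
theorem extD_add_half_wedge_semi_apply {φ : DForm F₁ Y₁ 1 EH} {ψ : DForm F₁ Y₁ 1 EG}
    (hφ : DForm.IsSmooth J₁ φ) (hψ : DForm.IsSmooth J₁ ψ) (y : Y₁) (v : Fin 2 → F₁) :
    (DForm.extD J₁ (DForm.pair φ ψ) + (1 / 2 : ℝ) • DForm.wedge (adStar Γ.semiModel Γ.Semi)
      (DForm.pair φ ψ) (DForm.pair φ ψ) : DForm F₁ Y₁ 2 (EH × EG)) y v =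
    ((DForm.extD J₁ φ + (1 / 2 : ℝ) • DForm.wedge (lieBr EH H) φ φ
      + DForm.wedge Γ.αStar ψ φ : DForm F₁ Y₁ 2 EH) y v,
      (DForm.extD J₁ ψ + (1 / 2 : ℝ) • DForm.wedge (lieBr EG G) ψ ψ : DForm F₁ Y₁ 2 EG) y v) := by
  rw [DForm.extD_pair hφ hψ]
  simp only [DForm.add_apply', DForm.smul_apply', DForm.wedge_one_one_apply, DForm.pair_apply,
    Γ.adStar_semi, lieBr_eq_adStar]
  refine Prod.ext ?_ ?_
  · simp only [Prod.fst_add, Prod.fst_sub, Prod.smul_fst]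
    module
  · simp only [Prod.snd_add, Prod.snd_sub, Prod.smul_snd]

/-- The gauge law in `H ⋉ G` handles everything except `Ω^c`. Those terms change by `α_{g⁻¹}` with
`g` taken at the target or at the source of the morphism, and the discrepancy between the two is the
`t_*Ω^c` part of `curv^a` fed through `α̃_*`. -/
theorem pullback_curv_b_of_gauge (h : IsForm Γ I₀ I₁ X Ω) (hX : IsLieGroupoid I₀ I₁ X)
    (hYs : ContMDiff J₁ J₀ ∞ Y.src) (hYt : ContMDiff J₁ J₀ ∞ Y.tgt)
    (hp : IsSmoothFunctor J₀ J₁ I₀ I₁ Y X p₀ p₁) (hr : IsSmoothFunctor J₀ J₁ I₀ I₁ Y X r₀ r₁)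
    (hg : IsSmoothFunctor J₀ J₁ 𝓘(ℝ, EG) (𝓘(ℝ, EH).prod 𝓘(ℝ, EG)) Y Γ.gpd g₀ g₁)
    (e : pullback J₀ J₁ I₀ I₁ r₀ r₁ Ω = adjInv Γ J₀ J₁ Y g₀ g₁ (pullback J₀ J₁ I₀ I₁ p₀ p₁ Ω)
      + pullback J₀ J₁ 𝓘(ℝ, EG) (𝓘(ℝ, EH).prod 𝓘(ℝ, EG)) g₀ g₁ (Theta Γ)) :
    DForm.pullback J₁ I₁ r₁ (curv Γ I₀ I₁ X Ω).b =
      (adjInv Γ J₀ J₁ Y g₀ g₁ (pullback J₀ J₁ I₀ I₁ p₀ p₁ (curv Γ I₀ I₁ X Ω))).b := by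
  have hs := hX.submersion_src.contMDiff
  have ht := hX.submersion_tgt.contMDiff
  have hsp : ContMDiff J₁ I₀ ∞ (fun y => X.src (p₁ y)) := hs.comp hp.smooth_mor
  have hsr : ContMDiff J₁ I₀ ∞ (fun y => X.src (r₁ y)) := hs.comp hr.smooth_mor
  have hgS : ContMDiff J₁ Γ.semiModel ∞ (fun y => Γ.toSemi (g₁ y)) := hg.smooth_mor
  have key := extD_gauge_add_half_wedge hgS
    ((h.smooth_b.pullback hp.smooth_mor).pair (h.smooth_a.pullback hsp))
    (pair_eq_of_gauge hYs hp hr hg e)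
  have ec : ∀ x v, DForm.pullback J₀ I₀ r₀ Ω.c x v = Γ.actStar (g₀ x)⁻¹
      (DForm.pullback J₀ I₀ p₀ Ω.c x v) := by
    intro x v
    refine (DFunLike.congr_fun (congrFun (congrArg GForm.c e) x) v).trans ?_
    exact add_zero _
  have pc : ∀ {q₀ : Y₀ → X₀} {q₁ : Y₁ → X₁}, IsSmoothFunctor J₀ J₁ I₀ I₁ Y X q₀ q₁ →
      DForm.pullback J₁ I₀ (fun y => X.tgt (q₁ y)) Ω.c =
        DForm.pullback J₁ J₀ Y.tgt (DForm.pullback J₀ I₀ q₀ Ω.c) ∧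
      DForm.pullback J₁ I₀ (fun y => X.src (q₁ y)) Ω.c =
        DForm.pullback J₁ J₀ Y.src (DForm.pullback J₀ I₀ q₀ Ω.c) := by
    intro q₀ q₁ hq
    rw [← DForm.pullback_comp _ (hq.smooth_obj.mdifferentiable (by simp))
      (hYt.mdifferentiable (by simp)), ← DForm.pullback_comp _
      (hq.smooth_obj.mdifferentiable (by simp)) (hYs.mdifferentiable (by simp))]
    simp only [hq.tgt_map, hq.src_map, and_self]
  have ep : DForm.pullback J₁ J₀ Y.src (DForm.pullback J₀ I₀ p₀ (curv Γ I₀ I₁ X Ω).a) =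
      DForm.pullback J₁ I₀ (fun y => X.src (p₁ y)) (curv Γ I₀ I₁ X Ω).a := by
    rw [← DForm.pullback_comp _ (hp.smooth_obj.mdifferentiable (by simp))
      (hYs.mdifferentiable (by simp))]
    simp only [hp.src_map]
  funext y
  ext1 v
  have key' := DFunLike.congr_fun (congrFun key y) v
  rw [DForm.mapVal_apply, extD_add_half_wedge_semi_apply (h.smooth_b.pullback hr.smooth_mor)
    (h.smooth_a.pullback hsr), extD_add_half_wedge_semi_apply
    (h.smooth_b.pullback hp.smooth_mor) (h.smooth_a.pullback hsp), Γ.conjStar_semi] at key'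
  have key1 := congrArg Prod.fst key'
  set s₁ := (Γ.morInv (g₁ y)).1 with hs₁
  set s₂ := (Γ.morInv (g₁ y)).2 with hs₂
  have hsrc : (g₀ (Y.src y))⁻¹ = s₂ := by
    rw [← hg.src_map]
    rfl
  -- The pointwise inverse of `g` is again compatible with targets: the target of the morphism `(s₁,
  -- s₂)` is `t(s₁) s₂`.
  have htgt : (g₀ (Y.tgt y))⁻¹ = Γ.t s₁ * s₂ := by
    rw [← hg.tgt_map, hs₁, hs₂]
    simp only [CrossedModule.gpd, CrossedModule.morInv, Γ.t_α, map_inv Γ.t]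
    group
  have fa : DForm.pullback J₁ I₀ (fun y => X.src (p₁ y)) (curv Γ I₀ I₁ X Ω).a y v =
      (DForm.extD J₁ (DForm.pullback J₁ I₀ (fun y => X.src (p₁ y)) Ω.a)
        + (1 / 2 : ℝ) • DForm.wedge (lieBr EG G)
          (DForm.pullback J₁ I₀ (fun y => X.src (p₁ y)) Ω.a)
          (DForm.pullback J₁ I₀ (fun y => X.src (p₁ y)) Ω.a) : DForm F₁ Y₁ 2 EG) y v
      + Γ.tStar (DForm.pullback J₁ I₀ (fun y => X.src (p₁ y)) Ω.c y v) := by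
    rw [curv_a, h.smooth_a.extD_pullback hsp]
    simp only [DForm.pullback_add, DForm.pullback_smul, DForm.pullback_wedge,
      DForm.pullback_mapVal]
    rw [add_right_comm]
    rfl
  have fb : ∀ {q₀ : Y₀ → X₀} {q₁ : Y₁ → X₁}, IsSmoothFunctor J₀ J₁ I₀ I₁ Y X q₀ q₁ →
      DForm.pullback J₁ I₁ q₁ (curv Γ I₀ I₁ X Ω).b y v =
      (DForm.extD J₁ (DForm.pullback J₁ I₁ q₁ Ω.b)
        + (1 / 2 : ℝ) • DForm.wedge (lieBr EH H) (DForm.pullback J₁ I₁ q₁ Ω.b)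
          (DForm.pullback J₁ I₁ q₁ Ω.b)
        + DForm.wedge Γ.αStar (DForm.pullback J₁ I₀ (fun y => X.src (q₁ y)) Ω.a)
          (DForm.pullback J₁ I₁ q₁ Ω.b) : DForm F₁ Y₁ 2 EH) y v
      + (DForm.pullback J₁ I₀ (fun y => X.tgt (q₁ y)) Ω.c y v
        - DForm.pullback J₁ I₀ (fun y => X.src (q₁ y)) Ω.c y v) := by
    intro q₀ q₁ hq
    rw [pullback_curv_b hX h hq.smooth_mor]
    simp only [DForm.add_apply', DForm.sub_apply']
    abel
  have ct : DForm.pullback J₁ I₀ (fun y => X.tgt (r₁ y)) Ω.c y v = Γ.actStar (Γ.t s₁ * s₂)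
      (DForm.pullback J₁ I₀ (fun y => X.tgt (p₁ y)) Ω.c y v) := by
    rw [(pc hr).1, (pc hp).1, ← htgt]
    exact ec _ _
  have cs : DForm.pullback J₁ I₀ (fun y => X.src (r₁ y)) Ω.c y v = Γ.actStar s₂
      (DForm.pullback J₁ I₀ (fun y => X.src (p₁ y)) Ω.c y v) := by
    rw [(pc hr).2, (pc hp).2, ← hsrc]
    exact ec _ _
  have hAd : ∀ z, Ad s₂ (Γ.tStar z) = Γ.tStar (Γ.actStar s₂ z) := fun z =>
    (DFunLike.congr_fun (Γ.tStar_comp_actStar s₂) z).symm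
  have htilde : ∀ z, Γ.tildeStar s₁⁻¹ (Γ.tStar z) = Ad s₁ z - z := fun z =>
    DFunLike.congr_fun (Γ.tildeStar_comp_tStar s₁) z
  refine Eq.trans ?_ (congrArg (fun z => Ad s₁ (Γ.actStar s₂ (DForm.pullback J₁ I₁ p₁
    (curv Γ I₀ I₁ X Ω).b y v)) + Γ.tildeStar s₁⁻¹ (Ad s₂ z))
      (DFunLike.congr_fun (congrFun ep y) v)).symm
  -- With `c_t`, `c_s` for `Ω^c` at target and source along `p`, what is left to compare is `Ad_{s₁}
  -- α_{s₂} c_t - α_{s₂} c_s` with `Ad_{s₁} α_{s₂}(c_t - c_s) + (Ad_{s₁} - 1) α_{s₂} c_s`.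
  simp only [fa, fb hp, fb hr, ct, cs, map_add, map_sub, hAd, htilde,
    Γ.isSmoothRep_actStar.map_mul, Γ.actStar_t, ContinuousLinearMap.comp_apply]
  refine (congrArg (· + _) key1).trans ?_
  change Ad s₁ (Γ.actStar s₂ _) + Γ.tildeStar s₁⁻¹ (Ad s₂ _) + _ = _
  abel

/-- The curvature of a gauge transform. -/

theorem pullback_curv_of_gauge (h : IsForm Γ I₀ I₁ X Ω) (hX : IsLieGroupoid I₀ I₁ X)
    (hYs : ContMDiff J₁ J₀ ∞ Y.src) (hYt : ContMDiff J₁ J₀ ∞ Y.tgt)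
    (hp : IsSmoothFunctor J₀ J₁ I₀ I₁ Y X p₀ p₁) (hr : IsSmoothFunctor J₀ J₁ I₀ I₁ Y X r₀ r₁)
    (hg : IsSmoothFunctor J₀ J₁ 𝓘(ℝ, EG) (𝓘(ℝ, EH).prod 𝓘(ℝ, EG)) Y Γ.gpd g₀ g₁)
    (e : pullback J₀ J₁ I₀ I₁ r₀ r₁ Ω = adjInv Γ J₀ J₁ Y g₀ g₁ (pullback J₀ J₁ I₀ I₁ p₀ p₁ Ω)
      + pullback J₀ J₁ 𝓘(ℝ, EG) (𝓘(ℝ, EH).prod 𝓘(ℝ, EG)) g₀ g₁ (Theta Γ)) :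
    pullback J₀ J₁ I₀ I₁ r₀ r₁ (curv Γ I₀ I₁ X Ω) =
      adjInv Γ J₀ J₁ Y g₀ g₁ (pullback J₀ J₁ I₀ I₁ p₀ p₁ (curv Γ I₀ I₁ X Ω)) := by
  have ec : DForm.pullback J₀ I₀ r₀ Ω.c = DForm.mapVal (fun x => Γ.actStar (g₀ x)⁻¹)
      (DForm.pullback J₀ I₀ p₀ Ω.c) := (congrArg GForm.c e).trans (add_zero _)
  exact GForm.ext
    (pullback_curv_a_of_gauge h hp.smooth_obj hr.smooth_obj hg.smooth_obj (congrArg GForm.a e) ec)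
    (pullback_curv_b_of_gauge h hX hYs hYt hp hr hg e)
    (pullback_curv_c_of_gauge h hp.smooth_obj hr.smooth_obj hg.smooth_obj (congrArg GForm.a e) ec)

end GForm

/-! ### Application to the action on a principal 2-bundle. -/

namespace PrincipalTwoBundle

variable {EG : Type*} [NormedAddCommGroup EG] [NormedSpace ℝ EG] [FiniteDimensional ℝ EG]
  {G : Type*} [TopologicalSpace G] [ChartedSpace EG G] [Group G] [LieGroup 𝓘(ℝ, EG) ∞ G]
  {EH : Type*} [NormedAddCommGroup EH] [NormedSpace ℝ EH] [FiniteDimensional ℝ EH]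
  {H : Type*} [TopologicalSpace H] [ChartedSpace EH H] [Group H] [LieGroup 𝓘(ℝ, EH) ∞ H]
  {Γ : CrossedModule EG G EH H}
  {EM : Type*} [NormedAddCommGroup EM] [NormedSpace ℝ EM]
  {M : Type*} [TopologicalSpace M] [ChartedSpace EM M]
  {E₀ : Type*} [NormedAddCommGroup E₀] [NormedSpace ℝ E₀] [FiniteDimensional ℝ E₀]
  {P₀ : Type*} [TopologicalSpace P₀] [ChartedSpace E₀ P₀] [IsManifold 𝓘(ℝ, E₀) ∞ P₀]
  {E₁ : Type*} [NormedAddCommGroup E₁] [NormedSpace ℝ E₁] [FiniteDimensional ℝ E₁]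
  {P₁ : Type*} [TopologicalSpace P₁] [ChartedSpace E₁ P₁] [IsManifold 𝓘(ℝ, E₁) ∞ P₁]
  (B : PrincipalTwoBundle Γ EM M E₀ P₀ E₁ P₁)

theorem isSmoothFunctor_fst : IsSmoothFunctor (𝓘(ℝ, E₀).prod 𝓘(ℝ, EG))
    (𝓘(ℝ, E₁).prod (𝓘(ℝ, EH).prod 𝓘(ℝ, EG))) 𝓘(ℝ, E₀) 𝓘(ℝ, E₁) (B.P.prod Γ.gpd) B.P
    Prod.fst Prod.fst where
  smooth_obj := contMDiff_fst
  smooth_mor := contMDiff_fst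
  src_map _ := rfl
  tgt_map _ := rfl
  map_one _ := rfl
  map_comp _ _ _ := rfl

theorem isSmoothFunctor_snd : IsSmoothFunctor (𝓘(ℝ, E₀).prod 𝓘(ℝ, EG))
    (𝓘(ℝ, E₁).prod (𝓘(ℝ, EH).prod 𝓘(ℝ, EG))) 𝓘(ℝ, EG) (𝓘(ℝ, EH).prod 𝓘(ℝ, EG))
    (B.P.prod Γ.gpd) Γ.gpd Prod.snd Prod.snd where
  smooth_obj := contMDiff_snd
  smooth_mor := contMDiff_snd
  src_map _ := rfl
  tgt_map _ := rfl
  map_one _ := rfl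
  map_comp _ _ _ := rfl

theorem contMDiff_prod_src : ContMDiff (𝓘(ℝ, E₁).prod (𝓘(ℝ, EH).prod 𝓘(ℝ, EG)))
    (𝓘(ℝ, E₀).prod 𝓘(ℝ, EG)) ∞ (B.P.prod Γ.gpd).src :=
  (B.isLieGroupoid.submersion_src.contMDiff.comp contMDiff_fst).prodMk
    (contMDiff_snd.comp contMDiff_snd)

theorem contMDiff_prod_tgt : ContMDiff (𝓘(ℝ, E₁).prod (𝓘(ℝ, EH).prod 𝓘(ℝ, EG)))
    (𝓘(ℝ, E₀).prod 𝓘(ℝ, EG)) ∞ (B.P.prod Γ.gpd).tgt :=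
  (B.isLieGroupoid.submersion_tgt.contMDiff.comp contMDiff_fst).prodMk
    ((Γ.smooth_t.comp (contMDiff_fst.comp contMDiff_snd)).mul
      (contMDiff_snd.comp contMDiff_snd))

/-- Over `P × Γ`, the connection condition says that `R^*Ω` is the gauge transform of `pr_P^*Ω` by
the functor `pr_Γ`. -/
theorem pullR_curv {Ω : GForm E₀ P₀ E₁ P₁ EG EH 1} (hΩ : B.IsConnection Ω) :
    B.pullR (B.curv Ω) = B.adPull (B.curv Ω) :=
  GForm.pullback_curv_of_gauge hΩ.isForm B.isLieGroupoid B.contMDiff_prod_src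
    B.contMDiff_prod_tgt B.isSmoothFunctor_fst B.R_functor B.isSmoothFunctor_snd hΩ.equivariant

end PrincipalTwoBundle
end TwoBundle

end

/-- The curvature of a connection on a principal 2-bundle is a `γ`-valued 2-form, satisfies the
Bianchi identity, and is equivariant. -/

theorem mainTheorem4
    {EG : Type*} [NormedAddCommGroup EG] [NormedSpace ℝ EG] [FiniteDimensional ℝ EG]
    {G : Type*} [TopologicalSpace G] [T2Space G] [SecondCountableTopology G]
    [ChartedSpace EG G] [Group G] [LieGroup 𝓘(ℝ, EG) ∞ G]
    {EH : Type*} [NormedAddCommGroup EH] [NormedSpace ℝ EH] [FiniteDimensional ℝ EH]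
    {H : Type*} [TopologicalSpace H] [T2Space H] [SecondCountableTopology H]
    [ChartedSpace EH H] [Group H] [LieGroup 𝓘(ℝ, EH) ∞ H]
    (Γ : TwoBundle.CrossedModule EG G EH H)
    {EM : Type*} [NormedAddCommGroup EM] [NormedSpace ℝ EM] [FiniteDimensional ℝ EM]
    {M : Type*} [TopologicalSpace M] [T2Space M] [SecondCountableTopology M]
    [ChartedSpace EM M] [IsManifold 𝓘(ℝ, EM) ∞ M]
    {E₀ : Type*} [NormedAddCommGroup E₀] [NormedSpace ℝ E₀] [FiniteDimensional ℝ E₀]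
    {P₀ : Type*} [TopologicalSpace P₀] [T2Space P₀] [SecondCountableTopology P₀]
    [ChartedSpace E₀ P₀] [IsManifold 𝓘(ℝ, E₀) ∞ P₀]
    {E₁ : Type*} [NormedAddCommGroup E₁] [NormedSpace ℝ E₁] [FiniteDimensional ℝ E₁]
    {P₁ : Type*} [TopologicalSpace P₁] [T2Space P₁] [SecondCountableTopology P₁]
    [ChartedSpace E₁ P₁] [IsManifold 𝓘(ℝ, E₁) ∞ P₁]
    (B : TwoBundle.PrincipalTwoBundle Γ EM M E₀ P₀ E₁ P₁)
    (Ω : TwoBundle.GForm E₀ P₀ E₁ P₁ EG EH 1)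
    (hΩ : B.IsConnection Ω) :
    TwoBundle.GForm.IsForm Γ 𝓘(ℝ, E₀) 𝓘(ℝ, E₁) B.P (B.curv Ω) ∧
    TwoBundle.GForm.D Γ 𝓘(ℝ, E₀) 𝓘(ℝ, E₁) B.P (B.curv Ω) =
      TwoBundle.GForm.bracket Γ 𝓘(ℝ, E₀) 𝓘(ℝ, E₁) B.P (B.curv Ω) Ω ∧
    B.pullR (B.curv Ω) = B.adPull (B.curv Ω) := by
  exact ⟨TwoBundle.GForm.isForm_curv B.isLieGroupoid hΩ.isForm,
    TwoBundle.GForm.bianchi B.isLieGroupoid hΩ.isForm, B.pullR_curv hΩ⟩
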